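/- Conventions. A BL-algebra is a bounded commutative integral residuated lattice $(L,\wedge,\vee,\otimes,\to,0,1)$ with $x\wedge y=x\otimes(x\to y)$ and $(x\to y)\vee(y\to x)=1$; write $\bar x=x\to 0$ and $x+y=(\bar x\to y)\wedge(\bar y\to x)$. Let $\mathcal{BL}$ be the category of BL-algebras and their homomorphisms, and $\mathcal{LU}$ the category of abelian lattice-ordered groups $\langle G,u\rangle$ with strong unit $u$, with unit-preserving lattice-group homomorphisms. A good sequence in $L$ is a sequence $\mathbf a=(a_1,a_2,\dots)$ in $L$ with $a_i+a_{i+1}=a_i$ for all $i$ and $a_i=0$ for all large $i$; $(a)$ denotes $(a,0,0,\dots)$. The sum of good sequences is $(\mathbf a+\mathbf b)_i=a_i+(a_{i-1}\otimes b_1)+\dots+(a_1\otimes b_{i-1})+b_i$, and their order is componentwise. On the set $M_L$ of good sequences, put $(\mathbf a,\mathbf b)\sim(\mathbf c,\mathbf d)$ if $(\mathbf a+\mathbf d)+\mathbf k=(\mathbf b+\mathbf c)+\mathbf k$ for some $\mathbf k\in M_L$. Chang's group of $L$ is $G_L=(M_L\times M_L)/{\sim}$ with $[\mathbf a,\mathbf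 b]+[\mathbf c,\mathbf d]=[\mathbf a+\mathbf c,\mathbf b+\mathbf d]$, ordered by $[\mathbf a,\mathbf b]\preceq[\mathbf c,\mathbf d]$ iff $(\mathbf a+\mathbf d)+\mathbf k\le(\mathbf b+\mathbf c)+\mathbf k$ for some $\mathbf k\in M_L$; it is an abelian lattice-ordered group with strong unit $u_L=[(1),(0)]$. Let $\Xi:\mathcal{BL}\to\mathcal{LU}$ be the functor $L\mapsto\langle G_L,u_L\rangle$, $\Xi(f)([\mathbf a,\mathbf b])=[f(\mathbf a),f(\mathbf b)]$ (with $f$ applied componentwise). Let $\Gamma:\mathcal{LU}\to\mathcal{BL}$ be Mundici's functor, $\Gamma\langle G,u\rangle=[0,u]$ with $x\otimes y=u-(2u-x-y)\wedge u$ and $x\to y=(u-x+y)\wedge u$, acting on morphisms by restriction. Theorem. 1. Neither $\Xi\dashv\Gamma$ nor $\Gamma\dashv\Xi$ holds: the two functors do not form an adjoint pair, in either order. 2. Let $L=[0,1]$ be the product algebra ($x\otimes y=xy$; $x\to y=1$ if $x\le y$ and $y/x$ otherwise), and let $\mathbf G=\langle\mathbb Z\times_{lex}\mathbb R_+,(1,1)\rangle$,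 where $\mathbb R_+$ is the multiplicative group of positive reals. Then $\Xi L\cong\mathbf G$ and: (i) $Hom(L,\Gamma\mathbf G)$ is a singleton; (ii) $Hom(\Xi L,\mathbf G)$ has at least two elements: under an identification of $\Xi L$ with $\mathbf G$, the identity and $(m,x)\mapsto(m,1)$; (iii) $Hom(\Gamma\mathbf G,L)$ is a singleton, its only element being the map with $(m,x)\mapsto 0$ if $m=0$ and $(m,x)\mapsto 1$ if $m=1$; (iv) $Hom(\mathbf G,\Xi L)$ has at least two elements. Consequently there is no bijection between $Hom(\Xi L,\mathbf G)$ and $Hom(L,\Gamma\mathbf G)$, and there is no bijection between $Hom(\Gamma\mathbf G,L)$ and $Hom(\mathbf G,\Xi L)$. 3. Nevertheless, $\eta_L(a)=[(\bar{\bar a}),(0)]$ defines a natural transformation $\eta:1_{\mathcal{BL}}\to\Gamma\Xi$ such that for every BL-algebra $L$, every $\langle G,u\rangle$ in $\mathcal{LU}$ and every morphism $f:L\to\Gamma\langle G,u\rangle$ in $\mathcal{BL}$ there is a morphism $g:\Xi L\to\langle G,u\rangle$ with $\Gamma(g)\,\eta_L=f$. The morphism $g$ is not unique in general: for $L$ and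 $\mathbf G$ as in 2 there are a morphism $f:L\to\Gamma\mathbf G$ and two different morphisms $g:\Xi L\to\mathbf G$ with $\Gamma(g)\,\eta_L=f$. -/

import Mathlib

open CategoryTheory

universe u

/-- A BL-algebra `(L, ⊓, ⊔, *, imp, 0, 1)`: a bounded commutative integral residuated lattice
that is divisible and prelinear. The monoid operation `⊗` is written `*`. -/
class BLAlgebra (L : Type u) extends Lattice L, CommMonoid L, Zero L where
  /-- the residuum -/
  imp : L → L → L
  zero_le_all : ∀ x : L, 0 ≤ x
  le_one_all : ∀ x : L, x ≤ 1
  le_imp_iff : ∀ x y z : L, z ≤ imp x y ↔ x * z ≤ y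
  inf_eq : ∀ x y : L, x ⊓ y = x * imp x y
  prelinear : ∀ x y : L, imp x y ⊔ imp y x = 1

/-- Homomorphisms of BL-algebras. (They preserve the lattice operations, because these are terms
in `*` and `imp`.) -/
@[ext]
structure BLHom (L M : Type u) [BLAlgebra L] [BLAlgebra M] where
  toFun : L → M
  map_mul : ∀ x y, toFun (x * y) = toFun x * toFun y
  map_imp : ∀ x y, toFun (BLAlgebra.imp x y) = BLAlgebra.imp (toFun x) (toFun y)
  map_zero : toFun 0 = 0
  map_one : toFun 1 = 1

namespace BLAlgebra

section Basic
variable {L : Type u} [BLAlgebra L]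

/-- The complement `x̄ = x → 0`. -/
def cpl (x : L) : L := imp x 0

theorem le_antisymm_iff_all {x y : L} (h : ∀ z : L, z ≤ x ↔ z ≤ y) : x = y :=
  le_antisymm ((h x).1 le_rfl) ((h y).2 le_rfl)

theorem mul_imp_le (x y : L) : x * imp x y ≤ y := (le_imp_iff _ _ _).1 le_rfl

theorem mul_mono_right {x y : L} (z : L) (h : x ≤ y) : z * x ≤ z * y :=
  (le_imp_iff _ _ _).1 (h.trans ((le_imp_iff _ _ _).2 le_rfl))

theorem mul_mono {a b c d : L} (h : a ≤ b) (k : c ≤ d) : a * c ≤ b * d := by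
  refine (mul_mono_right a k).trans ?_
  rw [mul_comm a, mul_comm b]
  exact mul_mono_right d h

theorem mul_le_l (x y : L) : x * y ≤ x := by
  simpa using mul_mono_right x (le_one_all y)

theorem mul_le_r (x y : L) : x * y ≤ y := by
  rw [mul_comm]; exact mul_le_l y x

theorem imp_eq_one {x y : L} : imp x y = 1 ↔ x ≤ y := by
  constructor
  · intro h
    have := mul_imp_le x y
    rwa [h, mul_one] at this
  · intro h
    refine le_antisymm (le_one_all _) ((le_imp_iff _ _ _).2 (by simpa using h))

theorem one_le {x : L} : 1 ≤ x ↔ x = 1 :=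
  ⟨fun h => le_antisymm (le_one_all _) h, fun h => h ▸ le_rfl⟩

theorem le_zero {x : L} : x ≤ 0 ↔ x = 0 :=
  ⟨fun h => le_antisymm h (zero_le_all _), fun h => h ▸ le_rfl⟩

theorem imp_self (x : L) : imp x x = 1 := imp_eq_one.2 le_rfl

theorem one_imp (x : L) : imp 1 x = x :=
  le_antisymm_iff_all fun z => by rw [le_imp_iff, one_mul]

theorem imp_one (x : L) : imp x 1 = 1 := imp_eq_one.2 (le_one_all _)

theorem zero_imp (x : L) : imp 0 x = 1 := imp_eq_one.2 (zero_le_all _)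

theorem imp_imp (x y z : L) : imp x (imp y z) = imp (x * y) z :=
  le_antisymm_iff_all fun w => by
    rw [le_imp_iff, le_imp_iff, le_imp_iff]
    have : y * (x * w) = x * y * w := by rw [mul_left_comm, mul_assoc]
    rw [this]

theorem imp_mono {x y : L} (z : L) (h : x ≤ y) : imp z x ≤ imp z y :=
  (le_imp_iff _ _ _).2 ((mul_imp_le z x).trans h)

theorem imp_anti {x y : L} (z : L) (h : x ≤ y) : imp y z ≤ imp x z :=
  (le_imp_iff _ _ _).2 ((mul_mono h le_rfl).trans (mul_imp_le y z))

theorem imp_trans (x y z : L) : imp x y * imp y z ≤ imp x z := by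
  rw [le_imp_iff, ← mul_assoc]
  exact (mul_mono (mul_imp_le x y) le_rfl).trans (mul_imp_le y z)

theorem mul_sup (x y z : L) : x * (y ⊔ z) = x * y ⊔ x * z := by
  apply le_antisymm
  · rw [← le_imp_iff]
    refine sup_le ?_ ?_ <;> rw [le_imp_iff]
    · exact le_sup_left
    · exact le_sup_right
  · exact sup_le (mul_mono_right _ le_sup_left) (mul_mono_right _ le_sup_right)

theorem sup_eq (x y : L) : x ⊔ y = imp (imp x y) y ⊓ imp (imp y x) x := by
  apply le_antisymm
  · refine sup_le (le_inf ?_ ?_) (le_inf ?_ ?_) <;> rw [le_imp_iff]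
    · rw [mul_comm]; exact mul_imp_le _ _
    · exact mul_le_r _ _
    · exact mul_le_r _ _
    · rw [mul_comm]; exact mul_imp_le _ _
  · set w := imp (imp x y) y ⊓ imp (imp y x) x with hw
    have h1 : w * (imp x y ⊔ imp y x) = w := by rw [prelinear, mul_one]
    rw [← h1, mul_sup]
    refine sup_le ?_ ?_
    · refine le_trans ?_ le_sup_right
      rw [mul_comm, ← le_imp_iff]; exact inf_le_left
    · refine le_trans ?_ le_sup_left
      rw [mul_comm, ← le_imp_iff]; exact inf_le_right

theorem cpl_anti {x y : L} (h : x ≤ y) : cpl y ≤ cpl x := imp_anti 0 h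

theorem le_cpl {x y : L} : x ≤ cpl y ↔ y * x = 0 := by
  rw [cpl, le_imp_iff, le_zero]

theorem mul_cpl (x : L) : x * cpl x = 0 := le_cpl.1 le_rfl

theorem le_cpl_cpl (x : L) : x ≤ cpl (cpl x) := by
  rw [le_cpl, mul_comm, mul_cpl]

theorem cpl_cpl_cpl (x : L) : cpl (cpl (cpl x)) = cpl x :=
  le_antisymm (cpl_anti (le_cpl_cpl x)) (le_cpl_cpl _)

theorem cpl_zero : cpl (0 : L) = 1 := imp_self 0

theorem cpl_one : cpl (1 : L) = 0 := one_imp 0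

theorem imp_cpl (x y : L) : imp x (cpl y) = cpl (x * y) := imp_imp x y 0

theorem mul_zero_all (x : L) : x * 0 = 0 := le_zero.1 (mul_le_r _ _)

theorem zero_mul_all (x : L) : 0 * x = 0 := le_zero.1 (mul_le_l _ _)

theorem cpl_eq_one {x : L} : cpl x = 1 ↔ x = 0 := by
  rw [cpl, imp_eq_one, le_zero]

end Basic

end BLAlgebra

namespace BLHom
open BLAlgebra
variable {L M N : Type u} [BLAlgebra L] [BLAlgebra M] [BLAlgebra N]

theorem map_inf (f : BLHom L M) (x y : L) : f.toFun (x ⊓ y) = f.toFun x ⊓ f.toFun y := by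
  rw [inf_eq, inf_eq, f.map_mul, f.map_imp]

theorem map_sup (f : BLHom L M) (x y : L) : f.toFun (x ⊔ y) = f.toFun x ⊔ f.toFun y := by
  rw [sup_eq, sup_eq, f.map_inf, f.map_imp, f.map_imp, f.map_imp, f.map_imp]

theorem map_cpl (f : BLHom L M) (x : L) : f.toFun (cpl x) = cpl (f.toFun x) := by
  rw [cpl, cpl, f.map_imp, f.map_zero]

theorem map_le (f : BLHom L M) {x y : L} (h : x ≤ y) : f.toFun x ≤ f.toFun y := by
  rw [← imp_eq_one] at h ⊢
  rw [← f.map_imp, h, f.map_one]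

/-- The identity homomorphism. -/
def id (L : Type u) [BLAlgebra L] : BLHom L L where
  toFun x := x
  map_mul _ _ := rfl
  map_imp _ _ := rfl
  map_zero := rfl
  map_one := rfl

/-- `g ∘ f` -/
def comp (g : BLHom M N) (f : BLHom L M) : BLHom L N where
  toFun x := g.toFun (f.toFun x)
  map_mul x y := by rw [f.map_mul, g.map_mul]
  map_imp x y := by rw [f.map_imp, g.map_imp]
  map_zero := by rw [f.map_zero, g.map_zero]
  map_one := by rw [f.map_one, g.map_one]

end BLHom

/-! Helper facts: every BL-algebra is a subdirect product of BL-chains. -/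

namespace BLAlgebra

section Filters
variable {L : Type u} [BLAlgebra L]

/-- Filters of a BL-algebra. -/
structure IsFilt (F : Set L) : Prop where
  one_mem : 1 ∈ F
  mul_mem : ∀ {x y}, x ∈ F → y ∈ F → x * y ∈ F
  up : ∀ {x y}, x ∈ F → x ≤ y → y ∈ F

theorem IsFilt.imp_mem {F : Set L} (hF : IsFilt F) {x y : L} (h : x ≤ y) : imp x y ∈ F := by
  rw [imp_eq_one.2 h]; exact hF.one_mem

theorem IsFilt.trans {F : Set L} (hF : IsFilt F) {x y z : L} (h : imp x y ∈ F)
    (k : imp y z ∈ F) : imp x z ∈ F :=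
  hF.up (hF.mul_mem h k) (imp_trans x y z)

/-- The congruence of a filter. -/
def filtSetoid (F : Set L) (hF : IsFilt F) : Setoid L where
  r x y := imp x y ∈ F ∧ imp y x ∈ F
  iseqv :=
    { refl := fun _ => ⟨hF.imp_mem le_rfl, hF.imp_mem le_rfl⟩
      symm := fun h => ⟨h.2, h.1⟩
      trans := fun h k => ⟨hF.trans h.1 k.1, hF.trans k.2 h.2⟩ }

/-- The quotient by a filter. -/
def FiltQuot (F : Set L) (hF : IsFilt F) : Type u := Quotient (filtSetoid F hF)

theorem IsFilt.inf_mem {F : Set L} (hF : IsFilt F) {x y z : L} (h : imp x y ∈ F)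
    (k : imp x z ∈ F) : imp x (y ⊓ z) ∈ F := by
  refine hF.up (hF.mul_mem h k) ?_
  rw [le_imp_iff]
  refine le_inf ?_ ?_
  · exact (mul_mono le_rfl (mul_le_l _ _)).trans (mul_imp_le _ _)
  · exact (mul_mono le_rfl (mul_le_r _ _)).trans (mul_imp_le _ _)

theorem IsFilt.sup_mem {F : Set L} (hF : IsFilt F) {x y z : L} (h : imp x z ∈ F)
    (k : imp y z ∈ F) : imp (x ⊔ y) z ∈ F := by
  refine hF.up (hF.mul_mem h k) ?_
  rw [le_imp_iff, mul_comm, mul_sup]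
  refine sup_le ?_ ?_ <;> rw [mul_comm]
  · exact (mul_mono le_rfl (mul_le_l _ _)).trans (mul_imp_le _ _)
  · exact (mul_mono le_rfl (mul_le_r _ _)).trans (mul_imp_le _ _)

theorem IsFilt.mul_congr {F : Set L} (hF : IsFilt F) {x y z w : L} (h : imp x y ∈ F)
    (k : imp z w ∈ F) : imp (x * z) (y * w) ∈ F := by
  refine hF.up (hF.mul_mem h k) ?_
  rw [le_imp_iff, mul_mul_mul_comm]
  exact mul_mono (mul_imp_le _ _) (mul_imp_le _ _)

theorem IsFilt.imp_congr {F : Set L} (hF : IsFilt F) {x y z w : L} (h : imp y x ∈ F)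
    (k : imp z w ∈ F) : imp (imp x z) (imp y w) ∈ F := by
  refine hF.up (hF.mul_mem h k) ?_
  rw [le_imp_iff, le_imp_iff]
  have : y * (imp x z * (imp y x * imp z w)) = ((y * imp y x) * imp x z) * imp z w := by
    simp only [mul_assoc, mul_left_comm]
  rw [this]
  refine (mul_mono ?_ le_rfl).trans (mul_imp_le z w)
  exact (mul_mono (mul_imp_le _ _) le_rfl).trans (mul_imp_le _ _)

instance (F : Set L) (hF : IsFilt F) : LE (FiltQuot F hF) where
  le := Quotient.lift₂ (fun x y => imp x y ∈ F) (by
    intro a b c d h k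
    exact propext ⟨fun t => hF.trans h.2 (hF.trans t k.1), fun t => hF.trans h.1 (hF.trans t k.2)⟩)

instance (F : Set L) (hF : IsFilt F) : BLAlgebra (FiltQuot F hF) where
  le_refl := by rintro ⟨x⟩; exact hF.imp_mem le_rfl
  le_trans := by rintro ⟨x⟩ ⟨y⟩ ⟨z⟩ h k; exact hF.trans h k
  le_antisymm := by rintro ⟨x⟩ ⟨y⟩ h k; exact Quotient.sound ⟨h, k⟩
  sup := Quotient.map₂ (· ⊔ ·) (by
    intro a b h c d k
    exact ⟨hF.sup_mem (hF.trans h.1 (hF.imp_mem le_sup_left))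
        (hF.trans k.1 (hF.imp_mem le_sup_right)),
      hF.sup_mem (hF.trans h.2 (hF.imp_mem le_sup_left))
        (hF.trans k.2 (hF.imp_mem le_sup_right))⟩)
  inf := Quotient.map₂ (· ⊓ ·) (by
    intro a b h c d k
    exact ⟨hF.inf_mem (hF.trans (hF.imp_mem inf_le_left) h.1)
        (hF.trans (hF.imp_mem inf_le_right) k.1),
      hF.inf_mem (hF.trans (hF.imp_mem inf_le_left) h.2)
        (hF.trans (hF.imp_mem inf_le_right) k.2)⟩)
  le_sup_left := by rintro ⟨x⟩ ⟨y⟩; exact hF.imp_mem le_sup_left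
  le_sup_right := by rintro ⟨x⟩ ⟨y⟩; exact hF.imp_mem le_sup_right
  sup_le := by rintro ⟨x⟩ ⟨y⟩ ⟨z⟩ h k; exact hF.sup_mem h k
  inf_le_left := by rintro ⟨x⟩ ⟨y⟩; exact hF.imp_mem inf_le_left
  inf_le_right := by rintro ⟨x⟩ ⟨y⟩; exact hF.imp_mem inf_le_right
  le_inf := by rintro ⟨x⟩ ⟨y⟩ ⟨z⟩ h k; exact hF.inf_mem h k
  mul := Quotient.map₂ (· * ·) (by
    intro a b h c d k
    exact ⟨hF.mul_congr h.1 k.1, hF.mul_congr h.2 k.2⟩)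
  one := Quotient.mk _ 1
  zero := Quotient.mk _ 0
  imp := Quotient.map₂ imp (by
    intro a b h c d k
    exact ⟨hF.imp_congr h.2 k.1, hF.imp_congr h.1 k.2⟩)
  mul_assoc := by
    rintro ⟨x⟩ ⟨y⟩ ⟨z⟩; exact congrArg (Quotient.mk (filtSetoid F hF)) (mul_assoc x y z)
  mul_comm := by
    rintro ⟨x⟩ ⟨y⟩; exact congrArg (Quotient.mk (filtSetoid F hF)) (mul_comm x y)
  one_mul := by rintro ⟨x⟩; exact congrArg (Quotient.mk (filtSetoid F hF)) (one_mul x)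
  mul_one := by rintro ⟨x⟩; exact congrArg (Quotient.mk (filtSetoid F hF)) (mul_one x)
  zero_le_all := by rintro ⟨x⟩; exact hF.imp_mem (zero_le_all x)
  le_one_all := by rintro ⟨x⟩; exact hF.imp_mem (le_one_all x)
  le_imp_iff := by
    rintro ⟨x⟩ ⟨y⟩ ⟨z⟩
    change imp z (imp x y) ∈ F ↔ imp (x * z) y ∈ F
    rw [imp_imp, mul_comm]
  inf_eq := by
    rintro ⟨x⟩ ⟨y⟩; exact congrArg (Quotient.mk (filtSetoid F hF)) (inf_eq x y)
  prelinear := by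
    rintro ⟨x⟩ ⟨y⟩; exact congrArg (Quotient.mk (filtSetoid F hF)) (prelinear x y)

/-- The quotient map. -/
def filtMk (F : Set L) (hF : IsFilt F) : BLHom L (FiltQuot F hF) where
  toFun x := Quotient.mk _ x
  map_mul _ _ := rfl
  map_imp _ _ := rfl
  map_zero := rfl
  map_one := rfl

theorem sup_pow {p q : L} (h : p ⊔ q = 1) (n : ℕ) : p ⊔ q ^ n = 1 := by
  induction n with
  | zero => rw [pow_zero]; exact one_le.1 le_sup_right
  | succ n ih =>
    have h1 : (p ⊔ q ^ n) * (p ⊔ q) = 1 := by rw [h, ih, mul_one]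
    rw [← one_le, ← h1, mul_sup]
    refine sup_le ((mul_le_r _ _).trans le_sup_left) ?_
    rw [mul_comm, mul_sup, pow_succ, mul_comm q (q ^ n)]
    exact sup_le ((mul_le_r _ _).trans le_sup_left) le_sup_right

theorem pow_anti (p : L) {m n : ℕ} (h : m ≤ n) : p ^ n ≤ p ^ m := by
  obtain ⟨k, rfl⟩ := Nat.exists_eq_add_of_le h
  rw [pow_add]; exact mul_le_l _ _

theorem exists_prime (g : L) (hg : g ≠ 1) :
    ∃ F : Set L, IsFilt F ∧ g ∉ F ∧ ∀ x y, imp x y ∈ F ∨ imp y x ∈ F := by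
  obtain ⟨F, -, hmax⟩ := zorn_subset_nonempty {F : Set L | IsFilt F ∧ g ∉ F} (by
    intro c hc hch hne
    refine ⟨⋃₀ c, ⟨⟨?_, ?_, ?_⟩, ?_⟩, fun s hs => Set.subset_sUnion_of_mem hs⟩
    · obtain ⟨s, hs⟩ := hne
      exact ⟨s, hs, (hc hs).1.one_mem⟩
    · rintro x y ⟨s, hs, hx⟩ ⟨t, ht, hy⟩
      rcases hch.total hs ht with h | h
      · exact ⟨t, ht, (hc ht).1.mul_mem (h hx) hy⟩
      · exact ⟨s, hs, (hc hs).1.mul_mem hx (h hy)⟩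
    · rintro x y ⟨s, hs, hx⟩ h
      exact ⟨s, hs, (hc hs).1.up hx h⟩
    · rintro ⟨s, hs, hx⟩
      exact (hc hs).2 hx) {1} ⟨⟨rfl, by rintro x y rfl rfl; exact mul_one 1, by
        rintro _ y rfl h; exact one_le.1 h⟩, hg⟩
  have hF := hmax.prop.1
  have hgF := hmax.prop.2
  refine ⟨F, hF, hgF, ?_⟩
  have key : ∀ p, p ∉ F → ∃ f ∈ F, ∃ n : ℕ, f * p ^ n ≤ g := by
    intro p hp
    by_contra hcon
    push Not at hcon
    have hfil : IsFilt {r : L | ∃ f ∈ F, ∃ n : ℕ, f * p ^ n ≤ r} := by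
      refine ⟨⟨1, hF.one_mem, 0, by simp⟩, ?_, ?_⟩
      · rintro x y ⟨f, hf, n, h⟩ ⟨f', hf', n', h'⟩
        refine ⟨f * f', hF.mul_mem hf hf', n + n', ?_⟩
        rw [pow_add, mul_mul_mul_comm]
        exact mul_mono h h'
      · rintro x y ⟨f, hf, n, h⟩ hxy
        exact ⟨f, hf, n, h.trans hxy⟩
    have hsub : F ⊆ {r : L | ∃ f ∈ F, ∃ n : ℕ, f * p ^ n ≤ r} :=
      fun f hf => ⟨f, hf, 0, by simp⟩
    have hle := hmax.le_of_ge (y := {r : L | ∃ f ∈ F, ∃ n : ℕ, f * p ^ n ≤ r})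
      ⟨hfil, by rintro ⟨f, hf, n, h⟩; exact hcon f hf n h⟩ hsub
    exact hp (hle ⟨1, hF.one_mem, 1, by simp⟩)
  intro x y
  by_contra hcon
  push Not at hcon
  obtain ⟨f, hf, n, h⟩ := key _ hcon.1
  obtain ⟨f', hf', n', h'⟩ := key _ hcon.2
  refine hgF (hF.up (hF.mul_mem hf hf') ?_)
  have h1 : imp x y ^ n ⊔ imp y x ^ n' = 1 := by
    refine sup_pow ?_ n'
    rw [sup_comm]
    refine sup_pow ?_ n
    rw [sup_comm]; exact prelinear x y
  rw [← mul_one (f * f'), ← h1, mul_sup]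
  refine sup_le ?_ ?_
  · exact (mul_mono (mul_le_l _ _) le_rfl).trans h
  · exact (mul_mono (mul_le_r _ _) le_rfl).trans h'

end Filters

/-- Nontrivial BL-chains. -/
structure IsBLChain (C : Type u) [BLAlgebra C] : Prop where
  total : ∀ x y : C, x ≤ y ∨ y ≤ x
  zero_ne : (0 : C) ≠ 1

theorem le_of_chain {L : Type u} [BLAlgebra L] {x y : L}
    (h : ∀ (C : Type u) [BLAlgebra C], IsBLChain C → ∀ π : BLHom L C, π.toFun x ≤ π.toFun y) :
    x ≤ y := by
  by_contra hxy
  obtain ⟨F, hF, hg, hp⟩ := exists_prime (imp x y) (fun t => hxy (imp_eq_one.1 t))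
  refine hg (h (FiltQuot F hF) ⟨?_, ?_⟩ (filtMk F hF))
  · rintro ⟨a⟩ ⟨b⟩; exact hp a b
  · intro h0
    apply hg
    have h1 : imp 1 0 ∈ F := (Quotient.exact h0).2
    rw [one_imp] at h1
    exact hF.up h1 (zero_le_all _)

theorem eq_of_chain {L : Type u} [BLAlgebra L] {x y : L}
    (h : ∀ (C : Type u) [BLAlgebra C], IsBLChain C → ∀ π : BLHom L C, π.toFun x = π.toFun y) :
    x = y :=
  le_antisymm (le_of_chain fun C _ hC π => (h C hC π).le)
    (le_of_chain fun C _ hC π => (h C hC π).ge)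

end BLAlgebra

namespace BLAlgebra

/-- The algebraic addition `x + y = (x̄ → y) ∧ (ȳ → x)`. -/
instance instAddBL {L : Type u} [BLAlgebra L] : Add L where
  add x y := imp (cpl x) y ⊓ imp (cpl y) x

section Plus
variable {L : Type u} [BLAlgebra L]

theorem plus_def (x y : L) : x + y = imp (cpl x) y ⊓ imp (cpl y) x := rfl

theorem plus_comm (x y : L) : x + y = y + x := inf_comm _ _

theorem plus_zero (x : L) : x + 0 = x := by
  rw [plus_def, cpl_zero, one_imp]
  exact inf_eq_right.2 (le_cpl_cpl x)

theorem plus_one (x : L) : x + 1 = 1 := by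
  rw [plus_def, imp_one, cpl_one, zero_imp, inf_idem]

theorem one_plus (x : L) : 1 + x = 1 := by rw [plus_comm, plus_one]

theorem plus_mono {x y z w : L} (h : x ≤ y) (k : z ≤ w) : x + z ≤ y + w :=
  inf_le_inf ((imp_mono _ k).trans (imp_anti _ (cpl_anti h)))
    ((imp_mono _ h).trans (imp_anti _ (cpl_anti k)))

theorem le_plus_left (x y : L) : x ≤ x + y := by
  have := plus_mono (le_refl x) (zero_le_all y)
  rwa [plus_zero] at this

theorem le_plus_right (x y : L) : y ≤ x + y := by
  rw [plus_comm]; exact le_plus_left y x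

theorem cpl_imp_cpl_cpl (x : L) : cpl (imp (cpl (cpl x)) x) = 0 := by
  set e := imp (cpl (cpl x)) x with he
  have h1 : cpl e ≤ cpl (cpl x) := by
    apply cpl_anti
    rw [← cpl_cpl_cpl x]
    exact imp_mono _ (zero_le_all x)
  have hx : cpl (cpl x) * e = x := by rw [he, ← inf_eq]; exact inf_eq_right.2 (le_cpl_cpl x)
  have ht : cpl (cpl x) * imp (cpl (cpl x)) (cpl e) = cpl e := by
    rw [← inf_eq]; exact inf_eq_right.2 h1
  set s := imp (cpl (cpl x)) (cpl e) with hs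
  have h2 : s ≤ cpl x := by
    rw [le_cpl]
    calc x * s = cpl (cpl x) * e * s := (congrArg (· * s) hx).symm
      _ = cpl (cpl x) * s * e := mul_right_comm _ _ _
      _ = 0 := by rw [ht, mul_comm, mul_cpl]
  rw [← ht, ← le_zero]
  refine (mul_mono_right _ h2).trans ?_
  rw [mul_comm, mul_cpl]

theorem low_plus {x y : L} (hx : cpl (cpl x) = x) (hy : cpl (cpl y) = y) :
    x + y = cpl (cpl x * cpl y) := by
  rw [plus_def, ← imp_cpl, hy, ← inf_idem (imp (cpl x) y)]
  congr 1
  · exact inf_idem _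
  · nth_rw 1 [← hx]
    nth_rw 2 [← hy]
    rw [imp_cpl, imp_cpl, mul_comm]

theorem low_plus_left {x y : L} (hx : cpl (cpl x) = x) (hy : cpl (cpl y) = y) :
    x + y = imp (cpl x) y := by
  rw [low_plus hx hy, ← imp_cpl, hy]

theorem plus_low {x y : L} (hx : cpl (cpl x) = x) (hy : cpl (cpl y) = y) :
    cpl (cpl (x + y)) = x + y := by
  rw [low_plus hx hy, cpl_cpl_cpl]

end Plus

namespace IsBLChain
variable {C : Type u} [BLAlgebra C]

theorem le_of_not (hC : IsBLChain C) {x y : C} (h : ¬ x ≤ y) : y ≤ x :=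
  (hC.total x y).resolve_left h

theorem low_cases (hC : IsBLChain C) {e x : C} (he : cpl e = 0) (hx : cpl x ≠ 0)
    (hxx : cpl (cpl x) = x) : e * x = x := by
  have h1 : imp e x = x := by
    conv_lhs => rw [← hxx, imp_cpl, mul_comm, ← imp_cpl, he]
    exact hxx
  have h2 : x ≤ e := by
    refine hC.le_of_not fun h => hx ?_
    have := cpl_anti h
    rw [he] at this
    exact le_zero.1 this
  have h3 := inf_eq e x
  rw [h1] at h3
  rw [← h3]; exact inf_eq_right.2 h2

theorem low (hC : IsBLChain C) {x : C} (hx : cpl x ≠ 0) : cpl (cpl x) = x := by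
  have h := hC.low_cases (e := imp (cpl (cpl x)) x) (x := cpl (cpl x)) (cpl_imp_cpl_cpl x)
    (by rwa [cpl_cpl_cpl]) (by rw [cpl_cpl_cpl])
  rw [mul_comm, ← inf_eq, inf_eq_right.2 (le_cpl_cpl x)] at h
  exact h.symm

theorem high_mul (hC : IsBLChain C) {e x : C} (he : cpl e = 0) (hx : cpl x ≠ 0) : e * x = x :=
  hC.low_cases he hx (hC.low hx)

theorem mul_high (hC : IsBLChain C) {e x : C} (he : cpl e = 0) (hx : cpl x ≠ 0) : x * e = x := by
  rw [mul_comm]; exact hC.high_mul he hx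

theorem high_mul_high {e f : C} (he : cpl e = 0) (hf : cpl f = 0) : cpl (e * f) = 0 := by
  rw [← imp_cpl, hf]; exact he

theorem ne_zero_of_high (hC : IsBLChain C) {e : C} (he : cpl e = 0) : e ≠ 0 := by
  rintro rfl
  rw [cpl_zero] at he
  exact hC.zero_ne he.symm

theorem mul_high_ne {e x : C} (he : cpl e = 0) (hx : x ≠ 0) : x * e ≠ 0 := by
  intro h
  rw [mul_comm] at h
  have := le_cpl.2 h
  rw [he] at this
  exact hx (le_zero.1 this)

theorem high_plus (hC : IsBLChain C) {e x : C} (he : cpl e = 0) (hx : x ≠ 0) : e + x = 1 := by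
  rw [plus_def, he, zero_imp]
  have : cpl x ≤ e := by
    refine hC.le_of_not fun h => hx ?_
    have h2 := le_cpl.2 ((mul_comm e x).trans (le_cpl.1 h))
    rw [he] at h2
    exact le_zero.1 h2
  rw [imp_eq_one.2 this, inf_idem]

theorem plus_high (hC : IsBLChain C) {e x : C} (he : cpl e = 0) (hx : x ≠ 0) : x + e = 1 := by
  rw [plus_comm]; exact hC.high_plus he hx

theorem plus_eq_one_or (hC : IsBLChain C) (x y : C) : x + y = 1 ∨ x * y = 0 := by
  by_cases h : x * y = 0
  · exact Or.inr h
  · left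
    have h1 : cpl y ≤ x := hC.le_of_not fun k => h (by rw [mul_comm]; exact le_cpl.1 k)
    have h2 : cpl x ≤ y := hC.le_of_not fun k => h (le_cpl.1 k)
    rw [plus_def, imp_eq_one.2 h1, imp_eq_one.2 h2, inf_idem]

theorem plus_ne_zero {x : C} (y : C) (hx : x ≠ 0) : x + y ≠ 0 := by
  intro h
  have := le_plus_left x y
  rw [h] at this
  exact hx (le_zero.1 this)

theorem plus_assoc (hC : IsBLChain C) (x y z : C) : x + y + z = x + (y + z) := by
  by_cases x0 : x = 0
  · subst x0; rw [plus_comm 0 y, plus_zero, plus_comm 0, plus_zero]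
  by_cases y0 : y = 0
  · subst y0; rw [plus_comm 0 z, plus_zero, plus_zero]
  by_cases z0 : z = 0
  · subst z0; rw [plus_zero, plus_zero]
  by_cases hx : cpl x = 0
  · rw [hC.high_plus hx y0, hC.high_plus hx (plus_ne_zero z y0), one_plus]
  by_cases hz : cpl z = 0
  · rw [hC.plus_high hz y0, hC.plus_high hz (plus_ne_zero y x0), plus_one]
  by_cases hy : cpl y = 0
  · rw [hC.plus_high hy x0, hC.high_plus hy z0, one_plus, plus_one]
  have lx := hC.low hx
  have ly := hC.low hy
  have lz := hC.low hz
  rw [low_plus_left (plus_low lx ly) lz, low_plus_left lx (plus_low ly lz), low_plus_left ly lz,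
    imp_imp, low_plus lx ly]
  nth_rw 1 [← lz]
  nth_rw 2 [← lz]
  rw [imp_cpl, mul_comm, ← imp_cpl, cpl_cpl_cpl, imp_cpl, imp_cpl, mul_comm]

end IsBLChain

section Hom
variable {L M : Type u} [BLAlgebra L] [BLAlgebra M]

theorem _root_.BLHom.map_plus (f : BLHom L M) (x y : L) :
    f.toFun (x + y) = f.toFun x + f.toFun y := by
  rw [plus_def, plus_def, f.map_inf, f.map_imp, f.map_imp, f.map_cpl, f.map_cpl]

theorem plus_assoc_all (x y z : L) : x + y + z = x + (y + z) :=
  eq_of_chain fun C _ hC π => by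
    rw [π.map_plus, π.map_plus, π.map_plus, π.map_plus]; exact hC.plus_assoc _ _ _

end Hom

/-- A BL-algebra is a commutative monoid under its addition. -/
instance instAddCommMonoidBL {L : Type u} [BLAlgebra L] : AddCommMonoid L where
  add_assoc := plus_assoc_all
  zero_add x := by rw [plus_comm, plus_zero]
  add_zero := plus_zero
  add_comm := plus_comm
  nsmul := nsmulRec

end BLAlgebra

/-- A good sequence `(a₁, a₂, …)` in `L`: `aᵢ + aᵢ₊₁ = aᵢ` for all `i ≥ 1`, and `aᵢ = 0` for all
large `i`. It is stored as a function `val` on `ℕ` with `val i = aᵢ` for `i ≥ 1` and with the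
conventional value `val 0 = 1` (for which the condition `a₀ + a₁ = a₀` holds automatically). -/
@[ext]
structure GoodSeq (L : Type u) [BLAlgebra L] where
  val : ℕ → L
  val_zero : val 0 = 1
  good : ∀ i, val i + val (i + 1) = val i
  fin : ∃ N, ∀ n, N < n → val n = 0

namespace GoodSeq
open BLAlgebra

section Chain
variable {C : Type u} [BLAlgebra C]

/-- The sequence `(1, …, 1, x, 0, …)` with `x` at place `p.1` -/
def R (p : ℕ × C) (i : ℕ) : C := if i < p.1 then 1 else if i = p.1 then p.2 else 0

/-- Pairs in normal form -/
def Valid (p : ℕ × C) : Prop := p.2 ≠ 0 ∧ (p.1 = 0 → p.2 = 1)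

open Classical in
/-- Addition of normal forms -/
noncomputable def pp (p q : ℕ × C) : ℕ × C :=
  if p.2 * q.2 = 0 then (p.1 + q.1 - 1, p.2 + q.2) else (p.1 + q.1, p.2 * q.2)

/-- Double negation of normal forms -/
def dd (p : ℕ × C) : ℕ × C := (p.1, cpl (cpl p.2))

theorem pp_zero {p q : ℕ × C} (h : p.2 * q.2 = 0) : pp p q = (p.1 + q.1 - 1, p.2 + q.2) :=
  if_pos h

theorem pp_ne {p q : ℕ × C} (h : p.2 * q.2 ≠ 0) : pp p q = (p.1 + q.1, p.2 * q.2) :=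
  if_neg h

theorem pp_comm (p q : ℕ × C) : pp p q = pp q p := by
  unfold pp
  rw [mul_comm p.2, add_comm p.1, plus_comm p.2]

theorem Valid.pos_of_mul {p q : ℕ × C} (hp : Valid p) (hq : Valid q) (h : p.2 * q.2 = 0) :
    1 ≤ p.1 := by
  by_contra hn
  have := hp.2 (by omega)
  rw [this, one_mul] at h
  exact hq.1 h

theorem Valid.pp {p q : ℕ × C} (hp : Valid p) (hq : Valid q) : Valid (pp p q) := by
  by_cases h : p.2 * q.2 = 0
  · rw [pp_zero h]
    refine ⟨IsBLChain.plus_ne_zero _ hp.1, fun h0 => ?_⟩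
    have h1 := hp.pos_of_mul hq h
    have h2 := hq.pos_of_mul hp ((mul_comm _ _).trans h)
    dsimp only at h0
    omega
  · rw [pp_ne h]
    refine ⟨h, fun h0 => ?_⟩
    dsimp only at h0
    dsimp only
    rw [hp.2 (by omega), hq.2 (by omega), mul_one]

theorem cpl_cpl_ne_zero {x : C} (hx : x ≠ 0) : cpl (cpl x) ≠ 0 := by
  intro h
  have := le_cpl_cpl x
  rw [h] at this
  exact hx (le_zero.1 this)

theorem Valid.dd {p : ℕ × C} (hp : Valid p) : Valid (dd p) := by
  refine ⟨cpl_cpl_ne_zero hp.1, fun h => ?_⟩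
  change cpl (cpl p.2) = 1
  rw [hp.2 h, cpl_one, cpl_zero]

theorem R_inj {p q : ℕ × C} (hp : Valid p) (hq : Valid q) (h : R p = R q) : p = q := by
  obtain ⟨n, x⟩ := p
  obtain ⟨m, y⟩ := q
  have h1 := congrFun h n
  have h2 := congrFun h m
  have hx := hp.1
  have hy := hq.1
  simp only [R] at h1 h2 hx hy
  have hnm : n = m := by
    rcases lt_trichotomy n m with k | k | k
    · simp only [lt_irrefl, if_false, if_true, not_lt.2 k.le, k.ne'] at h2
      exact absurd h2.symm hy
    · exact k
    · simp only [lt_irrefl, if_false, if_true, not_lt.2 k.le, k.ne'] at h1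
      exact absurd h1 hx
  subst hnm
  simp at h1
  rw [h1]

theorem mul_dd (hC : IsBLChain C) (x y : C) :
    cpl (cpl (x * y)) = cpl (cpl x) * cpl (cpl y) := by
  by_cases hx : cpl x = 0
  · by_cases hy : cpl y = 0
    · rw [IsBLChain.high_mul_high hx hy, hx, hy, cpl_zero, mul_one]
    · rw [hC.high_mul hx hy, hx, cpl_zero, one_mul]
  · by_cases hy : cpl y = 0
    · rw [hC.mul_high hy hx, hy, cpl_zero, mul_one]
    · rw [hC.low hx, hC.low hy]
      refine hC.low fun h => hx ?_
      have := cpl_anti (mul_le_l x y)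
      rw [h] at this
      exact le_zero.1 this

theorem plus_dd (hC : IsBLChain C) (x y : C) :
    cpl (cpl (x + y)) = cpl (cpl x) + cpl (cpl y) := by
  have z : cpl (cpl (0 : C)) = 0 := by rw [cpl_zero, cpl_one]
  have o : cpl (cpl (1 : C)) = 1 := by rw [cpl_one, cpl_zero]
  by_cases x0 : x = 0
  · rw [x0, z, plus_comm, plus_zero, plus_comm, plus_zero]
  by_cases y0 : y = 0
  · rw [y0, z, plus_zero, plus_zero]
  by_cases hx : cpl x = 0
  · rw [hC.high_plus hx y0, hx, cpl_zero, one_plus, o]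
  by_cases hy : cpl y = 0
  · rw [hC.plus_high hy x0, hy, cpl_zero, plus_one, o]
  rw [plus_low (hC.low hx) (hC.low hy), hC.low hx, hC.low hy]

theorem dd_pp (hC : IsBLChain C) (p q : ℕ × C) : dd (pp p q) = pp (dd p) (dd q) := by
  have key : (dd p).2 * (dd q).2 = cpl (cpl (p.2 * q.2)) := (mul_dd hC _ _).symm
  by_cases h : p.2 * q.2 = 0
  · have h1 : (dd p).2 * (dd q).2 = 0 := by rw [key, h, cpl_zero, cpl_one]
    rw [pp_zero h, pp_zero h1]
    simp only [dd, plus_dd hC]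
  · have h1 : (dd p).2 * (dd q).2 ≠ 0 := by rw [key]; exact cpl_cpl_ne_zero h
    rw [pp_ne h, pp_ne h1]
    simp only [dd, mul_dd hC]

theorem imp_dd (a b : C) : imp a (cpl (cpl (a * b))) = cpl (a ⊓ cpl b) := by
  rw [imp_cpl, ← imp_cpl a b, ← inf_eq]

theorem inf_zero (hC : IsBLChain C) {a b : C} (h : a ⊓ b = 0) : a = 0 ∨ b = 0 := by
  rcases hC.total a b with k | k
  · left; rwa [inf_eq_left.2 k] at h
  · right; rwa [inf_eq_right.2 k] at h

theorem cancel_one (hC : IsBLChain C) {a b : C} (h : a * b = a) : a = 0 ∨ cpl b = 0 := by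
  have h1 := imp_dd a b
  rw [h, imp_eq_one.2 (le_cpl_cpl a)] at h1
  exact inf_zero hC (cpl_eq_one.1 h1.symm)

theorem plus_eq_left (hC : IsBLChain C) {x y : C} (h : x + y = x) : x = 1 ∨ y = 0 := by
  rcases hC.plus_eq_one_or x y with h1 | h1
  · left; rw [← h, h1]
  right
  have hxy : x ≤ cpl y := le_cpl.2 ((mul_comm _ _).trans h1)
  have hyx : y ≤ cpl x := le_cpl.2 h1
  rcases hC.total (imp (cpl x) y) (imp (cpl y) x) with k | k
  · rw [plus_def, inf_eq_left.2 k] at h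
    have h2 := inf_eq (cpl x) y
    rw [inf_eq_right.2 hyx, h, mul_comm, mul_cpl] at h2
    exact h2
  · have h3 := h
    rw [plus_def, inf_eq_right.2 k] at h
    have h2 := inf_eq (cpl y) x
    rw [inf_eq_right.2 hxy, h, mul_comm] at h2
    rcases cancel_one hC h2.symm with h4 | h4
    · rw [h4, plus_comm, plus_zero] at h3
      exact h3
    · by_contra hy
      exact cpl_cpl_ne_zero hy h4

theorem pp_high {p q : ℕ × C} (hp : Valid p) (hq : cpl q.2 = 0) :
    pp p q = (p.1 + q.1, p.2 * q.2) := pp_ne (IsBLChain.mul_high_ne hq hp.1)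

theorem dd_ext {p q : ℕ × C} (h : p.1 = q.1) (k : cpl (cpl p.2) = cpl (cpl q.2)) : dd p = dd q :=
  Prod.ext h k

theorem pp_cancel_aux (hC : IsBLChain C) {p q c : ℕ × C} (hq : Valid q)
    (hc : Valid c) (hx : cpl p.2 = 0) (hy : cpl q.2 ≠ 0) (hz : cpl c.2 ≠ 0)
    (h : pp p c = pp q c) : False := by
  have h1 : p.2 * c.2 = c.2 := hC.high_mul hx hz
  rw [pp_ne (by rw [h1]; exact hc.1), h1] at h
  by_cases k : q.2 * c.2 = 0
  · rw [pp_zero k] at h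
    have h2 : c.2 + q.2 = c.2 := by rw [plus_comm]; exact (congrArg Prod.snd h).symm
    rcases plus_eq_left hC h2 with h3 | h3
    · exact hz (by rw [h3, cpl_one])
    · exact hq.1 h3
  · rw [pp_ne k] at h
    have h2 : c.2 * q.2 = c.2 := by rw [mul_comm]; exact (congrArg Prod.snd h).symm
    rcases cancel_one hC h2 with h3 | h3
    · exact hc.1 h3
    · exact hy h3

theorem pp_cancel_aux2 (hC : IsBLChain C) {p q c : ℕ × C}
    (hc : Valid c) (hx : cpl p.2 ≠ 0)
    (k1 : p.2 * c.2 ≠ 0) (k2 : q.2 * c.2 = 0) (h : pp p c = pp q c) : False := by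
  rw [pp_ne k1, pp_zero k2] at h
  have h1 : p.2 * c.2 = q.2 + c.2 := congrArg Prod.snd h
  have h2 : c.2 * p.2 = c.2 :=
    le_antisymm (mul_le_l _ _) (by rw [mul_comm, h1]; exact le_plus_right _ _)
  rcases cancel_one hC h2 with h3 | h3
  · exact hc.1 h3
  · exact hx h3

/-- Cancellation up to double negation -/
theorem pp_cancel (hC : IsBLChain C) {p q c : ℕ × C} (hp : Valid p) (hq : Valid q)
    (hc : Valid c) (h : pp p c = pp q c) : dd p = dd q := by
  by_cases hz : cpl c.2 = 0
  · rw [pp_high hp hz, pp_high hq hz] at h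
    have h1 : p.1 + c.1 = q.1 + c.1 := congrArg Prod.fst h
    have h2 : p.2 * c.2 = q.2 * c.2 := congrArg Prod.snd h
    refine dd_ext (by omega) ?_
    have h3 := congrArg (fun x => cpl (cpl x)) h2
    simp only [mul_dd hC, hz, cpl_zero, mul_one] at h3
    exact h3
  by_cases hx : cpl p.2 = 0
  · by_cases hy : cpl q.2 = 0
    · have h1 : p.2 * c.2 = c.2 := hC.high_mul hx hz
      have h2 : q.2 * c.2 = c.2 := hC.high_mul hy hz
      rw [pp_ne (by rw [h1]; exact hc.1), pp_ne (by rw [h2]; exact hc.1)] at h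
      have h1 : p.1 + c.1 = q.1 + c.1 := congrArg Prod.fst h
      exact dd_ext (by omega) (by rw [hx, hy])
    · exact (pp_cancel_aux hC hq hc hx hy hz h).elim
  by_cases hy : cpl q.2 = 0
  · exact (pp_cancel_aux hC hp hc hy hx hz h.symm).elim
  by_cases k1 : p.2 * c.2 = 0
  · by_cases k2 : q.2 * c.2 = 0
    · have n1 := hp.pos_of_mul hc k1
      have n2 := hq.pos_of_mul hc k2
      rw [pp_zero k1, pp_zero k2] at h
      have h1 : p.1 + c.1 - 1 = q.1 + c.1 - 1 := congrArg Prod.fst h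
      have h2 : p.2 + c.2 = q.2 + c.2 := congrArg Prod.snd h
      rw [plus_comm, plus_comm q.2, low_plus_left (hC.low hz) (hC.low hx),
        low_plus_left (hC.low hz) (hC.low hy)] at h2
      have h3 := inf_eq (cpl c.2) p.2
      rw [h2, ← inf_eq, inf_eq_right.2 (le_cpl.2 ((mul_comm _ _).trans k1)),
        inf_eq_right.2 (le_cpl.2 ((mul_comm _ _).trans k2))] at h3
      exact dd_ext (by omega) (by rw [h3])
    · exact (pp_cancel_aux2 hC hc hy k2 k1 h.symm).elim
  · by_cases k2 : q.2 * c.2 = 0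
    · exact (pp_cancel_aux2 hC hc hx k1 k2 h).elim
    · rw [pp_ne k1, pp_ne k2] at h
      have h1 : p.1 + c.1 = q.1 + c.1 := congrArg Prod.fst h
      have h2 : p.2 * c.2 = q.2 * c.2 := congrArg Prod.snd h
      refine dd_ext (by omega) ?_
      have aux : ∀ w : C, w * c.2 ≠ 0 → cpl (c.2 ⊓ cpl w) = cpl (cpl w) := by
        intro w hw
        have : cpl c.2 ≤ w :=
          hC.le_of_not fun h => hw ((mul_comm _ _).trans (le_cpl.1 h))
        have := cpl_anti this
        rw [hC.low hz] at this
        rw [inf_eq_right.2 this]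
      rw [← aux _ k1, ← aux _ k2, ← imp_dd, ← imp_dd, mul_comm, h2, mul_comm]

theorem pp_absorb (hC : IsBLChain C) {p q : ℕ × C} {k : C}
    (k0 : k ≠ 0) (hk : cpl k ≠ 0) (h : dd p = dd q) : pp p (1, k) = pp q (1, k) := by
  have h1 : (dd p).1 = (dd q).1 := congrArg Prod.fst h
  have h2 : (dd p).2 = (dd q).2 := congrArg Prod.snd h
  change p.1 = q.1 at h1
  change cpl (cpl p.2) = cpl (cpl q.2) at h2
  have h3 : cpl p.2 = cpl q.2 := by rw [← cpl_cpl_cpl, h2, cpl_cpl_cpl]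
  by_cases hx : cpl p.2 = 0
  · have hy : cpl q.2 = 0 := by rw [← h3, hx]
    have e1 : p.2 * k = k := hC.high_mul hx hk
    have e2 : q.2 * k = k := hC.high_mul hy hk
    rw [pp_ne (by rw [e1]; exact k0), pp_ne (by rw [e2]; exact k0), h1, e1, e2]
  · have hy : cpl q.2 ≠ 0 := by rwa [← h3]
    rw [hC.low hx, hC.low hy] at h2
    rw [Prod.ext h1 h2]

theorem low_assoc_one {x y z : C} (hx : cpl (cpl x) = x) (hy : cpl (cpl y) = y)
    (hz : cpl (cpl z) = z) (h1 : x * y = 0) (h2 : y * z = 0) :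
    (x + y) * z = x * (y + z) := by
  have e1 : x = cpl y * imp (cpl y) x := by
    rw [← inf_eq]; exact (inf_eq_right.2 (le_cpl.2 ((mul_comm _ _).trans h1))).symm
  have e2 : z = cpl y * imp (cpl y) z := by
    rw [← inf_eq]; exact (inf_eq_right.2 (le_cpl.2 h2)).symm
  rw [plus_comm x, low_plus_left hy hx, low_plus_left hy hz]
  calc imp (cpl y) x * z = imp (cpl y) x * (cpl y * imp (cpl y) z) := by rw [← e2]
    _ = cpl y * imp (cpl y) x * imp (cpl y) z := by rw [← mul_assoc, mul_comm (imp (cpl y) x)]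
    _ = x * imp (cpl y) z := by rw [← e1]

theorem low_mul (hC : IsBLChain C) {x y : C} (hx : cpl (cpl x) = x) (hy : cpl (cpl y) = y) :
    cpl (cpl (x * y)) = x * y := by rw [mul_dd hC, hx, hy]

theorem low_assoc_two (hC : IsBLChain C) {x y z : C} (hx : cpl (cpl x) = x)
    (hy : cpl (cpl y) = y)
    (hz : cpl (cpl z) = z) (h1 : x * y = 0) (h2 : y + z = 1) :
    (x + y) * z = x + y * z := by
  have lu : cpl (cpl (x + y)) = x + y := plus_low hx hy
  have ld := low_mul hC hy hz
  have hyz : cpl y ≤ z := by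
    rw [low_plus_left hy hz, imp_eq_one] at h2; exact h2
  have e1 : cpl y = z * cpl (y * z) := by
    rw [mul_comm y, ← imp_cpl, ← inf_eq, inf_eq_right.2 hyz]
  have e2 : x = cpl y * (x + y) := by
    rw [plus_comm, low_plus_left hy hx, ← inf_eq]
    exact (inf_eq_right.2 (le_cpl.2 ((mul_comm _ _).trans h1))).symm
  have e3 : x = cpl (y * z) * ((x + y) * z) := by
    calc x = cpl y * (x + y) := e2
      _ = z * cpl (y * z) * (x + y) := by rw [← e1]
      _ = cpl (y * z) * ((x + y) * z) := by
        rw [mul_comm z, mul_assoc, mul_comm z]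
  rw [plus_comm x (y * z), low_plus_left ld hx]
  have e4 : imp (cpl (y * z)) x = cpl (cpl (y * z) ⊓ cpl ((x + y) * z)) := by
    rw [← imp_dd, ← e3, hx]
  have e5 : y * z ≤ (x + y) * z := mul_mono (le_plus_right _ _) le_rfl
  rw [e4, inf_eq_right.2 (cpl_anti e5), low_mul hC lu hz]

theorem low_assoc_four (hC : IsBLChain C) {x y z : C} (hx : cpl (cpl x) = x)
    (hy : cpl (cpl y) = y)
    (hz : cpl (cpl z) = z) (h1 : x + y = 1) (h2 : y + z = 1) :
    x * y + z = x + y * z := by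
  have hyx : cpl y ≤ x := by
    rw [plus_comm, low_plus_left hy hx, imp_eq_one] at h1; exact h1
  have hyz : cpl y ≤ z := by
    rw [low_plus_left hy hz, imp_eq_one] at h2; exact h2
  rw [low_plus (low_mul hC hx hy) hz, low_plus hx (low_mul hC hy hz)]
  congr 1
  have aux : ∀ w : C, cpl (cpl w) = w → cpl y ≤ w → cpl w = y * cpl (w * y) := by
    intro w hw hyw
    have t1 : cpl w ≤ cpl (w * y) := cpl_anti (mul_le_l _ _)
    have t2 := inf_eq (cpl (w * y)) (cpl w)
    have t3 : w * cpl (w * y) = cpl y := by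
      rw [← imp_cpl, ← inf_eq]; exact inf_eq_right.2 hyw
    rw [inf_eq_right.2 t1, imp_cpl, mul_comm _ w, t3, hy, mul_comm] at t2
    exact t2
  rw [aux x hx hyx, aux z hz hyz, mul_comm z y]
  simp only [mul_left_comm, mul_comm]

theorem pp_assoc_low (hC : IsBLChain C) {p q r : ℕ × C} (hp : Valid p) (hq : Valid q)
    (hr : Valid r) (hx : cpl (cpl p.2) = p.2) (hy : cpl (cpl q.2) = q.2)
    (hz : cpl (cpl r.2) = r.2) : pp (pp p q) r = pp p (pp q r) := by
  by_cases h1 : p.2 * q.2 = 0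
  · have n1 := hp.pos_of_mul hq h1
    have n2 := hq.pos_of_mul hp ((mul_comm _ _).trans h1)
    by_cases h2 : q.2 * r.2 = 0
    · have n3 := hr.pos_of_mul hq ((mul_comm _ _).trans h2)
      have e := low_assoc_one hx hy hz h1 h2
      rw [pp_zero h1, pp_zero h2]
      by_cases h3 : (p.2 + q.2) * r.2 = 0
      · rw [pp_zero h3, pp_zero (e ▸ h3)]
        refine Prod.ext ?_ (plus_assoc_all _ _ _)
        dsimp only; omega
      · rw [pp_ne h3, pp_ne (e ▸ h3)]
        refine Prod.ext ?_ e
        dsimp only; omega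
    · have e := low_assoc_two hC hx hy hz h1 ((hC.plus_eq_one_or _ _).resolve_right h2)
      have h3 : (p.2 + q.2) * r.2 ≠ 0 := by
        rw [e, plus_comm]; exact IsBLChain.plus_ne_zero _ h2
      have h4 : p.2 * (q.2 * r.2) = 0 := by rw [← mul_assoc, h1, zero_mul_all]
      rw [pp_zero h1, pp_ne h2, pp_ne h3, pp_zero h4]
      refine Prod.ext ?_ e
      dsimp only; omega
  · by_cases h2 : q.2 * r.2 = 0
    · have n2 := hq.pos_of_mul hr h2
      have n3 := hr.pos_of_mul hq ((mul_comm _ _).trans h2)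
      have e := low_assoc_two hC hz hy hx ((mul_comm _ _).trans h2)
        ((plus_comm _ _).trans ((hC.plus_eq_one_or _ _).resolve_right h1))
      rw [plus_comm, mul_comm, plus_comm r.2, mul_comm q.2] at e
      have h3 : p.2 * (q.2 + r.2) ≠ 0 := by
        rw [e]; exact IsBLChain.plus_ne_zero _ h1
      have h4 : p.2 * q.2 * r.2 = 0 := by rw [mul_assoc, h2, mul_zero_all]
      rw [pp_ne h1, pp_zero h2, pp_zero h4, pp_ne h3]
      refine Prod.ext ?_ e.symm
      dsimp only; omega
    · rw [pp_ne h1, pp_ne h2]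
      by_cases h3 : p.2 * q.2 * r.2 = 0
      · rw [pp_zero h3, pp_zero (by rw [← h3, mul_assoc])]
        refine Prod.ext ?_ (low_assoc_four hC hx hy hz
          ((hC.plus_eq_one_or _ _).resolve_right h1) ((hC.plus_eq_one_or _ _).resolve_right h2))
        dsimp only; omega
      · rw [pp_ne h3, pp_ne (by rwa [← mul_assoc])]
        refine Prod.ext ?_ (mul_assoc _ _ _)
        dsimp only; omega

theorem dd_low (p : ℕ × C) : cpl (cpl (dd p).2) = (dd p).2 := by
  simp only [dd, cpl_cpl_cpl]

theorem dd_dd (p : ℕ × C) : dd (dd p) = dd p := by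
  simp only [dd, cpl_cpl_cpl]

theorem dd_assoc (hC : IsBLChain C) {p q r : ℕ × C} (hp : Valid p) (hq : Valid q)
    (hr : Valid r) : dd (pp (pp p q) r) = dd (pp p (pp q r)) := by
  rw [dd_pp hC, dd_pp hC, dd_pp hC, dd_pp hC]
  exact pp_assoc_low hC hp.dd hq.dd hr.dd (dd_low _) (dd_low _) (dd_low _)

end Chain
end GoodSeq

namespace GoodSeq
open BLAlgebra

section Conv
variable {L M : Type u} [BLAlgebra L] [BLAlgebra M]

/-- The sum of sequences: `cᵢ = aᵢ + (aᵢ₋₁ ⊗ b₁) + ⋯ + (a₁ ⊗ bᵢ₋₁) + bᵢ`, that is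
`cᵢ = ∑_{j + k = i} aⱼ ⊗ bₖ` with `a₀ = b₀ = 1`. -/
def conv (a b : ℕ → L) (i : ℕ) : L := ∑ p ∈ Finset.HasAntidiagonal.antidiagonal i, a p.1 * b p.2

/-- A BL-homomorphism as a homomorphism for `+` -/
def toAdd (f : BLHom L M) : L →+ M where
  toFun := f.toFun
  map_zero' := f.map_zero
  map_add' := f.map_plus

theorem map_conv (f : BLHom L M) (a b : ℕ → L) (i : ℕ) :
    f.toFun (conv a b i) = conv (fun j => f.toFun (a j)) (fun j => f.toFun (b j)) i := by
  change toAdd f _ = _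
  unfold conv
  rw [map_sum]
  exact Finset.sum_congr rfl fun p _ => f.map_mul _ _

theorem sum_eq_one {ι : Type*} (s : Finset ι) (f : ι → L) (j : ι) (hj : j ∈ s)
    (h : f j = 1) : ∑ i ∈ s, f i = 1 := by
  classical
  rw [← Finset.add_sum_erase s f hj, h, one_plus]

theorem conv_comm (a b : ℕ → L) : conv a b = conv b a := by
  funext i
  unfold conv
  rw [← Finset.Nat.sum_antidiagonal_swap]
  exact Finset.sum_congr rfl fun p _ => mul_comm _ _

theorem sum_mono {ι : Type*} (s : Finset ι) {f g : ι → L} (h : ∀ i, f i ≤ g i) :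
    ∑ i ∈ s, f i ≤ ∑ i ∈ s, g i := by
  classical
  induction s using Finset.induction_on with
  | empty => exact le_rfl
  | insert a s ha ih => rw [Finset.sum_insert ha, Finset.sum_insert ha]; exact plus_mono (h a) ih

theorem conv_mono {a b c d : ℕ → L} (h : ∀ i, a i ≤ b i) (k : ∀ i, c i ≤ d i) (i : ℕ) :
    conv a c i ≤ conv b d i :=
  sum_mono _ fun p => mul_mono (h p.1) (k p.2)

end Conv

section ChainSeq
variable {C : Type u} [BLAlgebra C]

theorem R_lt {p : ℕ × C} {i : ℕ} (h : i < p.1) : R p i = 1 := if_pos h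
theorem R_eq (p : ℕ × C) : R p p.1 = p.2 := by simp [R]
theorem R_gt {p : ℕ × C} {i : ℕ} (h : p.1 < i) : R p i = 0 := by
  unfold R
  rw [if_neg (by omega), if_neg (by omega)]

theorem R_val_zero {p : ℕ × C} (hp : Valid p) : R p 0 = 1 := by
  by_cases h : p.1 = 0
  · have := R_eq p
    rwa [h, hp.2 h] at this
  · exact R_lt (by omega)

theorem R_good (p : ℕ × C) (i : ℕ) : R p i + R p (i + 1) = R p i := by
  by_cases h : i < p.1
  · rw [R_lt h, one_plus]
  · rw [R_gt (show p.1 < i + 1 by omega), plus_zero]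

theorem conv_one {p q : ℕ × C} (hp : Valid p) (hq : Valid q) {i j : ℕ} (hj : j ≤ i)
    (h1 : j < p.1 ∨ j = 0) (h2 : i - j < q.1 ∨ i - j = 0) : conv (R p) (R q) i = 1 := by
  refine sum_eq_one _ _ (j, i - j) 
    (Finset.HasAntidiagonal.mem_antidiagonal.2 (Nat.add_sub_of_le hj)) ?_
  have e1 : R p j = 1 := by
    rcases h1 with h | h
    · exact R_lt h
    · rw [h]; exact R_val_zero hp
  have e2 : R q (i - j) = 1 := by
    rcases h2 with h | h
    · exact R_lt h
    · rw [h]; exact R_val_zero hq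
  dsimp only
  rw [e1, e2, mul_one]

theorem conv_low {p q : ℕ × C} (hp : Valid p) (hq : Valid q) {i : ℕ} (hi : i + 1 < p.1 + q.1) :
    conv (R p) (R q) i = 1 := by
  by_cases hn : p.1 = 0
  · exact conv_one hp hq (j := 0) (by omega) (by omega) (by omega)
  by_cases h : i < p.1
  · exact conv_one hp hq (j := i) le_rfl (by omega) (by omega)
  · exact conv_one hp hq (j := p.1 - 1) (by omega) (by omega) (by omega)

theorem conv_mid {p q : ℕ × C} (hp : Valid p) (hq : Valid q) {i : ℕ} (hi : i + 1 = p.1 + q.1) :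
    conv (R p) (R q) i = p.2 + q.2 := by
  by_cases hn : p.1 = 0
  · rw [hp.2 hn, one_plus]
    exact conv_one hp hq (j := 0) (by omega) (by omega) (by omega)
  by_cases hm : q.1 = 0
  · rw [hq.2 hm, plus_one]
    exact conv_one hp hq (j := i) le_rfl (by omega) (by omega)
  unfold conv
  rw [Finset.sum_eq_add (p.1, q.1 - 1) (p.1 - 1, q.1)]
  · dsimp only
    rw [R_eq, R_eq, R_lt (by omega), R_lt (by omega), mul_one, one_mul]
  · intro h
    have := congrArg Prod.snd h
    dsimp only at this
    omega
  · rintro ⟨j, k⟩ hjk ⟨h1, h2⟩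
    rw [Finset.HasAntidiagonal.mem_antidiagonal] at hjk
    dsimp only at hjk ⊢
    by_cases h3 : p.1 < j
    · rw [R_gt h3, zero_mul_all]
    · have h4 : q.1 < k := by
        by_contra h4
        rcases Nat.lt_or_ge j p.1 with h5 | h5
        · exact h2 (Prod.ext (by dsimp only; omega) (by dsimp only; omega))
        · exact h1 (Prod.ext (by dsimp only; omega) (by dsimp only; omega))
      rw [R_gt h4, mul_zero_all]
  · intro h
    exact absurd (Finset.HasAntidiagonal.mem_antidiagonal.2 (by dsimp only; omega)) h
  · intro h
    exact absurd (Finset.HasAntidiagonal.mem_antidiagonal.2 (by dsimp only; omega)) h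

theorem conv_top {p q : ℕ × C} : conv (R p) (R q) (p.1 + q.1) = p.2 * q.2 := by
  unfold conv
  rw [Finset.sum_eq_single (p.1, q.1)]
  · dsimp only
    rw [R_eq, R_eq]
  · rintro ⟨j, k⟩ hjk h1
    rw [Finset.HasAntidiagonal.mem_antidiagonal] at hjk
    dsimp only at hjk ⊢
    by_cases h3 : p.1 < j
    · rw [R_gt h3, zero_mul_all]
    · have h4 : q.1 < k := by
        by_contra h4
        exact h1 (Prod.ext (by dsimp only; omega) (by dsimp only; omega))
      rw [R_gt h4, mul_zero_all]
  · intro h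
    exact (h (Finset.HasAntidiagonal.mem_antidiagonal.2 rfl)).elim

theorem conv_R (hC : IsBLChain C) {p q : ℕ × C} (hp : Valid p) (hq : Valid q) :
    conv (R p) (R q) = R (pp p q) := by
  funext i
  by_cases h4 : p.1 + q.1 < i
  · have e : conv (R p) (R q) i = 0 := by
      refine Finset.sum_eq_zero ?_
      rintro ⟨j, k⟩ hjk
      rw [Finset.HasAntidiagonal.mem_antidiagonal] at hjk
      dsimp only at hjk ⊢
      by_cases h3 : p.1 < j
      · rw [R_gt h3, zero_mul_all]
      · rw [R_gt (show q.1 < k by omega), mul_zero_all]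
    rw [e]
    by_cases h : p.2 * q.2 = 0
    · rw [pp_zero h, R_gt (by dsimp only; omega)]
    · rw [pp_ne h, R_gt (by dsimp only; omega)]
  by_cases h : p.2 * q.2 = 0
  · have n1 := hp.pos_of_mul hq h
    rw [pp_zero h]
    by_cases h1 : i + 1 < p.1 + q.1
    · rw [conv_low hp hq h1, R_lt (by dsimp only; omega)]
    by_cases h2 : i + 1 = p.1 + q.1
    · rw [conv_mid hp hq h2]
      have : i = p.1 + q.1 - 1 := by omega
      rw [this]
      exact (R_eq (p.1 + q.1 - 1, p.2 + q.2)).symm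
    · have : i = p.1 + q.1 := by omega
      rw [R_gt (by dsimp only; omega), this, conv_top, h]
  · rw [pp_ne h]
    by_cases h1 : i + 1 < p.1 + q.1
    · rw [conv_low hp hq h1, R_lt (by dsimp only; omega)]
    by_cases h2 : i + 1 = p.1 + q.1
    · rw [conv_mid hp hq h2, R_lt (by dsimp only; omega)]
      exact (hC.plus_eq_one_or _ _).resolve_right h
    · have : i = p.1 + q.1 := by omega
      rw [this, conv_top]
      exact (R_eq (p.1 + q.1, p.2 * q.2)).symm

theorem exists_R (hC : IsBLChain C) (a : GoodSeq C) : ∃ p, Valid p ∧ a.val = R p := by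
  classical
  have hex : ∃ i, a.val (i + 1) = 0 := by
    obtain ⟨N, hN⟩ := a.fin
    exact ⟨N, hN _ (Nat.lt_succ_self N)⟩
  set n := Nat.find hex with hn
  have h1 : ∀ i, i ≤ n → a.val i ≠ 0 := by
    intro i hi
    cases i with
    | zero => rw [a.val_zero]; exact hC.zero_ne.symm
    | succ i => exact Nat.find_min hex (by omega)
  have h2 : ∀ i, i < n → a.val i = 1 := fun i hi =>
    (plus_eq_left hC (a.good i)).resolve_right (h1 (i + 1) (by omega))
  have h3 : ∀ i, a.val (n + 1 + i) = 0 := by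
    intro i
    induction i with
    | zero => exact Nat.find_spec hex
    | succ i ih =>
      have h := a.good (n + 1 + i)
      rw [ih, plus_comm, plus_zero] at h
      exact h
  refine ⟨(n, a.val n), ⟨h1 n le_rfl, fun h => ?_⟩, ?_⟩
  · change n = 0 at h
    change a.val n = 1
    rw [h, a.val_zero]
  · funext i
    rcases lt_trichotomy i n with h | h | h
    · rw [R_lt h, h2 i h]
    · rw [h]; exact (R_eq (n, a.val n)).symm
    · rw [R_gt h]
      have := h3 (i - (n + 1))
      rwa [Nat.add_sub_of_le h] at this

theorem R_total (hC : IsBLChain C) (p q : ℕ × C) : (∀ i, R p i ≤ R q i) ∨ ∀ i, R q i ≤ R p i := by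
  have aux : ∀ p q : ℕ × C, p.1 < q.1 → ∀ i, R p i ≤ R q i := by
    intro p q h i
    by_cases hi : i < q.1
    · rw [R_lt hi]; exact le_one_all _
    · rw [R_gt (show p.1 < i by omega)]; exact zero_le_all _
  have aux2 : ∀ p q : ℕ × C, p.1 = q.1 → p.2 ≤ q.2 → ∀ i, R p i ≤ R q i := by
    intro p q h hx i
    unfold R
    rw [h]
    split_ifs
    · exact le_rfl
    · exact hx
    · exact le_rfl
  rcases lt_trichotomy p.1 q.1 with h | h | h
  · exact Or.inl (aux p q h)
  · rcases hC.total p.2 q.2 with k | k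
    · exact Or.inl (aux2 p q h k)
    · exact Or.inr (aux2 q p h.symm k)
  · exact Or.inr (aux q p h)

end ChainSeq
end GoodSeq

namespace GoodSeq
open BLAlgebra

section Ops
variable {L M N : Type u} [BLAlgebra L] [BLAlgebra M] [BLAlgebra N]

/-- `f(𝐚) = (f(a₁), f(a₂), …)` -/
def map (f : BLHom L M) (a : GoodSeq L) : GoodSeq M where
  val i := f.toFun (a.val i)
  val_zero := by rw [a.val_zero, f.map_one]
  good i := by rw [← f.map_plus, a.good]
  fin := by
    obtain ⟨n, hn⟩ := a.fin
    exact ⟨n, fun i hi => by rw [hn i hi, f.map_zero]⟩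

theorem conv_val_zero (a b : GoodSeq L) : conv a.val b.val 0 = 1 := by
  unfold conv
  rw [Finset.Nat.antidiagonal_zero, Finset.sum_singleton, a.val_zero, b.val_zero, mul_one]

/-- Addition of good sequences. -/
instance : Add (GoodSeq L) where
  add a b :=
    { val := conv a.val b.val
      val_zero := conv_val_zero a b
      good := fun i => eq_of_chain fun C _ hC π => by
        obtain ⟨p, hp, ep⟩ := exists_R hC (a.map π)
        obtain ⟨q, hq, eq⟩ := exists_R hC (b.map π)
        have e : ∀ j, π.toFun (conv a.val b.val j) = R (pp p q) j := fun j => by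
          rw [map_conv, ← conv_R hC hp hq, ← ep, ← eq]; rfl
        rw [π.map_plus, e, e]
        exact R_good _ _
      fin := by
        obtain ⟨n, hn⟩ := a.fin
        obtain ⟨m, hm⟩ := b.fin
        refine ⟨n + m, fun i hi => Finset.sum_eq_zero ?_⟩
        rintro ⟨j, k⟩ hjk
        rw [Finset.HasAntidiagonal.mem_antidiagonal] at hjk
        dsimp only at hjk ⊢
        by_cases h : n < j
        · rw [hn j h, zero_mul_all]
        · rw [hm k (by omega), mul_zero_all] }

/-- The good sequence `(x) = (x, 0, 0, …)`. -/
def single (x : L) : GoodSeq L where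
  val i := if i = 0 then 1 else if i = 1 then x else 0
  val_zero := rfl
  good i := by
    rcases i with _ | i
    · exact one_plus _
    · rw [if_neg (show i + 1 + 1 ≠ 0 by omega), if_neg (show i + 1 + 1 ≠ 1 by omega), plus_zero]
  fin := ⟨1, fun i hi => by rw [if_neg (by omega), if_neg (by omega)]⟩

/-- The pointwise order of good sequences. -/
instance : PartialOrder (GoodSeq L) where
  le a b := ∀ i, a.val i ≤ b.val i
  le_refl _ _ := le_rfl
  le_trans _ _ _ h k i := (h i).trans (k i)
  le_antisymm _ _ h k := GoodSeq.ext (funext fun i => le_antisymm (h i) (k i))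

theorem map_add (f : BLHom L M) (a b : GoodSeq L) : (a + b).map f = a.map f + b.map f :=
  GoodSeq.ext (funext fun i => map_conv f a.val b.val i)

theorem map_single (f : BLHom L M) (x : L) : (single x).map f = single (f.toFun x) := by
  refine GoodSeq.ext (funext fun i => ?_)
  change f.toFun (if i = 0 then 1 else if i = 1 then x else 0) =
    if i = 0 then 1 else if i = 1 then f.toFun x else 0
  split_ifs
  · exact f.map_one
  · rfl
  · exact f.map_zero

theorem map_mono (f : BLHom L M) {a b : GoodSeq L} (h : a ≤ b) : a.map f ≤ b.map f :=
  fun i => f.map_le (h i)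

theorem gs_le_of_chain {a b : GoodSeq L}
    (h : ∀ (C : Type u) [BLAlgebra C], IsBLChain C → ∀ π : BLHom L C, a.map π ≤ b.map π) :
    a ≤ b :=
  fun i => le_of_chain fun C _ hC π => h C hC π i

theorem gs_eq_of_chain {a b : GoodSeq L}
    (h : ∀ (C : Type u) [BLAlgebra C], IsBLChain C → ∀ π : BLHom L C, a.map π = b.map π) :
    a = b :=
  le_antisymm (gs_le_of_chain fun C _ hC π => (h C hC π).le)
    (gs_le_of_chain fun C _ hC π => (h C hC π).ge)

theorem gs_add_comm (a b : GoodSeq L) : a + b = b + a :=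
  GoodSeq.ext (conv_comm a.val b.val)

theorem gs_add_mono {a b c d : GoodSeq L} (h : a ≤ b) (k : c ≤ d) : a + c ≤ b + d :=
  fun i => conv_mono h k i

end Ops

section ChainOps
variable {C : Type u} [BLAlgebra C]

theorem add_val (hC : IsBLChain C) {a b : GoodSeq C} {p q : ℕ × C} (hp : Valid p)
    (hq : Valid q) (ha : a.val = R p) (hb : b.val = R q) : (a + b).val = R (pp p q) := by
  rw [← conv_R hC hp hq, ← ha, ← hb]; rfl

theorem single_val (x : C) : (single x).val = R (1, x) := by
  funext i
  change (if i = 0 then 1 else if i = 1 then x else 0) = if i < 1 then 1 else if i = 1 then x else 0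
  simp only [Nat.lt_one_iff]

theorem valid_one {x : C} (hx : x ≠ 0) : Valid (1, x) := ⟨hx, fun h => absurd h one_ne_zero⟩

theorem gs_total (hC : IsBLChain C) (a b : GoodSeq C) : a ≤ b ∨ b ≤ a := by
  obtain ⟨p, -, ep⟩ := exists_R hC a
  obtain ⟨q, -, eq⟩ := exists_R hC b
  rcases R_total hC p q with h | h
  · left; intro i; rw [ep, eq]; exact h i
  · right; intro i; rw [ep, eq]; exact h i

/-- pass from equalities to inequalities in a chain -/
theorem le_of_eq_case (hC : IsBLChain C) {a b : GoodSeq C} {F G : GoodSeq C → GoodSeq C}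
    (hF : ∀ {x y}, x ≤ y → F x ≤ F y) (hG : ∀ {x y}, x ≤ y → G x ≤ G y)
    (h : F a = F b → G a = G b) (hab : F a ≤ F b) : G a ≤ G b := by
  rcases gs_total hC a b with k | k
  · exact hG k
  · exact (h (le_antisymm hab (hF k))).le

theorem high_of_le {x y : C} (hx : cpl x = 0) (h : x ≤ y) : cpl y = 0 :=
  le_zero.1 (hx ▸ cpl_anti h)

theorem high_of_sup {x m : C} (hC : IsBLChain C) (hm : cpl m = 0) (hx : x ≠ 0)
    (h : m ≤ x ⊔ cpl x) : cpl x = 0 := by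
  rcases hC.total x (cpl x) with k | k
  · rw [sup_eq_right.2 k] at h
    have := cpl_anti h
    rw [hm] at this
    exact absurd (le_zero.1 this) (cpl_cpl_ne_zero hx)
  · rw [sup_eq_left.2 k] at h
    exact high_of_le hm h

theorem mul_eq_of_le {x y k m : C} (h : x * k = y * k) (hm : m ≤ k) : x * m = y * m := by
  have e : m = k * imp k m := by rw [← inf_eq]; exact (inf_eq_right.2 hm).symm
  rw [e, ← mul_assoc, h, mul_assoc]

theorem pp_congr (hC : IsBLChain C) {p q c : ℕ × C} {k : C} (hp : Valid p) (hq : Valid q)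
    (hc : Valid c) (k0 : k ≠ 0) (h : pp p (1, k) = pp q (1, k)) :
    pp (pp p c) (1, k) = pp (pp q c) (1, k) := by
  by_cases hk : cpl k = 0
  · rw [pp_high hp hk, pp_high hq hk] at h
    rw [pp_high (hp.pp hc) hk, pp_high (hq.pp hc) hk]
    have h1 : p.1 + 1 = q.1 + 1 := congrArg Prod.fst h
    have h2 : p.2 * k = q.2 * k := congrArg Prod.snd h
    have h1' : p.1 = q.1 := by omega
    have z : ∀ x y : C, x * k = y * k → x * c.2 = 0 → y * c.2 = 0 := by
      intro x y e e0
      by_contra h0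
      refine IsBLChain.mul_high_ne hk h0 ?_
      rw [mul_right_comm, ← e, mul_right_comm, e0, zero_mul_all]
    by_cases h3 : p.2 * c.2 = 0
    · have h4 := z _ _ h2 h3
      have hx : cpl p.2 ≠ 0 := fun e => by
        have := le_cpl.2 h3
        rw [e] at this
        exact hc.1 (le_zero.1 this)
      have hy : cpl q.2 ≠ 0 := fun e => by
        have := le_cpl.2 h4
        rw [e] at this
        exact hc.1 (le_zero.1 this)
      rw [hC.mul_high hk hx, hC.mul_high hk hy] at h2
      rw [Prod.ext h1' h2]
    · have h4 : q.2 * c.2 ≠ 0 := fun e => h3 (z _ _ h2.symm e)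
      rw [pp_ne h3, pp_ne h4]
      dsimp only
      rw [h1', mul_right_comm, h2, mul_right_comm]
  · refine pp_absorb hC k0 hk ?_
    rw [dd_pp hC, dd_pp hC, pp_cancel hC hp hq (valid_one k0) h]

theorem pp_le_level (hC : IsBLChain C) {p q : ℕ × C} {k m : C} (hp : Valid p) (hq : Valid q)
    (k0 : k ≠ 0) (m0 : m ≠ 0) (hmk : m ≤ k) (h : pp p (1, k) = pp q (1, k)) :
    pp p (1, m) = pp q (1, m) := by
  by_cases hm : cpl m = 0
  · have hk := high_of_le hm hmk
    rw [pp_high hp hk, pp_high hq hk] at h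
    have h1 : p.1 + 1 = q.1 + 1 := congrArg Prod.fst h
    have h2 : p.2 * k = q.2 * k := congrArg Prod.snd h
    rw [pp_high hp hm, pp_high hq hm]
    exact Prod.ext h1 (mul_eq_of_le h2 hmk)
  · exact pp_absorb hC m0 hm (pp_cancel hC hp hq (valid_one k0) h)

theorem pp_cancel_level (hC : IsBLChain C) {p q c : ℕ × C} {k m : C} (hp : Valid p)
    (hq : Valid q) (hc : Valid c) (k0 : k ≠ 0) (m0 : m ≠ 0) (hmk : m ≤ k)
    (hmc : m ≤ c.2 ⊔ cpl c.2) (hmt : m ≤ (pp c (1, k)).2 ⊔ cpl (pp c (1, k)).2)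
    (h : pp (pp p c) (1, k) = pp (pp q c) (1, k)) : pp p (1, m) = pp q (1, m) := by
  by_cases hm : cpl m = 0
  · have hk := high_of_le hm hmk
    have hz := high_of_sup hC hm hc.1 hmc
    rw [pp_high hc hk] at hmt
    have ht := IsBLChain.high_mul_high hz hk
    dsimp only at hmt
    rw [ht, sup_eq_left.2 (zero_le_all _)] at hmt
    rw [pp_high (hp.pp hc) hk, pp_high (hq.pp hc) hk, pp_high hp hz, pp_high hq hz] at h
    have h1 : p.1 + c.1 + 1 = q.1 + c.1 + 1 := congrArg Prod.fst h
    have h2 : p.2 * c.2 * k = q.2 * c.2 * k := congrArg Prod.snd h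
    rw [mul_assoc, mul_assoc] at h2
    rw [pp_high hp hm, pp_high hq hm]
    exact Prod.ext (by dsimp only; omega) (mul_eq_of_le h2 hmt)
  · have h1 := pp_cancel hC (hp.pp hc) (hq.pp hc) (valid_one k0) h
    rw [dd_pp hC, dd_pp hC] at h1
    have h2 := pp_cancel hC hp.dd hq.dd hc.dd h1
    rw [dd_dd, dd_dd] at h2
    exact pp_absorb hC m0 hm h2

theorem pp_assoc_level (hC : IsBLChain C) {p q r : ℕ × C} {m : C} (hp : Valid p)
    (hq : Valid q) (hr : Valid r) (m0 : m ≠ 0)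
    (h2 : m ≤ q.2 ⊔ cpl q.2) (h3 : m ≤ r.2 ⊔ cpl r.2) :
    pp (pp (pp p q) r) (1, m) = pp (pp p (pp q r)) (1, m) := by
  by_cases hm : cpl m = 0
  · have hy := high_of_sup hC hm hq.1 h2
    have hz := high_of_sup hC hm hr.1 h3
    rw [pp_high (hp.pp hq) hz, pp_high hp hy, pp_high hq hz,
      pp_high hp (IsBLChain.high_mul_high hy hz)]
    dsimp only
    rw [add_assoc, mul_assoc]
  · exact pp_absorb hC m0 hm (dd_assoc hC hp hq hr)

theorem gs_congr (hC : IsBLChain C) {a b c : GoodSeq C} {k : C} (k0 : k ≠ 0)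
    (h : a + single k ≤ b + single k) : a + c + single k ≤ b + c + single k := by
  refine le_of_eq_case hC (F := fun x => x + single k) (G := fun x => x + c + single k)
    (fun e => gs_add_mono e le_rfl) (fun e => gs_add_mono (gs_add_mono e le_rfl) le_rfl) ?_ h
  intro e
  obtain ⟨p, hp, ep⟩ := exists_R hC a
  obtain ⟨q, hq, eq⟩ := exists_R hC b
  obtain ⟨r, hr, er⟩ := exists_R hC c
  have vk := valid_one k0
  have sk := single_val k
  have e1 := congrArg GoodSeq.val e
  rw [add_val hC hp vk ep sk, add_val hC hq vk eq sk] at e1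
  apply GoodSeq.ext
  rw [add_val hC (hp.pp hr) vk (add_val hC hp hr ep er) sk,
    add_val hC (hq.pp hr) vk (add_val hC hq hr eq er) sk,
    pp_congr hC hp hq hr k0 (R_inj (hp.pp vk) (hq.pp vk) e1)]

theorem gs_le_level (hC : IsBLChain C) {a b : GoodSeq C} {k m : C} (k0 : k ≠ 0) (m0 : m ≠ 0)
    (hmk : m ≤ k) (h : a + single k ≤ b + single k) : a + single m ≤ b + single m := by
  refine le_of_eq_case hC (F := fun x => x + single k) (G := fun x => x + single m)
    (fun e => gs_add_mono e le_rfl) (fun e => gs_add_mono e le_rfl) ?_ h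
  intro e
  obtain ⟨p, hp, ep⟩ := exists_R hC a
  obtain ⟨q, hq, eq⟩ := exists_R hC b
  have vk := valid_one k0
  have sk := single_val k
  have e1 := congrArg GoodSeq.val e
  rw [add_val hC hp vk ep sk, add_val hC hq vk eq sk] at e1
  apply GoodSeq.ext
  rw [add_val hC hp (valid_one m0) ep (single_val m), add_val hC hq (valid_one m0) eq (single_val m),
    pp_le_level hC hp hq k0 m0 hmk (R_inj (hp.pp vk) (hq.pp vk) e1)]

theorem gs_cancel_level (hC : IsBLChain C) {a b c : GoodSeq C} {k m : C} (k0 : k ≠ 0)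
    (m0 : m ≠ 0) (hmk : m ≤ k) (hmc : ∀ i, m ≤ c.val i ⊔ cpl (c.val i))
    (hmt : ∀ i, m ≤ (c + single k).val i ⊔ cpl ((c + single k).val i))
    (h : a + c + single k ≤ b + c + single k) : a + single m ≤ b + single m := by
  refine le_of_eq_case hC (F := fun x => x + c + single k) (G := fun x => x + single m)
    (fun e => gs_add_mono (gs_add_mono e le_rfl) le_rfl) (fun e => gs_add_mono e le_rfl) ?_ h
  intro e
  obtain ⟨p, hp, ep⟩ := exists_R hC a
  obtain ⟨q, hq, eq⟩ := exists_R hC b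
  obtain ⟨r, hr, er⟩ := exists_R hC c
  have vk := valid_one k0
  have sk := single_val k
  have e1 := congrArg GoodSeq.val e
  rw [add_val hC (hp.pp hr) vk (add_val hC hp hr ep er) sk,
    add_val hC (hq.pp hr) vk (add_val hC hq hr eq er) sk] at e1
  have t1 := hmc r.1
  rw [er, R_eq] at t1
  have t2 := hmt (pp r (1, k)).1
  rw [add_val hC hr vk er sk, R_eq] at t2
  apply GoodSeq.ext
  rw [add_val hC hp (valid_one m0) ep (single_val m), add_val hC hq (valid_one m0) eq (single_val m),
    pp_cancel_level hC hp hq hr k0 m0 hmk t1 t2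
      (R_inj ((hp.pp hr).pp vk) ((hq.pp hr).pp vk) e1)]

theorem gs_assoc_level (hC : IsBLChain C) {a b c : GoodSeq C} {m : C}
    (m0 : m ≠ 0) (h2 : ∀ i, m ≤ b.val i ⊔ cpl (b.val i))
    (h3 : ∀ i, m ≤ c.val i ⊔ cpl (c.val i)) :
    a + b + c + single m = a + (b + c) + single m := by
  obtain ⟨p, hp, ep⟩ := exists_R hC a
  obtain ⟨q, hq, eq⟩ := exists_R hC b
  obtain ⟨r, hr, er⟩ := exists_R hC c
  have t2 := h2 q.1
  have t3 := h3 r.1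
  rw [eq, R_eq] at t2
  rw [er, R_eq] at t3
  have vm := valid_one m0
  have sm := single_val m
  apply GoodSeq.ext
  rw [add_val hC ((hp.pp hq).pp hr) vm (add_val hC (hp.pp hq) hr (add_val hC hp hq ep eq) er) sm,
    add_val hC (hp.pp (hq.pp hr)) vm (add_val hC hp (hq.pp hr) ep (add_val hC hq hr eq er)) sm,
    pp_assoc_level hC hp hq hr m0 t2 t3]

end ChainOps

section Global
variable {L M : Type u} [BLAlgebra L] [BLAlgebra M]

/-- The componentwise join of good sequences. -/
instance : Max (GoodSeq L) where
  max a b :=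
    { val := fun i => a.val i ⊔ b.val i
      val_zero := by rw [a.val_zero, b.val_zero, sup_idem]
      good := fun i => eq_of_chain fun C _ hC π => by
        rw [π.map_plus, π.map_sup, π.map_sup]
        rcases gs_total hC (a.map π) (b.map π) with h | h
        · have e : ∀ j, π.toFun (a.val j) ⊔ π.toFun (b.val j) = π.toFun (b.val j) :=
            fun j => sup_eq_right.2 (h j)
          rw [e, e]
          exact (b.map π).good i
        · have e : ∀ j, π.toFun (a.val j) ⊔ π.toFun (b.val j) = π.toFun (a.val j) :=
            fun j => sup_eq_left.2 (h j)
          rw [e, e]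
          exact (a.map π).good i
      fin := by
        obtain ⟨n, hn⟩ := a.fin
        obtain ⟨m, hm⟩ := b.fin
        refine ⟨n + m, fun i hi => ?_⟩
        rw [hn i (by omega), hm i (by omega), sup_idem] }

theorem map_max (f : BLHom L M) (a b : GoodSeq L) : (a ⊔ b).map f = a.map f ⊔ b.map f :=
  GoodSeq.ext (funext fun i => f.map_sup (a.val i) (b.val i))

theorem le_max_l (a b : GoodSeq L) : a ≤ a ⊔ b := fun _ => le_sup_left
theorem le_max_r (a b : GoodSeq L) : b ≤ a ⊔ b := fun _ => le_sup_right

theorem max_add_le {a b c d : GoodSeq L} (h : a + d ≤ c) (k : b + d ≤ c) : a ⊔ b + d ≤ c :=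
  gs_le_of_chain fun C _ hC π => by
    rw [map_add, map_max]
    rcases gs_total hC (a.map π) (b.map π) with t | t
    · have e : a.map π ⊔ b.map π = b.map π :=
        GoodSeq.ext (funext fun j => sup_eq_right.2 (t j))
      rw [e, ← map_add]; exact map_mono π k
    · have e : a.map π ⊔ b.map π = a.map π :=
        GoodSeq.ext (funext fun j => sup_eq_left.2 (t j))
      rw [e, ← map_add]; exact map_mono π h

/-- Elements that are nonzero in every chain -/
def Dense (k : L) : Prop :=
  ∀ (C : Type u) [BLAlgebra C], IsBLChain C → ∀ π : BLHom L C, π.toFun k ≠ 0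

theorem dense_one : Dense (1 : L) := fun C _ hC π => by
  rw [π.map_one]; exact hC.zero_ne.symm

theorem Dense.inf {k m : L} (hk : Dense k) (hm : Dense m) : Dense (k ⊓ m) := fun C _ hC π => by
  rw [π.map_inf]
  intro h
  rcases inf_zero hC h with h | h
  · exact hk C hC π h
  · exact hm C hC π h

theorem dense_sup_cpl (x : L) : Dense (x ⊔ cpl x) := fun C _ hC π => by
  rw [π.map_sup, π.map_cpl]
  intro h
  have h1 : π.toFun x = 0 := le_zero.1 (h ▸ le_sup_left)
  have h2 : cpl (π.toFun x) = 0 := le_zero.1 (h ▸ le_sup_right)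
  rw [h1, cpl_zero] at h2
  exact hC.zero_ne h2.symm

theorem exists_delta (a : GoodSeq L) : ∃ e : L, Dense e ∧ ∀ i, e ≤ a.val i ⊔ cpl (a.val i) := by
  obtain ⟨n, hn⟩ := a.fin
  have key : ∀ m : ℕ, ∃ e : L, Dense e ∧ ∀ i < m, e ≤ a.val i ⊔ cpl (a.val i) := by
    intro m
    induction m with
    | zero => exact ⟨1, dense_one, fun i hi => absurd hi (Nat.not_lt_zero i)⟩
    | succ m ih =>
      obtain ⟨e, he, h⟩ := ih
      refine ⟨e ⊓ (a.val m ⊔ cpl (a.val m)), he.inf (dense_sup_cpl _), fun i hi => ?_⟩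
      rcases Nat.lt_succ_iff_lt_or_eq.1 hi with h1 | h1
      · exact inf_le_left.trans (h i h1)
      · rw [h1]; exact inf_le_right
  obtain ⟨e, he, h⟩ := key (n + 1)
  refine ⟨e, he, fun i => ?_⟩
  by_cases hi : i < n + 1
  · exact h i hi
  · rw [hn i (by omega), cpl_zero]
    exact (le_one_all _).trans le_sup_right

theorem map_delta {a : GoodSeq L} {m : L} (f : BLHom L M)
    (h : ∀ i, m ≤ a.val i ⊔ cpl (a.val i)) (i : ℕ) :
    f.toFun m ≤ (a.map f).val i ⊔ cpl ((a.map f).val i) := by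
  have := f.map_le (h i)
  rwa [f.map_sup, f.map_cpl] at this

theorem lev_congr {a b : GoodSeq L} (c : GoodSeq L) {k : L} (hk : Dense k)
    (h : a + single k ≤ b + single k) : a + c + single k ≤ b + c + single k :=
  gs_le_of_chain fun C _ hC π => by
    have := map_mono π h
    simp only [map_add, map_single] at this ⊢
    exact gs_congr hC (hk C hC π) this

theorem lev_le {a b : GoodSeq L} {k m : L} (hk : Dense k) (hm : Dense m) (hmk : m ≤ k)
    (h : a + single k ≤ b + single k) : a + single m ≤ b + single m :=
  gs_le_of_chain fun C _ hC π => by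
    have := map_mono π h
    simp only [map_add, map_single] at this ⊢
    exact gs_le_level hC (hk C hC π) (hm C hC π) (π.map_le hmk) this

theorem lev_cancel {a b c : GoodSeq L} {k : L} (hk : Dense k)
    (h : a + c + single k ≤ b + c + single k) : ∃ m, Dense m ∧ a + single m ≤ b + single m := by
  obtain ⟨e, he, h1⟩ := exists_delta c
  obtain ⟨f, hf, h2⟩ := exists_delta (c + single k)
  have hm : Dense (e ⊓ f ⊓ k) := (he.inf hf).inf hk
  refine ⟨_, hm, gs_le_of_chain fun C _ hC π => ?_⟩
  have := map_mono π h
  have t2 := map_delta (m := e ⊓ f ⊓ k) π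
    (fun i => (inf_le_left.trans inf_le_right : e ⊓ f ⊓ k ≤ f).trans (h2 i))
  simp only [map_add, map_single] at this t2 ⊢
  exact gs_cancel_level hC (hk C hC π) (hm C hC π) (π.map_le inf_le_right)
    (map_delta π fun i => (inf_le_left.trans inf_le_left).trans (h1 i)) t2 this

theorem lev_assoc (a b c : GoodSeq L) :
    ∃ m, Dense m ∧ a + b + c + single m = a + (b + c) + single m := by
  obtain ⟨f, hf, h2⟩ := exists_delta b
  obtain ⟨g, hg, h3⟩ := exists_delta c
  have hm : Dense (f ⊓ g) := hf.inf hg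
  refine ⟨_, hm, gs_eq_of_chain fun C _ hC π => ?_⟩
  simp only [map_add, map_single]
  exact gs_assoc_level hC (hm C hC π)
    (map_delta π fun i => inf_le_left.trans (h2 i))
    (map_delta π fun i => inf_le_right.trans (h3 i))

/-- `a ≲ b` -/
def Pre (a b : GoodSeq L) : Prop := ∃ m, Dense m ∧ a + single m ≤ b + single m

theorem pre_of_le {a b : GoodSeq L} (h : a ≤ b) : Pre a b :=
  ⟨1, dense_one, gs_add_mono h le_rfl⟩

theorem pre_of_add {a b : GoodSeq L} (c : GoodSeq L) (h : a + c ≤ b + c) : Pre a b :=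
  lev_cancel dense_one (gs_add_mono h le_rfl)

theorem Pre.trans {a b c : GoodSeq L} (h : Pre a b) (k : Pre b c) : Pre a c := by
  obtain ⟨m, hm, h⟩ := h
  obtain ⟨n, hn, k⟩ := k
  exact ⟨m ⊓ n, hm.inf hn, (lev_le hm (hm.inf hn) inf_le_left h).trans
    (lev_le hn (hm.inf hn) inf_le_right k)⟩

theorem Pre.add {a b : GoodSeq L} (h : Pre a b) (c : GoodSeq L) : Pre (a + c) (b + c) := by
  obtain ⟨m, hm, h⟩ := h
  exact ⟨m, hm, lev_congr c hm h⟩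

theorem Pre.cancel {a b c : GoodSeq L} (h : Pre (a + c) (b + c)) : Pre a b := by
  obtain ⟨m, hm, h⟩ := h
  exact lev_cancel hm h

theorem pre_eq {a b : GoodSeq L} (h : Pre a b) (k : Pre b a) :
    ∃ c, a + c = b + c := by
  obtain ⟨m, hm, h⟩ := h
  obtain ⟨n, hn, k⟩ := k
  exact ⟨single (m ⊓ n), le_antisymm (lev_le hm (hm.inf hn) inf_le_left h)
    (lev_le hn (hm.inf hn) inf_le_right k)⟩

theorem Pre.max {a b c : GoodSeq L} (h : Pre a c) (k : Pre b c) : Pre (a ⊔ b) c := by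
  obtain ⟨m, hm, h⟩ := h
  obtain ⟨n, hn, k⟩ := k
  exact ⟨m ⊓ n, hm.inf hn, max_add_le (lev_le hm (hm.inf hn) inf_le_left h)
    (lev_le hn (hm.inf hn) inf_le_right k)⟩

theorem gs_add_zero (a : GoodSeq L) : a + single 0 = a := by
  refine GoodSeq.ext (funext fun i => ?_)
  change conv _ _ i = _
  unfold conv
  rw [Finset.sum_eq_single (i, 0)]
  · exact mul_one _
  · rintro ⟨j, k⟩ hjk h
    rw [Finset.HasAntidiagonal.mem_antidiagonal] at hjk
    have hk : k ≠ 0 := by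
      rintro rfl
      exact h (Prod.ext (by dsimp only at hjk ⊢; omega) rfl)
    change a.val j * (if k = 0 then 1 else if k = 1 then 0 else 0) = 0
    rw [if_neg hk, ite_self, mul_zero_all]
  · intro h
    exact (h (Finset.HasAntidiagonal.mem_antidiagonal.2 (by simp))).elim

/-- The equivalence relation of `Pre` -/
def preSetoid (L : Type u) [BLAlgebra L] : Setoid (GoodSeq L) where
  r a b := Pre a b ∧ Pre b a
  iseqv :=
    { refl := fun _ => ⟨pre_of_le le_rfl, pre_of_le le_rfl⟩
      symm := fun h => ⟨h.2, h.1⟩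
      trans := fun h k => ⟨h.1.trans k.1, k.2.trans h.2⟩ }

/-- Auxiliary: good sequences up to the preorder; an ordered cancellative monoid. -/
def Can (L : Type u) [BLAlgebra L] : Type u := Quotient (preSetoid L)

/-- The class of a good sequence -/
def cls (a : GoodSeq L) : Can L := Quotient.mk _ a

instance : Zero (Can L) where
  zero := cls (single 0)

instance : Add (Can L) where
  add := Quotient.map₂ (· + ·) (by
    intro a b h c d k
    have aux : ∀ {a b c d : GoodSeq L}, Pre a b → Pre c d → Pre (a + c) (b + d) := by
      intro a b c d h k
      refine (h.add c).trans ?_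
      rw [gs_add_comm b, gs_add_comm b]
      exact k.add b
    exact ⟨aux h.1 k.1, aux h.2 k.2⟩)

instance : AddCommMonoid (Can L) where
  add_assoc := by
    rintro ⟨a⟩ ⟨b⟩ ⟨c⟩
    obtain ⟨m, hm, h⟩ := lev_assoc a b c
    exact Quotient.sound ⟨⟨m, hm, h.le⟩, ⟨m, hm, h.ge⟩⟩
  zero_add := by
    rintro ⟨a⟩
    exact congrArg cls ((gs_add_comm _ _).trans (gs_add_zero a))
  add_zero := by
    rintro ⟨a⟩
    exact congrArg cls (gs_add_zero a)
  add_comm := by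
    rintro ⟨a⟩ ⟨b⟩
    exact congrArg cls (gs_add_comm a b)
  nsmul := nsmulRec

instance : PartialOrder (Can L) where
  le := Quotient.lift₂ Pre (by
    intro a b c d h k
    exact propext ⟨fun t => h.2.trans (t.trans k.1), fun t => h.1.trans (t.trans k.2)⟩)
  le_refl := by rintro ⟨a⟩; exact pre_of_le le_rfl
  le_trans := by rintro ⟨a⟩ ⟨b⟩ ⟨c⟩ h k; exact Pre.trans h k
  le_antisymm := by rintro ⟨a⟩ ⟨b⟩ h k; exact Quotient.sound ⟨h, k⟩

instance : IsOrderedCancelAddMonoid (Can L) where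
  add_le_add_left := by
    rintro ⟨a⟩ ⟨b⟩ h ⟨c⟩
    exact Pre.add h c
  le_of_add_le_add_left := by
    rintro ⟨a⟩ ⟨b⟩ ⟨c⟩ h
    change Pre (a + b) (a + c) at h
    rw [gs_add_comm a, gs_add_comm a] at h
    exact h.cancel

theorem cls_add (a b : GoodSeq L) : cls (a + b) = cls a + cls b := rfl

theorem cls_le {a b : GoodSeq L} : cls a ≤ cls b ↔ ∃ c, a + c ≤ b + c :=
  ⟨fun h => ⟨single (Classical.choose h), (Classical.choose_spec h).2⟩,
    fun ⟨c, h⟩ => pre_of_add c h⟩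

theorem cls_eq {a b : GoodSeq L} : cls a = cls b ↔ ∃ c, a + c = b + c :=
  ⟨fun h => pre_eq (Quotient.exact h).1 (Quotient.exact h).2,
    fun ⟨c, h⟩ => le_antisymm (pre_of_add c h.le) (pre_of_add c h.ge)⟩

theorem cls_le_of_le {a b : GoodSeq L} (h : a ≤ b) : cls a ≤ cls b := pre_of_le h

theorem cls_max {a b : GoodSeq L} {x : Can L} : cls (a ⊔ b) ≤ x ↔ cls a ≤ x ∧ cls b ≤ x := by
  obtain ⟨c, rfl⟩ : ∃ c, cls c = x := Quotient.exists_rep x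
  refine ⟨fun h => ⟨le_trans (pre_of_le (le_max_l a b)) h, le_trans (pre_of_le (le_max_r a b)) h⟩,
    fun h => Pre.max h.1 h.2⟩

theorem cls_max_add {a b c w : GoodSeq L} :
    cls (a ⊔ b + c) ≤ cls w ↔ cls (a + c) ≤ cls w ∧ cls (b + c) ≤ cls w :=
  ⟨fun h => ⟨(cls_le_of_le (gs_add_mono (le_max_l a b) le_rfl)).trans h,
    (cls_le_of_le (gs_add_mono (le_max_r a b) le_rfl)).trans h⟩,
    fun h => (cls_le_of_le (max_add_le (le_max_l _ _) (le_max_r _ _))).trans (cls_max.2 h)⟩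

end Global
end GoodSeq

open GoodSeq in
/-- The Grothendieck relation on pairs of good sequences: `(𝐚, 𝐛) ∼ (𝐜, 𝐝)` if and only if
`(𝐚 + 𝐝) + 𝐤 = (𝐛 + 𝐜) + 𝐤` for some good sequence `𝐤`. -/
def changSetoid (L : Type u) [BLAlgebra L] : Setoid (GoodSeq L × GoodSeq L) where
  r p q := ∃ k, p.1 + q.2 + k = p.2 + q.1 + k
  iseqv :=
    { refl := fun p => ⟨p.1, by rw [gs_add_comm p.1 p.2]⟩
      symm := fun {p q} ⟨k, h⟩ => ⟨k, by rw [gs_add_comm q.1, gs_add_comm q.2, h]⟩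
      trans := fun {p q r} h k => by
        rw [← cls_eq, cls_add, cls_add] at h k ⊢
        apply add_right_cancel (b := cls q.2 + cls q.1)
        calc cls p.1 + cls r.2 + (cls q.2 + cls q.1)
            = (cls p.1 + cls q.2) + (cls q.1 + cls r.2) := by abel
          _ = (cls p.2 + cls q.1) + (cls q.2 + cls r.1) := by rw [h, k]
          _ = cls p.2 + cls r.1 + (cls q.2 + cls q.1) := by abel }

/-- Chang's group `G_L` of a BL-algebra `L`. -/
def ChangGroup (L : Type u) [BLAlgebra L] : Type u := Quotient (changSetoid L)

namespace ChangGroup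
open BLAlgebra GoodSeq

section Defs
variable {L M : Type u} [BLAlgebra L] [BLAlgebra M]

/-- The class `[𝐚, 𝐛]`. -/
def mk (a b : GoodSeq L) : ChangGroup L := Quotient.mk (changSetoid L) (a, b)

theorem exists_mk (x : ChangGroup L) : ∃ a b, mk a b = x := by
  obtain ⟨⟨a, b⟩, rfl⟩ := Quotient.exists_rep x
  exact ⟨a, b, rfl⟩

theorem mk_eq_cls {a b c d : GoodSeq L} :
    mk a b = mk c d ↔ cls a + cls d = cls b + cls c := by
  rw [← cls_add, ← cls_add, cls_eq]
  exact Quotient.eq (r := changSetoid L)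

/-- `[𝐚, 𝐛] + [𝐜, 𝐝] = [𝐚 + 𝐜, 𝐛 + 𝐝]` -/
instance : Add (ChangGroup L) where
  add := Quotient.map₂ (fun p q => (p.1 + q.1, p.2 + q.2)) (by
    intro p p' h q q' k
    refine Quotient.exact (s := changSetoid L) (mk_eq_cls.2 ?_)
    replace h := mk_eq_cls.1 (Quotient.sound (s := changSetoid L) h)
    replace k := mk_eq_cls.1 (Quotient.sound (s := changSetoid L) k)
    simp only [cls_add]
    calc cls p.1 + cls q.1 + (cls p'.2 + cls q'.2)
        = (cls p.1 + cls p'.2) + (cls q.1 + cls q'.2) := by abel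
      _ = (cls p.2 + cls p'.1) + (cls q.2 + cls q'.1) := by rw [h, k]
      _ = _ := by abel)

/-- `0 = [(0), (0)]` -/
instance : Zero (ChangGroup L) where
  zero := mk (single 0) (single 0)

/-- `-[𝐚, 𝐛] = [𝐛, 𝐚]` -/
instance : Neg (ChangGroup L) where
  neg := Quotient.map (fun p => (p.2, p.1)) (by
    intro p q h
    obtain ⟨k, h⟩ := h
    exact ⟨k, h.symm⟩)

theorem mk_add (a b c d : GoodSeq L) : mk a b + mk c d = mk (a + c) (b + d) := rfl
theorem neg_mk (a b : GoodSeq L) : -mk a b = mk b a := rfl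
theorem zero_def : (0 : ChangGroup L) = mk (single 0) (single 0) := rfl
theorem cls_zero : cls (single (0 : L)) = 0 := rfl

instance : AddCommGroup (ChangGroup L) where
  add_assoc x y z := by
    obtain ⟨a, b, rfl⟩ := exists_mk x
    obtain ⟨c, d, rfl⟩ := exists_mk y
    obtain ⟨e, f, rfl⟩ := exists_mk z
    simp only [mk_add, mk_eq_cls, cls_add]
    abel
  zero_add x := by
    obtain ⟨a, b, rfl⟩ := exists_mk x
    simp only [zero_def, mk_add, mk_eq_cls, cls_add, cls_zero]
    abel
  add_zero x := by
    obtain ⟨a, b, rfl⟩ := exists_mk x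
    simp only [zero_def, mk_add, mk_eq_cls, cls_add, cls_zero]
    abel
  add_comm x y := by
    obtain ⟨a, b, rfl⟩ := exists_mk x
    obtain ⟨c, d, rfl⟩ := exists_mk y
    simp only [mk_add, mk_eq_cls, cls_add]
    abel
  neg_add_cancel x := by
    obtain ⟨a, b, rfl⟩ := exists_mk x
    simp only [neg_mk, zero_def, mk_add, mk_eq_cls, cls_add, cls_zero]
    abel
  nsmul := nsmulRec
  zsmul := zsmulRec

theorem le_aux {a b c d a' b' c' d' : GoodSeq L} (h : mk a b = mk a' b') (k : mk c d = mk c' d')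
    (t : ∃ e, a + d + e ≤ b + c + e) : ∃ e, a' + d' + e ≤ b' + c' + e := by
  rw [← cls_le, cls_add, cls_add] at t ⊢
  rw [mk_eq_cls] at h k
  refine le_of_add_le_add_right (a := cls a + cls b + (cls c + cls d)) ?_
  calc cls a' + cls d' + (cls a + cls b + (cls c + cls d))
      = (cls a + cls d) + (cls b + cls a') + (cls c + cls d') := by abel
    _ = (cls a + cls d) + (cls a + cls b') + (cls d + cls c') := by rw [h, k]
    _ ≤ (cls b + cls c) + (cls a + cls b') + (cls d + cls c') := by gcongr
    _ = cls b' + cls c' + (cls a + cls b + (cls c + cls d)) := by abel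

/-- `[𝐚, 𝐛] ≼ [𝐜, 𝐝]` if and only if `(𝐚 + 𝐝) + 𝐤 ≤ (𝐛 + 𝐜) + 𝐤` for some good sequence `𝐤`. -/
instance : LE (ChangGroup L) where
  le := Quotient.lift₂ (fun p q => ∃ k, p.1 + q.2 + k ≤ p.2 + q.1 + k) (by
    intro p q p' q' h k
    have h' := Quotient.sound (s := changSetoid L) h
    have k' := Quotient.sound (s := changSetoid L) k
    exact propext ⟨le_aux h' k', le_aux h'.symm k'.symm⟩)

theorem mk_le_cls {a b c d : GoodSeq L} :
    mk a b ≤ mk c d ↔ cls a + cls d ≤ cls b + cls c := by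
  rw [← cls_add, ← cls_add, cls_le]
  exact Iff.rfl

instance : PartialOrder (ChangGroup L) where
  le_refl x := by
    obtain ⟨a, b, rfl⟩ := exists_mk x
    rw [mk_le_cls, add_comm]
  le_trans x y z h k := by
    obtain ⟨a, b, rfl⟩ := exists_mk x
    obtain ⟨c, d, rfl⟩ := exists_mk y
    obtain ⟨e, f, rfl⟩ := exists_mk z
    rw [mk_le_cls] at h k ⊢
    refine le_of_add_le_add_right (a := cls c + cls d) ?_
    calc cls a + cls f + (cls c + cls d) = (cls a + cls d) + (cls c + cls f) := by abel
      _ ≤ (cls b + cls c) + (cls d + cls e) := add_le_add h k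
      _ = _ := by abel
  le_antisymm x y h k := by
    obtain ⟨a, b, rfl⟩ := exists_mk x
    obtain ⟨c, d, rfl⟩ := exists_mk y
    rw [mk_le_cls] at h k
    rw [mk_eq_cls]
    refine le_antisymm h ?_
    rw [add_comm, add_comm (cls a)]
    rw [add_comm, add_comm (cls d)] at k
    rw [add_comm (cls c), add_comm (cls d)]
    exact k

instance : IsOrderedAddMonoid (ChangGroup L) where
  add_le_add_left x y h z := by
    obtain ⟨a, b, rfl⟩ := exists_mk x
    obtain ⟨c, d, rfl⟩ := exists_mk y
    obtain ⟨e, f, rfl⟩ := exists_mk z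
    rw [mk_add, mk_add, mk_le_cls]
    rw [mk_le_cls] at h
    simp only [cls_add]
    calc cls a + cls e + (cls d + cls f) = (cls a + cls d) + (cls e + cls f) := by abel
      _ ≤ (cls b + cls c) + (cls e + cls f) := by gcongr
      _ = _ := by abel

theorem join_le {a b c d : GoodSeq L} {z : ChangGroup L} :
    mk ((a + d) ⊔ (b + c)) (b + d) ≤ z ↔ mk a b ≤ z ∧ mk c d ≤ z := by
  obtain ⟨e, f, rfl⟩ := exists_mk z
  rw [mk_le_cls, mk_le_cls, mk_le_cls, ← cls_add, ← cls_add (b + d), cls_max_add]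
  simp only [cls_add]
  have e1 : cls a + cls d + cls f = cls a + cls f + cls d := by abel
  have e2 : cls b + cls d + cls e = cls b + cls e + cls d := by abel
  have e3 : cls b + cls c + cls f = cls c + cls f + cls b := by abel
  have e4 : cls b + cls d + cls e = cls d + cls e + cls b := by abel
  refine and_congr ?_ ?_
  · rw [e1, e2]; exact add_le_add_iff_right _
  · rw [e3, e4]; exact add_le_add_iff_right _

/-- `[𝐚, 𝐛] ∨ [𝐜, 𝐝] = [(𝐚 + 𝐝) ∨ (𝐛 + 𝐜), 𝐛 + 𝐝]` -/
instance : Max (ChangGroup L) where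
  max := Quotient.map₂ (fun p q => ((p.1 + q.2) ⊔ (p.2 + q.1), p.2 + q.2)) (by
    intro p p' h q q' k
    have h' : mk p.1 p.2 = mk p'.1 p'.2 := Quotient.sound (s := changSetoid L) h
    have k' : mk q.1 q.2 = mk q'.1 q'.2 := Quotient.sound (s := changSetoid L) k
    refine Quotient.exact (s := changSetoid L)
      (le_antisymm (α := ChangGroup L) (a := mk _ _) (b := mk _ _) ?_ ?_)
    · refine join_le.2 ?_
      rw [h', k']; exact join_le.1 le_rfl
    · refine join_le.2 ?_
      rw [← h', ← k']; exact join_le.1 le_rfl)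

theorem mk_sup (a b c d : GoodSeq L) :
    mk a b ⊔ mk c d = mk ((a + d) ⊔ (b + c)) (b + d) := rfl

theorem max_le_iff_all {x y z : ChangGroup L} : x ⊔ y ≤ z ↔ x ≤ z ∧ y ≤ z := by
  obtain ⟨a, b, rfl⟩ := exists_mk x
  obtain ⟨c, d, rfl⟩ := exists_mk y
  exact join_le

instance : Lattice (ChangGroup L) where
  sup := (· ⊔ ·)
  inf x y := -(-x ⊔ -y)
  le_sup_left _ _ := (max_le_iff_all.1 le_rfl).1
  le_sup_right _ _ := (max_le_iff_all.1 le_rfl).2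
  sup_le _ _ _ h k := max_le_iff_all.2 ⟨h, k⟩
  inf_le_left _ _ := neg_le.1 (max_le_iff_all.1 le_rfl).1
  inf_le_right _ _ := neg_le.1 (max_le_iff_all.1 le_rfl).2
  le_inf _ _ _ h k := le_neg.1 (max_le_iff_all.2 ⟨neg_le_neg h, neg_le_neg k⟩)

/-- The unit `u_L = [(1), (0)]`. -/
def unit (L : Type u) [BLAlgebra L] : ChangGroup L := mk (single 1) (single 0)

theorem unit_nonneg : 0 ≤ unit L := by
  rw [zero_def, unit, mk_le_cls]
  simp only [cls_zero, add_zero, zero_add]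
  refine cls_le_of_le fun i => ?_
  change (if i = 0 then 1 else if i = 1 then 0 else 0) ≤ if i = 0 then (1 : L) else if i = 1 then 1 else 0
  split_ifs
  · exact le_rfl
  · exact le_one_all _
  · exact le_rfl

theorem add_single_one (a : GoodSeq L) (i : ℕ) : (a + single 1).val (i + 1) = a.val i := by
  refine eq_of_chain fun C _ hC π => ?_
  change ((a + single 1).map π).val (i + 1) = (a.map π).val i
  rw [GoodSeq.map_add, map_single, π.map_one]
  obtain ⟨p, hp, ep⟩ := exists_R hC (a.map π)
  have h1 : (1 : C) ≠ 0 := hC.zero_ne.symm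
  rw [add_val hC hp (valid_one h1) ep (single_val 1), ep, pp_ne (by rw [mul_one]; exact hp.1)]
  simp only [R, mul_one, Nat.add_lt_add_iff_right, Nat.add_right_cancel_iff]

theorem unit_strong (x : ChangGroup L) : ∃ n : ℕ, 1 ≤ n ∧ x ≤ n • unit L := by
  obtain ⟨a, b, rfl⟩ := exists_mk x
  have key : ∀ n : ℕ, ∃ c : GoodSeq L, n • unit L = mk c (single 0) ∧
      ∀ i, i ≤ n → c.val i = 1 := by
    intro n
    induction n with
    | zero =>
      refine ⟨single 0, by rw [zero_smul]; rfl, fun i hi => ?_⟩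
      rw [Nat.le_zero.1 hi]; exact (single 0).val_zero
    | succ n ih =>
      obtain ⟨c, h, hc⟩ := ih
      refine ⟨c + single 1, ?_, ?_⟩
      · rw [succ_nsmul, h, unit, mk_add, gs_add_zero]
      · intro i hi
        cases i with
        | zero => exact (c + single 1).val_zero
        | succ i => rw [add_single_one]; exact hc i (by omega)
  obtain ⟨n, hn⟩ := a.fin
  obtain ⟨c, h, hc⟩ := key (n + 1)
  refine ⟨n + 1, by omega, ?_⟩
  rw [h, mk_le_cls, cls_zero, add_zero]
  have h1 : cls a ≤ cls c := cls_le_of_le fun i => by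
    by_cases hi : i ≤ n
    · rw [hc i (by omega)]; exact le_one_all _
    · rw [hn i (by omega)]; exact zero_le_all _
  have h2 : (0 : Can L) ≤ cls b := by
    rw [← cls_zero]
    refine cls_le_of_le fun i => ?_
    change (if i = 0 then 1 else if i = 1 then 0 else 0) ≤ b.val i
    split_ifs with h
    · rw [h, b.val_zero]
    · exact zero_le_all _
    · exact zero_le_all _
  calc cls a ≤ cls c := h1
    _ = 0 + cls c := (zero_add _).symm
    _ ≤ cls b + cls c := by gcongr

/-- `[𝐚, 𝐛] ↦ [f(𝐚), f(𝐛)]` -/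
def map (f : BLHom L M) : ChangGroup L → ChangGroup M :=
  Quotient.map (fun p => (p.1.map f, p.2.map f)) (by
    rintro p q ⟨k, h⟩
    refine ⟨k.map f, ?_⟩
    simp only [← GoodSeq.map_add, h])

theorem map_mk (f : BLHom L M) (a b : GoodSeq L) : map f (mk a b) = mk (a.map f) (b.map f) := rfl

theorem map_add (f : BLHom L M) (x y : ChangGroup L) : map f (x + y) = map f x + map f y := by
  obtain ⟨a, b, rfl⟩ := exists_mk x
  obtain ⟨c, d, rfl⟩ := exists_mk y
  simp only [mk_add, map_mk, GoodSeq.map_add]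

theorem map_neg (f : BLHom L M) (x : ChangGroup L) : map f (-x) = -map f x := by
  obtain ⟨a, b, rfl⟩ := exists_mk x
  rfl

theorem map_sup (f : BLHom L M) (x y : ChangGroup L) : map f (x ⊔ y) = map f x ⊔ map f y := by
  obtain ⟨a, b, rfl⟩ := exists_mk x
  obtain ⟨c, d, rfl⟩ := exists_mk y
  simp only [mk_sup, map_mk, GoodSeq.map_add, GoodSeq.map_max]

theorem map_inf (f : BLHom L M) (x y : ChangGroup L) : map f (x ⊓ y) = map f x ⊓ map f y := by
  change map f (-(-x ⊔ -y)) = -(-map f x ⊔ -map f y)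
  rw [map_neg, map_sup, map_neg, map_neg]

theorem map_unit (f : BLHom L M) : map f (unit L) = unit M := by
  rw [unit, unit, map_mk, map_single, map_single, f.map_one, f.map_zero]

end Defs
end ChangGroup

/-- An abelian lattice-ordered group with a strong unit. -/
structure LUGroup where
  carrier : Type u
  [grp : AddCommGroup carrier]
  [lat : Lattice carrier]
  [ord : IsOrderedAddMonoid carrier]
  unit : carrier
  unit_nonneg : 0 ≤ unit
  strong : ∀ x : carrier, ∃ n : ℕ, 1 ≤ n ∧ x ≤ n • unit

attribute [instance] LUGroup.grp LUGroup.lat LUGroup.ord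

/-- Morphisms of lattice-ordered groups with strong unit. -/
@[ext]
structure LUHom (G H : LUGroup.{u}) where
  toFun : G.carrier → H.carrier
  map_add : ∀ x y, toFun (x + y) = toFun x + toFun y
  map_sup : ∀ x y, toFun (x ⊔ y) = toFun x ⊔ toFun y
  map_inf : ∀ x y, toFun (x ⊓ y) = toFun x ⊓ toFun y
  map_unit : toFun G.unit = H.unit

/-- The category of abelian lattice-ordered groups with strong unit. -/
instance : Category LUGroup.{u} where
  Hom G H := LUHom G H
  id G := ⟨fun x => x, fun _ _ => rfl, fun _ _ => rfl, fun _ _ => rfl, rfl⟩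
  comp f g := ⟨fun x => g.toFun (f.toFun x), fun x y => by rw [f.map_add, g.map_add],
    fun x y => by rw [f.map_sup, g.map_sup], fun x y => by rw [f.map_inf, g.map_inf],
    by rw [f.map_unit, g.map_unit]⟩

/-- A bundled BL-algebra. -/
structure BLCat where
  carrier : Type u
  [str : BLAlgebra carrier]

attribute [instance] BLCat.str

/-- The category of BL-algebras. -/
instance : Category BLCat.{u} where
  Hom L M := BLHom L.carrier M.carrier
  id L := BLHom.id L.carrier
  comp f g := BLHom.comp g f

/-- The functor `Ξ`, `L ↦ ⟨G_L, u_L⟩`. -/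
def Xi : BLCat.{u} ⥤ LUGroup.{u} where
  obj L :=
    { carrier := ChangGroup L.carrier
      unit := ChangGroup.unit L.carrier
      unit_nonneg := ChangGroup.unit_nonneg
      strong := ChangGroup.unit_strong }
  map f := ⟨ChangGroup.map f, ChangGroup.map_add f, ChangGroup.map_sup f, ChangGroup.map_inf f,
    ChangGroup.map_unit f⟩
  map_id L := LUHom.ext (funext fun x => by
    obtain ⟨a, b, rfl⟩ := ChangGroup.exists_mk x
    rfl)
  map_comp f g := LUHom.ext (funext fun x => by
    obtain ⟨a, b, rfl⟩ := ChangGroup.exists_mk x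
    rfl)

/-- The unit interval `[0, u]` of `⟨G, u⟩`. -/
def GammaCarrier (G : LUGroup.{u}) : Type u := {x : G.carrier // 0 ≤ x ∧ x ≤ G.unit}

instance (G : LUGroup.{u}) : Lattice (GammaCarrier G) :=
  Subtype.lattice (fun _ _ hx hy => ⟨hx.1.trans le_sup_left, sup_le hx.2 hy.2⟩)
    (fun _ _ hx hy => ⟨le_inf hx.1 hy.1, inf_le_left.trans hx.2⟩)

section GammaAux
variable {A : Type u} [AddCommGroup A] [Lattice A] [IsOrderedAddMonoid A]

theorem gamma_mul_eq (v x y : A) :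
    v - ((2 : ℕ) • v - x - y) ⊓ v = (x + y - v) ⊔ 0 := by
  rw [sub_eq_add_neg, neg_inf, add_sup]
  congr 1
  · rw [two_nsmul]; abel
  · abel

theorem gamma_mul_le (v x y z : A) (hy : 0 ≤ y) :
    v - ((2 : ℕ) • v - x - z) ⊓ v ≤ y ↔ z ≤ v - x + y := by
  rw [gamma_mul_eq, sup_le_iff, and_iff_left hy, sub_le_iff_le_add]
  constructor <;> intro h
  · have := sub_le_sub_right h x
    calc z = x + z - x := by abel
      _ ≤ _ := this
      _ = _ := by abel
  · have := add_le_add_right h x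
    calc x + z ≤ x + (v - x + y) := this
      _ = _ := by abel

theorem gamma_assoc_aux (v x y z : A) (hz : z ≤ v) :
    ((x + y - v) ⊔ 0 + z - v) ⊔ 0 = (x + y + z - (2 : ℕ) • v) ⊔ 0 := by
  have e : (x + y - v) ⊔ 0 + z - v = (x + y + z - (2 : ℕ) • v) ⊔ (z - v) := by
    rw [add_sub_assoc, sup_add]
    congr 1
    · rw [two_nsmul]; abel
    · abel
  rw [e, sup_assoc, sup_eq_right.2 (sub_nonpos.2 hz)]

end GammaAux

/-- The BL-algebra structure of `[0, u]`: `x ⊗ y = u - (2u - x - y) ∧ u` and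
`x → y = (u - x + y) ∧ u`, with bounds `0` and `u`. -/
instance (G : LUGroup.{u}) : BLAlgebra (GammaCarrier G) where
  mul x y := ⟨G.unit - ((2 : ℕ) • G.unit - x.1 - y.1) ⊓ G.unit, by
    refine ⟨sub_nonneg.2 inf_le_right, ?_⟩
    rw [gamma_mul_le _ _ _ _ G.unit_nonneg]
    refine y.2.2.trans ?_
    exact le_add_of_nonneg_left (sub_nonneg.2 x.2.2)⟩
  imp x y := ⟨(G.unit - x.1 + y.1) ⊓ G.unit,
    le_inf (add_nonneg (sub_nonneg.2 x.2.2) y.2.1) G.unit_nonneg, inf_le_right⟩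
  zero := ⟨0, le_rfl, G.unit_nonneg⟩
  one := ⟨G.unit, G.unit_nonneg, le_rfl⟩
  mul_assoc x y z := Subtype.ext (by
    change G.unit - ((2 : ℕ) • G.unit - (G.unit - ((2 : ℕ) • G.unit - x.1 - y.1) ⊓ G.unit) - z.1)
        ⊓ G.unit =
      G.unit - ((2 : ℕ) • G.unit - x.1 - (G.unit - ((2 : ℕ) • G.unit - y.1 - z.1) ⊓ G.unit))
        ⊓ G.unit
    simp only [gamma_mul_eq]
    rw [add_comm x.1 (_ ⊔ _), gamma_assoc_aux _ _ _ _ z.2.2, gamma_assoc_aux _ _ _ _ x.2.2]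
    congr 2
    abel)
  mul_comm x y := Subtype.ext (by
    change G.unit - ((2 : ℕ) • G.unit - x.1 - y.1) ⊓ G.unit =
      G.unit - ((2 : ℕ) • G.unit - y.1 - x.1) ⊓ G.unit
    rw [sub_right_comm])
  one_mul x := Subtype.ext (by
    change G.unit - ((2 : ℕ) • G.unit - G.unit - x.1) ⊓ G.unit = x.1
    rw [gamma_mul_eq, add_sub_cancel_left, sup_eq_left.2 x.2.1])
  mul_one x := Subtype.ext (by
    change G.unit - ((2 : ℕ) • G.unit - x.1 - G.unit) ⊓ G.unit = x.1
    rw [gamma_mul_eq, add_sub_cancel_right, sup_eq_left.2 x.2.1])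
  zero_le_all x := x.2.1
  le_one_all x := x.2.2
  le_imp_iff x y z := by
    change z.1 ≤ (G.unit - x.1 + y.1) ⊓ G.unit ↔
      G.unit - ((2 : ℕ) • G.unit - x.1 - z.1) ⊓ G.unit ≤ y.1
    rw [gamma_mul_le _ _ _ _ y.2.1, le_inf_iff, and_iff_left z.2.2]
  inf_eq x y := Subtype.ext (by
    change x.1 ⊓ y.1 = G.unit - ((2 : ℕ) • G.unit - x.1 - (G.unit - x.1 + y.1) ⊓ G.unit) ⊓ G.unit
    rw [gamma_mul_eq, add_inf, sub_eq_add_neg, inf_add]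
    have e1 : x.1 + (G.unit - x.1 + y.1) + -G.unit = y.1 := by abel
    have e2 : x.1 + G.unit + -G.unit = x.1 := by abel
    rw [e1, e2, inf_comm, sup_eq_left.2 (le_inf y.2.1 x.2.1)])
  prelinear x y := Subtype.ext (by
    change (G.unit - x.1 + y.1) ⊓ G.unit ⊔ (G.unit - y.1 + x.1) ⊓ G.unit = G.unit
    refine le_antisymm (sup_le inf_le_right inf_le_right) ?_
    let _ := AddCommGroup.toDistribLattice G.carrier
    rw [← inf_sup_right]
    refine le_inf ?_ le_rfl
    have e : (G.unit - x.1 + y.1) ⊔ (G.unit - y.1 + x.1) = G.unit + |y.1 - x.1| := by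
      rw [abs, add_sup]
      congr 1 <;> abel
    rw [e]
    exact le_add_of_nonneg_right (abs_nonneg _))

theorem LUHom.map_zero {G H : LUGroup.{u}} (f : LUHom G H) : f.toFun 0 = 0 := by
  have h := f.map_add 0 0
  rw [add_zero] at h
  exact left_eq_add.1 h

theorem LUHom.map_sub {G H : LUGroup.{u}} (f : LUHom G H) (x y : G.carrier) :
    f.toFun (x - y) = f.toFun x - f.toFun y := by
  have h := f.map_add (x - y) y
  rw [sub_add_cancel] at h
  rw [h, add_sub_cancel_right]

theorem LUHom.mono {G H : LUGroup.{u}} (f : LUHom G H) {x y : G.carrier} (h : x ≤ y) :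
    f.toFun x ≤ f.toFun y := by
  rw [← sup_eq_right] at h ⊢
  rw [← f.map_sup, h]

/-- Mundici's functor `Γ`, `⟨G, u⟩ ↦ [0, u]`, with values in the category of BL-algebras; a
morphism is restricted to `[0, u]`. -/
def Gamma : LUGroup.{u} ⥤ BLCat.{u} where
  obj G := { carrier := GammaCarrier G }
  map {G H} f :=
    { toFun := fun x => ⟨LUHom.toFun f x.1, by
        refine ⟨?_, ?_⟩
        · have := LUHom.mono f x.2.1
          rwa [LUHom.map_zero] at this
        · have := LUHom.mono f x.2.2
          rwa [LUHom.map_unit] at this⟩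
      map_mul := fun x y => Subtype.ext (by
        change LUHom.toFun f (G.unit - ((2 : ℕ) • G.unit - x.1 - y.1) ⊓ G.unit) =
          H.unit - ((2 : ℕ) • H.unit - LUHom.toFun f x.1 - LUHom.toFun f y.1) ⊓ H.unit
        simp only [two_nsmul, LUHom.map_sub, LUHom.map_inf, LUHom.map_add, LUHom.map_unit])
      map_imp := fun x y => Subtype.ext (by
        change LUHom.toFun f ((G.unit - x.1 + y.1) ⊓ G.unit) =
          (H.unit - LUHom.toFun f x.1 + LUHom.toFun f y.1) ⊓ H.unit
        simp only [LUHom.map_sub, LUHom.map_inf, LUHom.map_add, LUHom.map_unit])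
      map_zero := Subtype.ext (LUHom.map_zero f)
      map_one := Subtype.ext (LUHom.map_unit f) }
  map_id _ := rfl
  map_comp _ _ := rfl

/-- The product residuum on `[0, 1]`: `x → y = 1` if `x ≤ y`, and `y / x` otherwise. -/
noncomputable def prodImp (x y : unitInterval) : unitInterval :=
  ⟨if (x : ℝ) ≤ y then 1 else (y : ℝ) / x, by
    split_ifs with h
    · exact ⟨zero_le_one, le_rfl⟩
    · exact ⟨div_nonneg y.2.1 x.2.1, div_le_one_of_le₀ (not_le.1 h).le x.2.1⟩⟩

/-- The product algebra on `[0, 1]`: `x ⊗ y` is the product of real numbers. -/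
noncomputable instance : BLAlgebra unitInterval where
  imp := prodImp
  zero_le_all x := x.2.1
  le_one_all x := x.2.2
  le_imp_iff x y z := by
    change (z : ℝ) ≤ (if (x : ℝ) ≤ y then 1 else (y : ℝ) / x) ↔ (x : ℝ) * z ≤ y
    split_ifs with h
    · exact ⟨fun _ => (mul_le_of_le_one_right x.2.1 z.2.2).trans h, fun _ => z.2.2⟩
    · have hx : (0 : ℝ) < x := lt_of_le_of_lt y.2.1 (not_le.1 h)
      rw [le_div_iff₀ hx, mul_comm]
  inf_eq x y := Subtype.ext (by
    change ((x ⊓ y : unitInterval) : ℝ) = (x : ℝ) * (if (x : ℝ) ≤ y then 1 else (y : ℝ) / x)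
    split_ifs with h
    · rw [mul_one, inf_eq_left.2 (show x ≤ y from h)]
    · have hx : (0 : ℝ) < x := lt_of_le_of_lt y.2.1 (not_le.1 h)
      rw [mul_div_cancel₀ _ hx.ne', inf_eq_right.2 (show y ≤ x from (not_le.1 h).le)])
  prelinear x y := by
    have key : ∀ a b : unitInterval, a ≤ b → prodImp a b = 1 := fun a b h =>
      Subtype.ext (if_pos h)
    have le1 : ∀ a : unitInterval, a ≤ 1 := fun a => a.2.2
    rcases le_total x y with h | h
    · rw [key x y h, sup_eq_left.2 (le1 _)]
    · rw [key y x h, sup_eq_right.2 (le1 _)]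

/-- `L = [0, 1]` with the product structure. -/
noncomputable def productAlgebra : BLCat.{0} := { carrier := unitInterval }

/-- The multiplicative group of positive reals, written additively, and ordered as usual. -/
abbrev RPos : Type := Additive {x : ℝ // 0 < x}

/-- The element `1` of the positive reals, which is the neutral element of `RPos`. -/
def RPos.one : RPos := Additive.ofMul ⟨1, one_pos⟩

/-- `𝐆 = ⟨ℤ ×ₗₑₓ ℝ₊, (1, 1)⟩` -/
noncomputable def lexGroup : LUGroup.{0} where
  carrier := ℤ ×ₗ RPos
  unit := toLex (1, RPos.one)
  unit_nonneg := by
    rw [Prod.Lex.le_iff]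
    left
    exact zero_lt_one
  strong x := by
    refine ⟨(ofLex x).1.toNat + 1, by omega, ?_⟩
    rw [Prod.Lex.le_iff]
    left
    have e : (ofLex (((ofLex x).1.toNat + 1) • toLex ((1 : ℤ), RPos.one))).1 =
      ((ofLex x).1.toNat + 1) • (1 : ℤ) := rfl
    rw [e, nsmul_eq_mul, mul_one]
    push_cast
    have := Int.self_le_toNat (ofLex x).1
    omega

/-- The inclusion `[0, u] ⊆ G`. -/
def gammaIncl (G : LUGroup.{u}) (x : (Gamma.obj G).carrier) : G.carrier := Subtype.val x

/-- The element `[(a̿), (0)]` of `G_L`, where `a̿` is the double complement of `a`. -/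
def etaElt (L : BLCat.{u}) (a : L.carrier) : (Xi.obj L).carrier :=
  ChangGroup.mk (GoodSeq.single (BLAlgebra.cpl (BLAlgebra.cpl a))) (GoodSeq.single 0)

/-! Non-adjointness comes from a clash of negations. In an interval `[0, u]` negation is `x ↦ u -
x`, which is involutive, while in the product algebra `L` every nonzero element has negation `0`. So
a homomorphism from `L` to `Γ⟨G, u⟩` must send each nonzero `x` to `1`, because `f(x) = ¬¬f(x) =
f(¬¬x)`. A homomorphism from `Γ⟨G, u⟩` to `L`, with `G` totally ordered, must kill every `x ≤ ¬x`,
and its other values follow by complementation. Both hom-sets thus have at most one element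
(`BLHom.subsingleton_to_gamma`, `BLHom.subsingleton_of_gamma`). Yet `Ξ L` still remembers `L`:
nonzero elements of `L` cancel, so `[(x), (0)]` is not the unit when `0 < x < 1`, and `Ξ` of the
endomorphism `x ↦ ¬¬x` is not the identity (`Xi_map_cplCplHom_ne`). An adjunction in either order
would identify `Hom(Ξ L, Ξ L)`, which has two distinct elements, with one of the two small hom-sets.

The group `Ξ L` is computed by reading `(1, …, 1, x, 0, …)`, with `x` at place `n`, as the pair `(n,
x)`. As products of nonzero elements of `L` are nonzero, adding good sequences adds the places and
multiplies the entries, and differences of such pairs fill the whole lexicographic product.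

For the factorization through `η`, a homomorphism `f : L → Γ⟨G, u⟩` is extended by `[𝐚, 𝐛] ↦ ∑ f(aᵢ)
- ∑ f(bᵢ)` (`LUHom.extend`). The point is that summation of good sequences of `[0, u]` inside `G` is
additive and preserves joins (`GoodSeq.total_add`, `GoodSeq.total_sup`). This is checked in totally
ordered groups, where a good sequence has at most one entry other than `0` and `u`; the reduction to
them is the subdirect representation `LUGroup.eq_of_chain`, obtained from maximal cones
(`exists_isTotalCone`). The double negation in `η` does no harm because `f` does not see it.

That `η` is a homomorphism rests on `¬¬(x → y) = ¬¬x → ¬¬y` (`cpl_cpl_imp`) and on the identity `(x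
→ y) + (x ∨ y) = (1) + (y)` of good sequences for `x = ¬¬x` (`single_imp_add_single_sup`).
Non-uniqueness of the factorization is then automatic: `Hom(L, Γ𝐆)` is a singleton, so every
morphism `Ξ L → 𝐆` factors the same `f`. -/

namespace LUGroup

/-! ### Cones in lattice-ordered groups and their extension to total cones -/

section Cones
variable {A : Type u} [AddCommGroup A] [Lattice A]

/-- A set containing the positive cone and closed under addition and finite meets. -/
structure IsCone (P : Set A) : Prop where
  of_nonneg : ∀ {x}, 0 ≤ x → x ∈ P
  add_mem : ∀ {x y}, x ∈ P → y ∈ P → x + y ∈ P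
  inf_mem : ∀ {x y}, x ∈ P → y ∈ P → x ⊓ y ∈ P

/-- A cone whose induced preorder is total. -/
structure IsTotalCone (P : Set A) : Prop extends IsCone P where
  total : ∀ x, x ∈ P ∨ -x ∈ P

section Extension
variable [IsOrderedAddMonoid A]

theorem IsCone.up {P : Set A} (hP : IsCone P) {x y : A} (hx : x ∈ P) (h : x ≤ y) : y ∈ P := by
  rw [← add_sub_cancel x y]
  exact hP.add_mem hx (hP.of_nonneg (sub_nonneg.2 h))

/-- Expanding `(a ⊔ b) + (a ⊔ c)` gives a join of four sums. Since `a`, `b`, `c` are nonpositive,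
the three sums containing `a` lie below `a`, and the fourth is `b + c`. -/
theorem sup_add_eq_zero {a b c : A} (hb : a ⊔ b = 0) (hc : a ⊔ c = 0) : a ⊔ (b + c) = 0 := by
  have ha : a ≤ 0 := hb ▸ le_sup_left
  have hb' : b ≤ 0 := hb ▸ le_sup_right
  have hc' : c ≤ 0 := hc ▸ le_sup_right
  refine le_antisymm (sup_le ha (add_nonpos hb' hc')) ?_
  calc (0 : A) = (a ⊔ b) + (a ⊔ c) := by rw [hb, hc, add_zero]
    _ ≤ a ⊔ (b + c) := by
      rw [add_sup, sup_add, sup_add]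
      refine sup_le (sup_le ?_ ?_) (sup_le ?_ le_sup_right)
      · exact (add_le_of_nonpos_right ha).trans le_sup_left
      · exact (add_le_of_nonpos_left hb').trans le_sup_left
      · exact (add_le_of_nonpos_right hc').trans le_sup_left

theorem sup_nsmul_eq_zero {a b : A} (h : a ⊔ b = 0) (n : ℕ) : a ⊔ n • b = 0 := by
  induction n with
  | zero => rw [zero_nsmul]; exact sup_eq_right.2 (h ▸ le_sup_left)
  | succ n ih => rw [succ_nsmul]; exact sup_add_eq_zero ih h

/-- Adjoining `x ⊓ 0` instead of `x` is what keeps the set closed under meets: multiples of a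
nonpositive element decrease, so `n + m` copies bound both generators from below. -/
theorem isCone_adjoin {P : Set A} (hP : IsCone P) (x : A) :
    IsCone {z : A | ∃ p ∈ P, ∃ n : ℕ, p + n • (x ⊓ 0) ≤ z} where
  of_nonneg h := ⟨0, hP.of_nonneg le_rfl, 0, by simpa using h⟩
  add_mem := by
    rintro y z ⟨p, hp, n, h⟩ ⟨q, hq, m, k⟩
    refine ⟨p + q, hP.add_mem hp hq, n + m, ?_⟩
    rw [add_nsmul, add_add_add_comm]
    exact add_le_add h k
  inf_mem := by
    rintro y z ⟨p, hp, n, h⟩ ⟨q, hq, m, k⟩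
    refine ⟨p ⊓ q, hP.inf_mem hp hq, n + m, le_inf (le_trans ?_ h) (le_trans ?_ k)⟩ <;>
      rw [add_nsmul]
    · exact add_le_add inf_le_left (add_le_of_nonpos_right (nsmul_nonpos inf_le_right _))
    · exact add_le_add inf_le_right (add_le_of_nonpos_left (nsmul_nonpos inf_le_right _))

/-- This is the analogue of the prime filter theorem. Let `P` be maximal among the cones omitting
`t`. If `x` and `-x` were both outside `P`, adjoining either would capture `t`, so `p + n(x ∧ 0) ≤
t` and `q + m(-x ∧ 0) ≤ t`. The two multiples have join `0`, whence `p ∧ q ≤ t` and `t ∈ P`. -/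
theorem exists_isTotalCone {t : A} (ht : ¬ 0 ≤ t) : ∃ P : Set A, IsTotalCone P ∧ t ∉ P := by
  obtain ⟨P, -, hmax⟩ := zorn_subset_nonempty {P : Set A | IsCone P ∧ t ∉ P} (by
    intro c hc hch hne
    refine ⟨⋃₀ c, ⟨⟨?_, ?_, ?_⟩, ?_⟩, fun s hs => Set.subset_sUnion_of_mem hs⟩
    · intro x hx
      obtain ⟨s, hs⟩ := hne
      exact ⟨s, hs, (hc hs).1.of_nonneg hx⟩
    · rintro x y ⟨s, hs, hx⟩ ⟨t, ht, hy⟩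
      rcases hch.total hs ht with h | h
      · exact ⟨t, ht, (hc ht).1.add_mem (h hx) hy⟩
      · exact ⟨s, hs, (hc hs).1.add_mem hx (h hy)⟩
    · rintro x y ⟨s, hs, hx⟩ ⟨t, ht, hy⟩
      rcases hch.total hs ht with h | h
      · exact ⟨t, ht, (hc ht).1.inf_mem (h hx) hy⟩
      · exact ⟨s, hs, (hc hs).1.inf_mem hx (h hy)⟩
    · rintro ⟨s, hs, hx⟩
      exact (hc hs).2 hx) (Set.Ici (0 : A))
    ⟨⟨fun h => h, fun h k => add_nonneg h k, fun h k => le_inf h k⟩, ht⟩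
  have hP := hmax.prop.1
  have key : ∀ x, x ∉ P → ∃ p ∈ P, ∃ n : ℕ, p + n • (x ⊓ 0) ≤ t := by
    intro x hx
    by_contra hcon
    have hle := hmax.le_of_ge (y := {z : A | ∃ p ∈ P, ∃ n : ℕ, p + n • (x ⊓ 0) ≤ z})
      ⟨isCone_adjoin hP x, hcon⟩ (fun p hp => ⟨p, hp, 0, by simp⟩)
    exact hx (hle ⟨0, hP.of_nonneg le_rfl, 1, by simp⟩)
  refine ⟨P, ⟨hP, fun x => ?_⟩, hmax.prop.2⟩
  by_contra hcon
  push Not at hcon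
  obtain ⟨p, hp, n, h⟩ := key _ hcon.1
  obtain ⟨q, hq, m, k⟩ := key _ hcon.2
  refine hmax.prop.2 (hP.up (hP.inf_mem hp hq) ?_)
  let _ := AddCommGroup.toDistribLattice A
  -- By distributivity the left side is `|x| ⊓ 0`.
  have e : (x ⊓ 0) ⊔ (-x ⊓ 0) = 0 := by
    rw [← inf_sup_right]
    exact inf_eq_right.2 (abs_nonneg x)
  have e' : n • (x ⊓ 0) ⊔ m • (-x ⊓ 0) = 0 := by
    refine sup_nsmul_eq_zero ?_ m
    rw [sup_comm]
    refine sup_nsmul_eq_zero ?_ n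
    rw [sup_comm, e]
  calc p ⊓ q = p ⊓ q + (n • (x ⊓ 0) ⊔ m • (-x ⊓ 0)) := by rw [e', add_zero]
    _ ≤ t := by
      rw [add_sup]
      exact sup_le ((add_le_add inf_le_left le_rfl).trans h)
        ((add_le_add inf_le_right le_rfl).trans k)

end Extension

/-! ### The totally ordered quotient by a total cone -/

/-- The elements equivalent to `0` in the preorder of a cone. -/
def IsCone.kernel {P : Set A} (hP : IsCone P) : AddSubgroup A where
  carrier := {x | x ∈ P ∧ -x ∈ P}
  zero_mem' := ⟨hP.of_nonneg le_rfl, hP.of_nonneg neg_zero.ge⟩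
  add_mem' := fun h k => ⟨hP.add_mem h.1 k.1, by rw [neg_add]; exact hP.add_mem h.2 k.2⟩
  neg_mem' := fun h => ⟨h.2, by rw [neg_neg]; exact h.1⟩

/-- The totally ordered group defined by a total cone. -/
def ConeQuot {P : Set A} (hP : IsTotalCone P) : Type u := A ⧸ hP.toIsCone.kernel

namespace ConeQuot
variable {P : Set A} (hP : IsTotalCone P)

instance : AddCommGroup (ConeQuot hP) := inferInstanceAs (AddCommGroup (A ⧸ _))

/-- The quotient map. -/
def mk : A →+ ConeQuot hP := QuotientAddGroup.mk' hP.toIsCone.kernel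

theorem mk_surjective : Function.Surjective (mk hP) := QuotientAddGroup.mk'_surjective _

variable {hP} in
-- The cone is a union of cosets of its kernel, so the order of the quotient can be tested on any
-- representatives.
theorem mem_iff {x y : A} (h : mk hP x = mk hP y) : x ∈ P ↔ y ∈ P := by
  have h1 : -x + y ∈ hP.toIsCone.kernel := QuotientAddGroup.eq.1 h
  constructor <;> intro k
  · have := hP.add_mem k h1.1
    rwa [add_neg_cancel_left] at this
  · have := hP.add_mem k h1.2
    rwa [neg_add, neg_neg, add_comm x, add_neg_cancel_left] at this

theorem mk_eq_zero {x : A} (h : x ∈ P) (k : -x ∈ P) : mk hP x = 0 :=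
  (QuotientAddGroup.eq_zero_iff x).2 ⟨h, k⟩

instance : LE (ConeQuot hP) where
  le x y := ∃ z ∈ P, mk hP z = y - x

variable {hP} in
theorem mk_le {x y : A} : mk hP x ≤ mk hP y ↔ y - x ∈ P := by
  constructor
  · rintro ⟨z, hz, h⟩
    rw [← map_sub] at h
    exact (mem_iff h).1 hz
  · intro h
    exact ⟨y - x, h, map_sub _ _ _⟩

open Classical in
noncomputable instance : LinearOrder (ConeQuot hP) where
  le_refl x := ⟨0, hP.of_nonneg le_rfl, by rw [map_zero, sub_self]⟩
  le_trans := by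
    rintro x y z ⟨a, ha, h⟩ ⟨b, hb, k⟩
    exact ⟨a + b, hP.add_mem ha hb, by rw [map_add, h, k]; abel⟩
  le_antisymm := by
    rintro x y ⟨a, ha, h⟩ ⟨b, hb, k⟩
    have e : mk hP b = mk hP (-a) := by rw [map_neg, h, k, neg_sub]
    have := mk_eq_zero hP ha ((mem_iff e).1 hb)
    rw [h, sub_eq_zero] at this
    exact this.symm
  le_total x y := by
    obtain ⟨x, rfl⟩ := mk_surjective hP x
    obtain ⟨y, rfl⟩ := mk_surjective hP y
    rw [mk_le, mk_le, ← neg_sub y x]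
    exact hP.total _
  toDecidableLE := Classical.decRel _

instance : IsOrderedAddMonoid (ConeQuot hP) where
  add_le_add_left := by
    rintro x y ⟨a, ha, h⟩ z
    exact ⟨a, ha, by rw [h, add_sub_add_right_eq_sub]⟩

variable [IsOrderedAddMonoid A]

theorem mk_mono {x y : A} (h : x ≤ y) : mk hP x ≤ mk hP y :=
  mk_le.2 (hP.of_nonneg (sub_nonneg.2 h))

/-- If the image of `x` is the smaller one, the claim is that `(x ⊓ y) - x = 0 ⊓ (y - x)` lies in
`P`. This is where closure of cones under meets is needed. -/
theorem mk_inf (x y : A) : mk hP (x ⊓ y) = mk hP x ⊓ mk hP y := by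
  refine le_antisymm (le_inf (mk_mono hP inf_le_left) (mk_mono hP inf_le_right)) ?_
  rcases le_total (mk hP x) (mk hP y) with h | h
  · rw [inf_eq_left.2 h, mk_le, inf_sub, sub_self]
    exact hP.inf_mem (hP.of_nonneg le_rfl) (mk_le.1 h)
  · rw [inf_eq_right.2 h, mk_le, inf_sub, sub_self]
    exact hP.inf_mem (mk_le.1 h) (hP.of_nonneg le_rfl)

theorem mk_sup (x y : A) : mk hP (x ⊔ y) = mk hP x ⊔ mk hP y := by
  have h := inf_add_sup x y
  have k := inf_add_sup (mk hP x) (mk hP y)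
  rw [← map_add, ← h, map_add, mk_inf] at k
  exact (add_left_cancel k).symm

end ConeQuot
end Cones

/-! ### Subdirect representation of groups with strong unit -/

/-- Totally ordered groups with nonzero strong unit. -/
structure IsChain (G : LUGroup.{u}) : Prop where
  total : ∀ x y : G.carrier, x ≤ y ∨ y ≤ x
  unit_ne : G.unit ≠ 0

/-- If `x ≤ y` fails, a total cone omitting `y - x` gives a totally ordered quotient in which it
still fails. -/
theorem le_of_chain {G : LUGroup.{u}} {x y : G.carrier}
    (h : ∀ H : LUGroup.{u}, H.IsChain → ∀ g : LUHom G H, g.toFun x ≤ g.toFun y) : x ≤ y := by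
  by_contra hxy
  obtain ⟨P, hP, ht⟩ := exists_isTotalCone fun k => hxy (sub_nonneg.1 k)
  have hmono := fun {x y : G.carrier} => ConeQuot.mk_mono hP (x := x) (y := y)
  have hst : ∀ z : ConeQuot hP, ∃ n : ℕ, 1 ≤ n ∧ z ≤ n • ConeQuot.mk hP G.unit := by
    intro z
    obtain ⟨z, rfl⟩ := ConeQuot.mk_surjective hP z
    obtain ⟨n, hn, h⟩ := G.strong z
    exact ⟨n, hn, by rw [← map_nsmul]; exact hmono h⟩
  refine ht (ConeQuot.mk_le.1 (h
    { carrier := ConeQuot hP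
      unit := ConeQuot.mk hP G.unit
      unit_nonneg := by rw [← map_zero (ConeQuot.mk hP)]; exact hmono G.unit_nonneg
      strong := hst } ⟨le_total, fun h0 => ?_⟩
    ⟨ConeQuot.mk hP, map_add _, ConeQuot.mk_sup hP, ConeQuot.mk_inf hP, rfl⟩))
  change ConeQuot.mk hP G.unit = 0 at h0
  -- The unit cannot vanish in the quotient: by strength the image of `x - y` would then be at most
  -- `0`, which puts `y - x` in the cone.
  obtain ⟨n, -, hn⟩ := hst (ConeQuot.mk hP (x - y))
  rw [h0, smul_zero, ← map_zero (ConeQuot.mk hP), ConeQuot.mk_le] at hn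
  rw [zero_sub, neg_sub] at hn
  exact ht hn

theorem eq_of_chain {G : LUGroup.{u}} {x y : G.carrier}
    (h : ∀ H : LUGroup.{u}, H.IsChain → ∀ g : LUHom G H, g.toFun x = g.toFun y) : x = y :=
  le_antisymm (le_of_chain fun H hH g => (h H hH g).le)
    (le_of_chain fun H hH g => (h H hH g).ge)

end LUGroup

section Auxiliary
open BLAlgebra GoodSeq

/-! ### Operations of the interval `[0, u]` expressed in the group -/

namespace GammaCarrier
variable {G H : LUGroup.{u}}

theorem val_zero : (0 : GammaCarrier G).1 = 0 := rfl

theorem val_one : (1 : GammaCarrier G).1 = G.unit := rfl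

theorem val_mul (x y : GammaCarrier G) : (x * y).1 = (x.1 + y.1 - G.unit) ⊔ 0 :=
  gamma_mul_eq G.unit x.1 y.1

theorem val_imp (x y : GammaCarrier G) : (imp x y).1 = (G.unit - x.1 + y.1) ⊓ G.unit := rfl

theorem val_cpl (x : GammaCarrier G) : (cpl x).1 = G.unit - x.1 := by
  rw [cpl, val_imp, val_zero, add_zero]
  exact inf_eq_left.2 (sub_le_self _ x.2.1)

theorem cpl_cpl (x : GammaCarrier G) : cpl (cpl x) = x :=
  Subtype.ext (by rw [val_cpl, val_cpl, sub_sub_cancel])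

theorem val_plus (x y : GammaCarrier G) : (x + y).1 = (x.1 + y.1) ⊓ G.unit := by
  rw [low_plus_left (cpl_cpl x) (cpl_cpl y), val_imp, val_cpl, sub_sub_cancel]

theorem isBLChain (hG : G.IsChain) : IsBLChain (GammaCarrier G) where
  total x y := hG.total x.1 y.1
  zero_ne h := hG.unit_ne (congrArg Subtype.val h).symm

/-- The restriction of a morphism to the unit intervals. -/
def map (g : LUHom G H) : BLHom (GammaCarrier G) (GammaCarrier H) := Gamma.map (X := G) (Y := H) g

end GammaCarrier

/-- A morphism of lattice-ordered groups as an additive homomorphism. -/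
def LUHom.toAddHom {G H : LUGroup.{u}} (g : LUHom G H) : G.carrier →+ H.carrier where
  toFun := g.toFun
  map_zero' := g.map_zero
  map_add' := g.map_add

/-! ### Summation in `G` of good sequences of `[0, u]` -/

namespace GoodSeq
variable {G H : LUGroup.{u}}

/-- The sum `a₁ + a₂ + ⋯` in `G` of a good sequence in `[0, u]`. -/
noncomputable def total (a : GoodSeq (GammaCarrier G)) : G.carrier :=
  -- The finite-support sum also runs over the index `0`, whose conventional entry is `u`; the
  -- subtraction, which stands outside the sum, removes it.
  ∑ᶠ i, (a.val i).1 - G.unit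

theorem finite_support (a : GoodSeq (GammaCarrier G)) :
    (Function.support fun i => (a.val i).1).Finite := by
  obtain ⟨n, hn⟩ := a.fin
  refine (Set.finite_Iic n).subset fun i hi => ?_
  by_contra h
  exact hi (congrArg Subtype.val (hn i (not_le.1 h)))

/-- This naturality is what allows identities about sums to be checked after mapping to totally
ordered groups. -/
theorem map_total (g : LUHom G H) (a : GoodSeq (GammaCarrier G)) :
    g.toFun a.total = (a.map (GammaCarrier.map g)).total := by
  rw [total, total, g.map_sub, g.map_unit]
  congr 1
  exact g.toAddHom.map_finsum a.finite_support

theorem total_eq_sum {a : GoodSeq (GammaCarrier G)} {n : ℕ} (hn : ∀ i, n < i → a.val i = 0) :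
    a.total = ∑ i ∈ Finset.range (n + 1), (a.val i).1 - G.unit := by
  rw [total, finsum_eq_finsetSum_of_support_subset]
  intro i hi
  rw [Finset.mem_coe, Finset.mem_range]
  by_contra h
  exact hi (congrArg Subtype.val (hn i (by omega)))

theorem total_mono {a b : GoodSeq (GammaCarrier G)} (h : a ≤ b) : a.total ≤ b.total := by
  obtain ⟨n, hn⟩ := b.fin
  rw [total_eq_sum hn, total_eq_sum fun i hi => le_zero.1 ((h i).trans (hn i hi).le)]
  exact sub_le_sub_right (Finset.sum_le_sum (N := G.carrier) fun i _ => h i) _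

theorem total_eq_of_R {a : GoodSeq (GammaCarrier G)} {p : ℕ × GammaCarrier G}
    (h : a.val = R p) : a.total = p.1 • G.unit + p.2.1 - G.unit := by
  have hs : ∑ i ∈ Finset.range p.1, (R p i).1 = p.1 • G.unit :=
    (Finset.sum_eq_card_nsmul fun i hi =>
      congrArg (fun x : GammaCarrier G => x.1) (R_lt (Finset.mem_range.1 hi))).trans
      (by rw [Finset.card_range]; rfl)
  rw [total_eq_sum (n := p.1) fun i hi => by rw [h, R_gt hi], h, Finset.sum_range_succ, R_eq]
  exact congrArg (· + p.2.1 - G.unit) hs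

theorem total_single (x : GammaCarrier G) : (single x).total = x.1 := by
  rw [total_eq_of_R (single_val x), one_nsmul, add_sub_cancel_left]

/-- For normal forms with last entries `x` and `y` there are two cases. If `x ⊗ y = 0`, then `x + y
≤ u` in `G`, so the truncated sum is the true one and the place drops by one. Otherwise `x + y ≥ u`,
so `x ⊗ y = x + y - u`, and the extra `u` is the one gained in the place. -/
theorem total_add_of_isChain (hG : G.IsChain) (a b : GoodSeq (GammaCarrier G)) :
    (a + b).total = a.total + b.total := by
  have hC := GammaCarrier.isBLChain hG
  obtain ⟨p, hp, ep⟩ := exists_R hC a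
  obtain ⟨q, hq, eq⟩ := exists_R hC b
  rw [total_eq_of_R (add_val hC hp hq ep eq), total_eq_of_R ep, total_eq_of_R eq]
  by_cases h : p.2 * q.2 = 0
  -- A zero product forces the place of the first sequence to be positive, so the truncated
  -- subtraction in `p.1 + q.1 - 1` is a genuine one.
  · obtain ⟨n, hn⟩ := Nat.exists_eq_add_of_le' (hp.pos_of_mul hq h)
    have h1 := congrArg Subtype.val h
    rw [GammaCarrier.val_mul, GammaCarrier.val_zero, sup_eq_right, sub_nonpos] at h1
    rw [pp_zero h, hn]
    dsimp only
    rw [GammaCarrier.val_plus, inf_eq_left.2 h1, show n + 1 + q.1 - 1 = n + q.1 by omega,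
      add_nsmul, succ_nsmul]
    abel
  · have h1 : 0 ≤ p.2.1 + q.2.1 - G.unit := by
      refine (hG.total _ _).resolve_right fun k => h (Subtype.ext ?_)
      rw [GammaCarrier.val_mul, sup_eq_right.2 k]
      rfl
    rw [pp_ne h]
    dsimp only
    rw [GammaCarrier.val_mul, sup_eq_left.2 h1, add_nsmul]
    abel

theorem total_add (a b : GoodSeq (GammaCarrier G)) : (a + b).total = a.total + b.total :=
  LUGroup.eq_of_chain fun H hH g => by
    rw [g.map_add, map_total, map_total, map_total, GoodSeq.map_add, total_add_of_isChain hH]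

theorem sup_eq_right_of_le {L : Type u} [BLAlgebra L] {a b : GoodSeq L} (h : a ≤ b) : a ⊔ b = b :=
  GoodSeq.ext (funext fun i => _root_.sup_eq_right.2 (h i))

theorem sup_eq_left_of_le {L : Type u} [BLAlgebra L] {a b : GoodSeq L} (h : b ≤ a) : a ⊔ b = a :=
  GoodSeq.ext (funext fun i => _root_.sup_eq_left.2 (h i))

/-- Good sequences in a chain are totally ordered, so monotonicity suffices for joins. -/
theorem map_sup_of_mono {C : Type u} [BLAlgebra C] (hC : IsBLChain C) {ψ : GoodSeq C → G.carrier}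
    (hψ : ∀ {a b}, a ≤ b → ψ a ≤ ψ b) (a b : GoodSeq C) : ψ (a ⊔ b) = ψ a ⊔ ψ b := by
  rcases gs_total hC a b with h | h
  · rw [sup_eq_right_of_le h, sup_eq_right.2 (hψ h)]
  · rw [sup_eq_left_of_le h, sup_eq_left.2 (hψ h)]

theorem total_sup (a b : GoodSeq (GammaCarrier G)) : (a ⊔ b).total = a.total ⊔ b.total :=
  LUGroup.eq_of_chain fun H hH g => by
    rw [g.map_sup, map_total, map_total, map_total, map_max,
      map_sup_of_mono (GammaCarrier.isBLChain hH) total_mono]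

end GoodSeq

/-! ### Extension of homomorphisms to Chang's group -/

namespace LUHom
variable {L : BLCat.{u}} {G : LUGroup.{u}}

/-- The map `[𝐚, 𝐛] ↦ ψ(𝐚) - ψ(𝐛)` defined by an additive map `ψ`. -/
def liftGoodSeq (ψ : GoodSeq L.carrier → G.carrier) (hadd : ∀ a b, ψ (a + b) = ψ a + ψ b) :
    ChangGroup L.carrier → G.carrier :=
  Quotient.lift (fun p => ψ p.1 - ψ p.2) (by
    rintro p q ⟨k, h⟩
    have h := congrArg ψ h
    -- The auxiliary summand of the Grothendieck relation cancels because the target is a group.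
    rw [hadd, hadd, hadd, hadd, add_left_inj] at h
    rw [sub_eq_sub_iff_add_eq_add, h, add_comm])

/-- The morphism `[𝐚, 𝐛] ↦ ψ(𝐚) - ψ(𝐛)` defined by an additive and join-preserving map `ψ`. -/
def ofGoodSeq (ψ : GoodSeq L.carrier → G.carrier) (hadd : ∀ a b, ψ (a + b) = ψ a + ψ b)
    (hsup : ∀ a b, ψ (a ⊔ b) = ψ a ⊔ ψ b) (hone : ψ (single 1) = G.unit) :
    LUHom (Xi.obj L) G :=
  have hzero : ψ (single 0) = 0 := by
    have h := hadd (single 0) (single 0)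
    rw [gs_add_zero] at h
    exact left_eq_add.1 h
  have hmk : ∀ a b, liftGoodSeq ψ hadd (ChangGroup.mk a b) = ψ a - ψ b := fun _ _ => rfl
  have hneg : ∀ x, liftGoodSeq ψ hadd (-x) = -liftGoodSeq ψ hadd x := fun x => by
    obtain ⟨a, b, rfl⟩ := ChangGroup.exists_mk x
    rw [ChangGroup.neg_mk, hmk, hmk, neg_sub]
  have hmax : ∀ x y, liftGoodSeq ψ hadd (x ⊔ y) =
      liftGoodSeq ψ hadd x ⊔ liftGoodSeq ψ hadd y := fun x y => by
    obtain ⟨a, b, rfl⟩ := ChangGroup.exists_mk x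
    obtain ⟨c, d, rfl⟩ := ChangGroup.exists_mk y
    rw [ChangGroup.mk_sup, hmk, hmk, hmk, hsup, hadd, hadd, hadd, sup_sub]
    congr 1 <;> abel
  have hmin : ∀ x y, liftGoodSeq ψ hadd (x ⊓ y) =
      liftGoodSeq ψ hadd x ⊓ liftGoodSeq ψ hadd y := fun x y => by
    -- Meets in Chang's group are defined from joins and negatives, both already preserved.
    change liftGoodSeq ψ hadd (-(-x ⊔ -y)) = _
    rw [hneg, hmax, hneg, hneg, neg_sup, neg_neg, neg_neg]
  { toFun := liftGoodSeq ψ hadd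
    map_add := fun x y => by
      obtain ⟨a, b, rfl⟩ := ChangGroup.exists_mk x
      obtain ⟨c, d, rfl⟩ := ChangGroup.exists_mk y
      change liftGoodSeq ψ hadd (ChangGroup.mk a b + ChangGroup.mk c d) = _
      rw [ChangGroup.mk_add, hmk, hmk, hmk, hadd, hadd]
      abel
    map_sup := hmax
    map_inf := hmin
    map_unit := by
      change liftGoodSeq ψ hadd (ChangGroup.mk (single 1) (single 0)) = _
      rw [hmk, hzero, hone, sub_zero] }

/-- The extension `[𝐚, 𝐛] ↦ ∑ f(aᵢ) - ∑ f(bᵢ)` of a homomorphism `f : L → [0, u]`. -/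
noncomputable def extend (f : BLHom L.carrier (GammaCarrier G)) : LUHom (Xi.obj L) G :=
  ofGoodSeq (fun a => (a.map f).total) (fun a b => by rw [GoodSeq.map_add, total_add])
    (fun a b => by rw [map_max, total_sup])
    (by rw [map_single, f.map_one, total_single, GammaCarrier.val_one])

/-- The double complement in `etaElt` disappears under `f`, because complementation in `[0, u]` is
an involution. -/
theorem extend_etaElt (f : BLHom L.carrier (GammaCarrier G)) (a : L.carrier) :
    (extend f).toFun (etaElt L a) = (f.toFun a).1 := by
  change ((single (cpl (cpl a))).map f).total - ((single 0).map f).total = _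
  rw [map_single, map_single, total_single, total_single, f.map_cpl, f.map_cpl,
    GammaCarrier.cpl_cpl, f.map_zero, GammaCarrier.val_zero, sub_zero]

end LUHom

/-! ### The natural transformation `η` -/

section Eta
variable {L : Type u} [BLAlgebra L]

namespace GoodSeq

theorem single_add_single_val (x y : L) (i : ℕ) : (single x + single y).val i =
    if i = 0 then 1 else if i = 1 then x + y else if i = 2 then x * y else 0 := by
  change ∑ p ∈ Finset.HasAntidiagonal.antidiagonal i, (if p.1 = 0 then 1 else if p.1 = 1 then x
    else 0) * (if p.2 = 0 then 1 else if p.2 = 1 then y else 0) = _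
  rcases i with _ | _ | _ | i
  · simp
  · simp [Finset.Nat.antidiagonal_succ, plus_comm]
  · simp [Finset.Nat.antidiagonal_succ, mul_zero_all, zero_mul_all]
  · refine (Finset.sum_eq_zero fun p hp => ?_).trans (by simp)
    rw [Finset.HasAntidiagonal.mem_antidiagonal] at hp
    by_cases h : 1 < p.1
    · rw [if_neg (show p.1 ≠ 0 by omega), if_neg (show p.1 ≠ 1 by omega), zero_mul_all]
    · rw [if_neg (show p.2 ≠ 0 by omega), if_neg (show p.2 ≠ 1 by omega), mul_zero_all]

theorem single_sup_single (x y : L) : single x ⊔ single y = single (x ⊔ y) := by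
  refine GoodSeq.ext (funext fun i => ?_)
  change (if i = 0 then 1 else if i = 1 then x else 0) ⊔ (if i = 0 then 1 else if i = 1 then y
    else 0) = if i = 0 then 1 else if i = 1 then x ⊔ y else 0
  split_ifs
  · exact sup_idem _
  · rfl
  · exact sup_idem _

/-- A sum of two one-term sequences has only the terms `a + b` and `a ⊗ b`, so two identities in `L`
are needed: `(x → y) + (x ∨ y) = 1` and `(x → y) ⊗ (x ∨ y) = y`. The first uses `¬(x → y) ≤ ¬¬x =
x`; the second is divisibility, checked in chains. This makes `x → y` a difference in Chang's group.
-/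
theorem single_imp_add_single_sup {x y : L} (hx : BLAlgebra.cpl (BLAlgebra.cpl x) = x) :
    single (imp x y) + single (x ⊔ y) = single 1 + single y := by
  have h1 : imp x y + (x ⊔ y) = 1 := by
    refine one_le.1 (le_trans ?_ (plus_mono le_rfl le_sup_left))
    have h : BLAlgebra.cpl (imp x y) ≤ x :=
      (cpl_anti (imp_mono x (zero_le_all y))).trans hx.le
    have h' : BLAlgebra.cpl x ≤ imp x y := imp_mono x (zero_le_all y)
    rw [plus_def, imp_eq_one.2 h, imp_eq_one.2 h', inf_idem]
  have h2 : imp x y * (x ⊔ y) = y := by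
    refine BLAlgebra.eq_of_chain fun C _ hC π => ?_
    rw [π.map_mul, π.map_imp, π.map_sup]
    rcases hC.total (π.toFun x) (π.toFun y) with h | h
    · rw [imp_eq_one.2 h, one_mul, sup_eq_right.2 h]
    · rw [sup_eq_left.2 h, mul_comm, ← inf_eq, inf_eq_right.2 h]
  refine GoodSeq.ext (funext fun i => ?_)
  rw [single_add_single_val, single_add_single_val, h1, h2, one_plus, one_mul]

end GoodSeq

namespace BLAlgebra

theorem cpl_mul_cpl_cpl (x y : L) : cpl (x * cpl (cpl y)) = cpl (x * y) := by
  rw [← imp_cpl, cpl_cpl_cpl, imp_cpl]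

/-- The right side is `¬(x ⊗ ¬y)`. In a chain either `¬y = 0`, and then both sides are `1` since `y
≤ x → y`, or `y = ¬¬y`, and then `x → y` is itself the negation `¬(x ⊗ ¬y)`. -/
theorem cpl_cpl_imp (x y : L) : cpl (cpl (imp x y)) = imp (cpl (cpl x)) (cpl (cpl y)) := by
  rw [imp_cpl, mul_comm, cpl_mul_cpl_cpl, mul_comm]
  refine eq_of_chain fun C _ hC π => ?_
  simp only [π.map_imp, π.map_cpl, π.map_mul]
  generalize π.toFun x = x
  generalize π.toFun y = y
  by_cases hy : cpl y = 0
  · have h : cpl (imp x y) = 0 := high_of_le hy ((le_imp_iff _ _ _).2 (mul_le_r x y))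
    rw [h, hy, mul_zero_all]
  · nth_rw 1 [← hC.low hy]
    rw [imp_cpl, cpl_cpl_cpl]

theorem cpl_imp_cpl (x y : L) : cpl (imp x (cpl y)) = cpl (cpl (x * y)) := by rw [imp_cpl]

end BLAlgebra

namespace ChangGroup

/-- The element `[(x), (0)]`. -/
def ofElt (x : L) : ChangGroup L := mk (single x) (single 0)

theorem ofElt_mono {x y : L} (h : x ≤ y) : ofElt x ≤ ofElt y := by
  rw [ofElt, ofElt, mk_le_cls, cls_zero, add_zero, zero_add]
  refine cls_le_of_le fun i => ?_
  change (if i = 0 then 1 else if i = 1 then x else 0) ≤ if i = 0 then 1 else if i = 1 then y else 0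
  split_ifs
  · exact le_rfl
  · exact h
  · exact le_rfl

theorem ofElt_nonneg (x : L) : 0 ≤ ofElt x := ofElt_mono (zero_le_all x)

theorem ofElt_le_unit (x : L) : ofElt x ≤ unit L := ofElt_mono (le_one_all x)

theorem ofElt_sup (x y : L) : ofElt (x ⊔ y) = ofElt x ⊔ ofElt y := by
  simp only [ofElt]
  rw [mk_sup, gs_add_comm (single 0) (single y), gs_add_zero, gs_add_zero, gs_add_zero,
    single_sup_single]

/-- By `single_imp_add_single_sup` the class of `x → y` is `u + [y] - ([x] ∨ [y])`, and subtracting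
a join turns it into the meet of Mundici's formula. -/
theorem ofElt_imp {x : L} (hx : cpl (cpl x) = x) (y : L) :
    ofElt (imp x y) = (unit L - ofElt x + ofElt y) ⊓ unit L := by
  have h : ofElt (imp x y) + ofElt (x ⊔ y) = unit L + ofElt y := by
    simp only [ofElt, unit]
    rw [mk_add, mk_add, single_imp_add_single_sup hx]
  rw [← eq_sub_iff_add_eq] at h
  have h' : -(ofElt x ⊔ ofElt y) = -ofElt x ⊓ -ofElt y := neg_sup _ _
  rw [h, ofElt_sup, sub_eq_add_neg, h', add_inf]
  congr 1 <;> abel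

end ChangGroup

/-- The homomorphism `a ↦ [(a̿), (0)]` from `L` to `Γ Ξ L`. -/
def etaHom (L : BLCat.{u}) : BLHom L.carrier (GammaCarrier (Xi.obj L)) :=
  have hmap : ∀ x y, ChangGroup.ofElt (cpl (cpl (imp x y))) = (ChangGroup.unit L.carrier -
      ChangGroup.ofElt (cpl (cpl x)) + ChangGroup.ofElt (cpl (cpl y))) ⊓
        ChangGroup.unit L.carrier := fun x y => by
    rw [cpl_cpl_imp, ChangGroup.ofElt_imp (cpl_cpl_cpl _)]
  let η : L.carrier → GammaCarrier (Xi.obj L) := fun a =>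
    ⟨etaElt L a, ChangGroup.ofElt_nonneg _, ChangGroup.ofElt_le_unit _⟩
  have himp : ∀ x y, η (imp x y) = imp (η x) (η y) := fun x y => Subtype.ext (hmap x y)
  have hzero : η 0 = 0 := Subtype.ext (by
    change ChangGroup.ofElt (cpl (cpl 0)) = (0 : ChangGroup L.carrier)
    rw [cpl_zero, cpl_one]
    rfl)
  have hcpl : ∀ x, η (cpl x) = cpl (η x) := fun x => by rw [cpl, himp, hzero, cpl]
  have hdd : ∀ x, η (cpl (cpl x)) = η x := fun x => by rw [hcpl, hcpl, GammaCarrier.cpl_cpl]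
  { toFun := η
    map_mul := fun x y => by
      -- The product is recovered from implication and negation as `¬¬(x ⊗ y) = ¬(x → ¬y)`, since
      -- `η` does not see double negations.
      rw [← hdd, ← cpl_imp_cpl, hcpl, himp, hcpl, cpl_imp_cpl, GammaCarrier.cpl_cpl]
    map_imp := himp
    map_zero := hzero
    map_one := by rw [← cpl_zero, hcpl, hzero, cpl_zero] }

/-- The natural transformation `η : 1 ⟶ Γ Ξ`. -/
def eta : 𝟭 BLCat.{u} ⟶ Xi.{u} ⋙ Gamma.{u} where
  app L := etaHom L
  naturality L M f := BLHom.ext (funext fun a => Subtype.ext (by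
    let f' : BLHom L.carrier M.carrier := f
    change ChangGroup.ofElt (cpl (cpl (f'.toFun a))) =
      ChangGroup.map f' (ChangGroup.ofElt (cpl (cpl a)))
    rw [← f'.map_cpl, ← f'.map_cpl, ChangGroup.ofElt, ChangGroup.ofElt, ChangGroup.map_mk,
      map_single, map_single, f'.map_zero]))

theorem exists_eta_comp (L : BLCat.{u}) (G : LUGroup.{u}) (f : L ⟶ Gamma.obj G) :
    ∃ g : Xi.obj L ⟶ G, eta.app L ≫ Gamma.map g = f :=
  ⟨LUHom.extend f, BLHom.ext (funext fun a => Subtype.ext (LUHom.extend_etaElt f a))⟩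

end Eta

/-! ### Chains in which negation is trivial, and their rigidity -/

namespace BLAlgebra

/-- Chains in which every nonzero element has complement `0`. -/
structure IsStrictChain (C : Type u) [BLAlgebra C] : Prop extends IsBLChain C where
  cpl_eq_zero : ∀ {x : C}, x ≠ 0 → cpl x = 0

theorem cpl_cpl_mul {L : Type u} [BLAlgebra L] (x y : L) :
    cpl (cpl (x * y)) = cpl (cpl x) * cpl (cpl y) :=
  eq_of_chain fun C _ hC π => by
    simp only [π.map_mul, π.map_cpl]
    exact mul_dd hC _ _

/-- Double complementation as a homomorphism. -/
def cplCplHom (L : Type u) [BLAlgebra L] : BLHom L L where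
  toFun x := cpl (cpl x)
  map_mul := cpl_cpl_mul
  map_imp := cpl_cpl_imp
  map_zero := by rw [cpl_zero, cpl_one]
  map_one := by rw [cpl_one, cpl_zero]

end BLAlgebra

namespace BLHom
variable {C : Type u} [BLAlgebra C] {G : LUGroup.{u}}

/-- For `x ≠ 0` the value is forced: `f x = ¬¬(f x) = ¬ f (¬x) = ¬ f 0 = 1`. -/
theorem subsingleton_to_gamma (hC : IsStrictChain C) : Subsingleton (BLHom C (GammaCarrier G)) := by
  have key : ∀ (f : BLHom C (GammaCarrier G)) x, x ≠ 0 → f.toFun x = 1 := fun f x hx => by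
    rw [← GammaCarrier.cpl_cpl (f.toFun x), ← f.map_cpl, hC.cpl_eq_zero hx, f.map_zero, cpl_zero]
  refine ⟨fun f g => BLHom.ext (funext fun x => ?_)⟩
  by_cases hx : x = 0
  · rw [hx, f.map_zero, g.map_zero]
  · rw [key f x hx, key g x hx]

theorem eq_zero_of_le_cpl (hC : IsStrictChain C) {x : C} (h : x ≤ cpl x) : x = 0 := by
  by_contra hx
  rw [hC.cpl_eq_zero hx] at h
  exact hx (le_zero.1 h)

/-- If `x ≤ ¬x`, then `f x ≤ ¬ f x`, which in a strict chain leaves only `f x = 0`. Totality gives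
`x ≤ ¬x` or `¬x ≤ x`; in the second case the argument applies to `¬x`, and `x = ¬¬x` determines `f
x`. -/
theorem subsingleton_of_gamma (hC : IsStrictChain C)
    (hG : ∀ x y : G.carrier, x ≤ y ∨ y ≤ x) : Subsingleton (BLHom (GammaCarrier G) C) := by
  have key : ∀ (f : BLHom (GammaCarrier G) C) {x}, x ≤ cpl x → f.toFun x = 0 := fun f x hx =>
    eq_zero_of_le_cpl hC ((f.map_le hx).trans (f.map_cpl x).le)
  refine ⟨fun f g => BLHom.ext (funext fun x => ?_)⟩
  rcases hG x.1 (cpl x).1 with h | h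
  · rw [key f h, key g h]
  · have h' : cpl x ≤ cpl (cpl x) := by
      rw [GammaCarrier.cpl_cpl]
      exact h
    rw [← GammaCarrier.cpl_cpl x, f.map_cpl, g.map_cpl, key f h', key g h']

end BLHom

namespace ChangGroup

theorem le_total_of_isBLChain {C : Type u} [BLAlgebra C] (hC : IsBLChain C) (x y : ChangGroup C) :
    x ≤ y ∨ y ≤ x := by
  obtain ⟨a, b, rfl⟩ := exists_mk x
  obtain ⟨c, d, rfl⟩ := exists_mk y
  rw [mk_le_cls, mk_le_cls, add_comm (cls c), add_comm (cls d)]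
  exact (gs_total hC (a + d) (b + c)).imp cls_le_of_le cls_le_of_le

/-- Equality of classes means `(x) + 𝐜 = (1) + 𝐜` for some `𝐜`. The last nonzero entry `z` of `𝐜`
has complement `0`, so comparing normal forms gives `x ⊗ z = z`, and cancellation applies. -/
theorem eq_one_of_ofElt_eq_unit {C : Type u} [BLAlgebra C] (hC : IsStrictChain C)
    (hcancel : ∀ x y : C, y ≠ 0 → x * y = y → x = 1) {x : C} (hx : x ≠ 0)
    (h : ofElt x = unit C) : x = 1 := by
  have hone : (1 : C) ≠ 0 := hC.zero_ne.symm
  rw [ofElt, unit, mk_eq_cls, cls_zero, add_zero, zero_add, cls_eq] at h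
  obtain ⟨c, h⟩ := h
  obtain ⟨p, hp, ep⟩ := exists_R hC.toIsBLChain c
  have h := congrArg GoodSeq.val h
  rw [add_val hC.toIsBLChain (valid_one hx) hp (single_val x) ep,
    add_val hC.toIsBLChain (valid_one hone) hp (single_val 1) ep] at h
  have h := R_inj ((valid_one hx).pp hp) ((valid_one hone).pp hp) h
  have hz := hC.cpl_eq_zero hp.1
  rw [pp_high (valid_one hx) hz, pp_high (valid_one hone) hz, one_mul] at h
  exact hcancel x p.2 hp.1 (congrArg Prod.snd h)

end ChangGroup

/-! ### Failure of adjointness in both orders -/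

section NonAdjoint
variable {P : BLCat.{u}}

/-- Double negation sends `x` to `1`, so the induced endomorphism moves `[(x), (0)]` to the unit,
from which it differs by `eq_one_of_ofElt_eq_unit`. -/
theorem Xi_map_cplCplHom_ne (hP : IsStrictChain P.carrier)
    (hcancel : ∀ x y : P.carrier, y ≠ 0 → x * y = y → x = 1) {x : P.carrier} (hx : x ≠ 0)
    (hx1 : x ≠ 1) : Xi.map (X := P) (Y := P) (cplCplHom P.carrier) ≠ 𝟙 (Xi.obj P) := by
  intro h
  have h1 : ChangGroup.map (cplCplHom P.carrier) (ChangGroup.ofElt x) = ChangGroup.ofElt x :=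
    congrArg (fun g : Xi.obj P ⟶ Xi.obj P => LUHom.toFun g (ChangGroup.ofElt x)) h
  rw [ChangGroup.ofElt, ChangGroup.map_mk, map_single, map_single, (cplCplHom _).map_zero] at h1
  change ChangGroup.ofElt (cpl (cpl x)) = ChangGroup.ofElt x at h1
  rw [hP.cpl_eq_zero hx, cpl_zero] at h1
  exact hx1 (ChangGroup.eq_one_of_ofElt_eq_unit hP hcancel hx h1.symm)

/-- An adjunction would inject `Hom(Ξ P, Ξ P)`, with two distinct members, into `Hom(P, ΓΞ P)`,
which has at most one. -/
theorem isEmpty_Xi_adj_Gamma (hP : IsStrictChain P.carrier)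
    (hne : Xi.map (X := P) (Y := P) (cplCplHom P.carrier) ≠ 𝟙 (Xi.obj P)) :
    IsEmpty (Xi.{u} ⊣ Gamma.{u}) := by
  refine ⟨fun adj => hne ((adj.homEquiv P (Xi.obj P)).injective ?_)⟩
  exact (BLHom.subsingleton_to_gamma (G := Xi.obj P) hP).elim _ _

/-- The same two endomorphisms of `Ξ P` are now injected into `Hom(ΓΞ P, P)`, which has at most one
member because `Ξ P` is totally ordered. -/
theorem isEmpty_Gamma_adj_Xi (hP : IsStrictChain P.carrier)
    (hne : Xi.map (X := P) (Y := P) (cplCplHom P.carrier) ≠ 𝟙 (Xi.obj P)) :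
    IsEmpty (Gamma.{u} ⊣ Xi.{u}) := by
  refine ⟨fun adj => hne ((adj.homEquiv (Xi.obj P) P).symm.injective ?_)⟩
  exact (BLHom.subsingleton_of_gamma (G := Xi.obj P) hP
    (ChangGroup.le_total_of_isBLChain hP.toIsBLChain)).elim _ _

end NonAdjoint

/-- This carries the counterexample to every universe, as non-adjointness is asserted in each. -/
instance instBLAlgebraULift {L : Type} [BLAlgebra L] : BLAlgebra (ULift.{u} L) where
  imp x y := ⟨imp x.down y.down⟩
  zero_le_all x := zero_le_all x.down
  le_one_all x := le_one_all x.down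
  le_imp_iff x y z := le_imp_iff x.down y.down z.down
  inf_eq x y := ULift.ext _ _ (inf_eq x.down y.down)
  prelinear x y := ULift.ext _ _ (prelinear x.down y.down)

theorem BLAlgebra.IsStrictChain.uLift {C : Type} [BLAlgebra C] (hC : IsStrictChain C) :
    IsStrictChain (ULift.{u} C) where
  total x y := hC.total x.down y.down
  zero_ne h := hC.zero_ne (congrArg ULift.down h)
  cpl_eq_zero hx := ULift.ext _ _ (hC.cpl_eq_zero fun h => hx (ULift.ext _ _ h))

namespace ProductAlgebra

theorem isStrictChain : IsStrictChain unitInterval where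
  total := le_total
  zero_ne := zero_ne_one
  cpl_eq_zero {x} hx := by
    refine Subtype.ext ?_
    change (if (x : ℝ) ≤ (0 : unitInterval) then (1 : ℝ) else (0 : unitInterval) / x) = 0
    have h : ¬ (x : ℝ) ≤ (0 : unitInterval) := not_le.2 (unitInterval.pos_iff_ne_zero.2 hx)
    rw [if_neg h]
    exact zero_div _

theorem eq_one_of_mul_eq (x y : unitInterval) (hy : y ≠ 0) (h : x * y = y) : x = 1 := by
  have h' := congrArg Subtype.val h
  have hy' : (y : ℝ) ≠ 0 := fun k => hy (Subtype.ext k)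
  exact Subtype.ext (mul_right_cancel₀ hy' (h'.trans (one_mul _).symm))

end ProductAlgebra

theorem Xi_Gamma_not_adjoint : IsEmpty (Xi.{u} ⊣ Gamma.{u}) ∧ IsEmpty (Gamma.{u} ⊣ Xi.{u}) := by
  let P : BLCat.{u} := { carrier := ULift.{u} unitInterval }
  have hP : IsStrictChain P.carrier := ProductAlgebra.isStrictChain.uLift
  -- Any number strictly between `0` and `1` would serve.
  let x : unitInterval := ⟨1 / 2, by norm_num, by norm_num⟩
  have hne := Xi_map_cplCplHom_ne (P := P) (x := ⟨x⟩) hP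
    (fun x y hy h => ULift.ext _ _ (ProductAlgebra.eq_one_of_mul_eq x.down y.down
      (fun k => hy (ULift.ext _ _ k)) (congrArg ULift.down h)))
    (fun h => by simpa [x] using congrArg (fun z : ULift.{u} unitInterval => (z.down : ℝ)) h)
    (fun h => by
      have := congrArg (fun z : ULift.{u} unitInterval => (z.down : ℝ)) h
      change (1 / 2 : ℝ) = 1 at this
      norm_num at this)
  exact ⟨isEmpty_Xi_adj_Gamma hP hne, isEmpty_Gamma_adj_Xi hP hne⟩

namespace LUHom
variable {G H : LUGroup.{u}}

/-- The isomorphism defined by a bijective morphism. -/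
noncomputable def toIso (g : LUHom G H) (hg : Function.Bijective g.toFun) : G ≅ H :=
  let e := Equiv.ofBijective g.toFun hg
  have he : ∀ x, g.toFun (e.symm x) = x := e.apply_symm_apply
  { hom := g
    inv :=
      { toFun := e.symm
        map_add := fun x y => hg.1 (by rw [g.map_add, he, he, he])
        map_sup := fun x y => hg.1 (by rw [g.map_sup, he, he, he])
        map_inf := fun x y => hg.1 (by rw [g.map_inf, he, he, he])
        map_unit := hg.1 (by rw [he, g.map_unit]) }
    hom_inv_id := LUHom.ext (funext e.symm_apply_apply)
    inv_hom_id := LUHom.ext (funext e.apply_symm_apply) }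

theorem injective_of (g : LUHom G H) (h : ∀ x, g.toFun x = 0 → x = 0) :
    Function.Injective g.toFun := (injective_iff_map_eq_zero g.toAddHom).2 h

end LUHom

/-! ### The lexicographic group `𝐆` and its projection to `ℤ` -/

namespace LexGroup

/-- The element `(n, x)`. -/
def pt (n : ℤ) (x : ℝ) (hx : 0 < x) : lexGroup.carrier := toLex (n, Additive.ofMul ⟨x, hx⟩)

theorem exists_pt (z : lexGroup.carrier) : ∃ n x hx, pt n x hx = z :=
  ⟨(ofLex z).1, (Additive.toMul (ofLex z).2).1, (Additive.toMul (ofLex z).2).2, rfl⟩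

theorem pt_add (m n : ℤ) (x y : ℝ) (hx : 0 < x) (hy : 0 < y) :
    pt m x hx + pt n y hy = pt (m + n) (x * y) (mul_pos hx hy) := rfl

theorem pt_congr {m n : ℤ} {x y : ℝ} {hx : 0 < x} {hy : 0 < y} (h : m = n) (k : x = y) :
    pt m x hx = pt n y hy := by
  subst h k
  rfl

theorem pt_inj {m n : ℤ} {x y : ℝ} {hx : 0 < x} {hy : 0 < y} :
    pt m x hx = pt n y hy ↔ m = n ∧ x = y := by
  refine ⟨fun h => ⟨congrArg (fun z : ℤ ×ₗ RPos => (ofLex z).1) h,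
    congrArg (fun z : ℤ ×ₗ RPos => (Additive.toMul (ofLex z).2).1) h⟩, fun h => pt_congr h.1 h.2⟩

theorem pt_le {m n : ℤ} {x y : ℝ} {hx : 0 < x} {hy : 0 < y} :
    pt m x hx ≤ pt n y hy ↔ m < n ∨ m = n ∧ x ≤ y := Prod.Lex.le_iff

theorem le_total (x y : lexGroup.carrier) : x ≤ y ∨ y ≤ x :=
  _root_.le_total (α := ℤ ×ₗ RPos) x y

/-- The first coordinate. -/
def fst : lexGroup.carrier →+ ℤ where
  toFun z := (ofLex z).1
  map_zero' := rfl
  map_add' _ _ := rfl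

theorem fst_mono {x y : lexGroup.carrier} (h : x ≤ y) : fst x ≤ fst y := Prod.Lex.monotone_fst _ _ h

theorem fst_unit : fst lexGroup.unit = 1 := rfl

/-- The lexicographic order is total and the first coordinate is monotone, so joins are preserved.
-/
theorem fst_sup (x y : lexGroup.carrier) : fst (x ⊔ y) = fst x ⊔ fst y := by
  rcases le_total x y with h | h
  · rw [sup_eq_right.2 h, sup_eq_right.2 (fst_mono h)]
  · rw [sup_eq_left.2 h, sup_eq_left.2 (fst_mono h)]

theorem fst_inf (x y : lexGroup.carrier) : fst (x ⊓ y) = fst x ⊓ fst y := by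
  rcases le_total x y with h | h
  · rw [inf_eq_left.2 h, inf_eq_left.2 (fst_mono h)]
  · rw [inf_eq_right.2 h, inf_eq_right.2 (fst_mono h)]

/-- The endomorphism `(n, x) ↦ (n, 1)`. -/
noncomputable def collapse : LUHom lexGroup lexGroup :=
  have hmono : ∀ {m n : ℤ}, m ≤ n → pt m 1 one_pos ≤ pt n 1 one_pos := fun h =>
    pt_le.2 (h.lt_or_eq.imp_right fun k => ⟨k, le_rfl⟩)
  { toFun := fun z => pt (fst z) 1 one_pos
    map_add := fun x y => by
      rw [pt_add]
      exact pt_congr (map_add fst x y) (mul_one 1).symm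
    map_sup := fun x y => by
      rw [pt_congr (hy := one_pos) (fst_sup x y) rfl]
      rcases _root_.le_total (fst x) (fst y) with h | h
      · rw [sup_eq_right.2 (hmono h)]
        exact pt_congr (sup_eq_right.2 h) rfl
      · rw [sup_eq_left.2 (hmono h)]
        exact pt_congr (sup_eq_left.2 h) rfl
    map_inf := fun x y => by
      rw [pt_congr (hy := one_pos) (fst_inf x y) rfl]
      rcases _root_.le_total (fst x) (fst y) with h | h
      · rw [inf_eq_left.2 (hmono h)]
        exact pt_congr (inf_eq_left.2 h) rfl
      · rw [inf_eq_right.2 (hmono h)]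
        exact pt_congr (inf_eq_right.2 h) rfl
    map_unit := rfl }

theorem fst_eq_zero_or_one (z : GammaCarrier lexGroup) : fst z.1 = 0 ∨ fst z.1 = 1 := by
  have h0 := fst_mono z.2.1
  have h1 := fst_mono z.2.2
  rw [map_zero] at h0
  rw [fst_unit] at h1
  omega

/-- The homomorphism from `Γ 𝐆` to a BL-algebra sending `(0, x)` to `0` and `(1, x)` to `1`. -/
noncomputable def gammaHom (L : Type) [BLAlgebra L] : BLHom (GammaCarrier lexGroup) L where
  toFun z := if fst z.1 = 0 then 0 else 1
  map_mul x y := by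
    -- The first coordinate turns the operations of `[0, u]` into those of the interval `{0, 1}` of
    -- `ℤ`, so a truth table finishes.
    have h : fst (x * y).1 = (fst x.1 + fst y.1 - 1) ⊔ 0 := by
      rw [GammaCarrier.val_mul, fst_sup, map_sub, _root_.map_add, map_zero, fst_unit]
    rw [h]
    rcases fst_eq_zero_or_one x with hx | hx <;> rcases fst_eq_zero_or_one y with hy | hy <;>
      rw [hx, hy] <;> simp [mul_zero_all]
  map_imp x y := by
    have h : fst (imp x y).1 = (1 - fst x.1 + fst y.1) ⊓ 1 := by
      rw [GammaCarrier.val_imp, fst_inf, _root_.map_add, map_sub, fst_unit]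
    rw [h]
    rcases fst_eq_zero_or_one x with hx | hx <;> rcases fst_eq_zero_or_one y with hy | hy <;>
      rw [hx, hy] <;> simp [one_imp, zero_imp]
  map_zero := if_pos rfl
  map_one := if_neg one_ne_zero

end LexGroup

/-! ### Chang's group of the product algebra and the four hom-sets -/

namespace ProductAlgebra
open LexGroup

theorem isBLChain : IsBLChain unitInterval := isStrictChain.toIsBLChain

/-- The normal form of a good sequence. -/
noncomputable def normalForm (a : GoodSeq unitInterval) : ℕ × unitInterval :=
  Classical.choose (exists_R isBLChain a)

theorem valid_normalForm (a : GoodSeq unitInterval) : Valid (normalForm a) :=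
  (Classical.choose_spec (exists_R isBLChain a)).1

theorem val_eq_normalForm (a : GoodSeq unitInterval) : a.val = R (normalForm a) :=
  (Classical.choose_spec (exists_R isBLChain a)).2

theorem normalForm_eq {a : GoodSeq unitInterval} {p : ℕ × unitInterval} (hp : Valid p)
    (h : a.val = R p) : normalForm a = p :=
  R_inj (valid_normalForm a) hp ((val_eq_normalForm a).symm.trans h)

theorem snd_normalForm_pos (a : GoodSeq unitInterval) : 0 < ((normalForm a).2 : ℝ) :=
  unitInterval.pos_iff_ne_zero.2 (valid_normalForm a).1

/-- The map `(1, …, 1, x, 0, …) ↦ (n, x)`, where `n` is the place of `x`. -/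
noncomputable def toLexGroup (a : GoodSeq unitInterval) : lexGroup.carrier :=
  pt (normalForm a).1 (normalForm a).2 (snd_normalForm_pos a)

theorem toLexGroup_eq {a : GoodSeq unitInterval} {p : ℕ × unitInterval} (hp : Valid p)
    (h : a.val = R p) :
    toLexGroup a = pt p.1 p.2 (unitInterval.pos_iff_ne_zero.2 hp.1) := by
  have e := normalForm_eq hp h
  exact pt_congr (by rw [e]) (by rw [e])

/-- Nonzero elements have complement `0`, so `pp` is always in its second case: places add and
entries multiply, as in the lexicographic product. -/
theorem toLexGroup_add (a b : GoodSeq unitInterval) :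
    toLexGroup (a + b) = toLexGroup a + toLexGroup b := by
  have hp := valid_normalForm a
  have hq := valid_normalForm b
  have h := add_val isBLChain hp hq (val_eq_normalForm a) (val_eq_normalForm b)
  rw [toLexGroup_eq (hp.pp hq) h, toLexGroup, toLexGroup, pt_add]
  have e := pp_high (q := normalForm b) hp (isStrictChain.cpl_eq_zero hq.1)
  exact pt_congr (by rw [e]; exact Nat.cast_add _ _) (by rw [e]; rfl)

/-- It suffices to compare the two sequences at the last nonzero place of `a`. -/
theorem toLexGroup_mono {a b : GoodSeq unitInterval} (h : a ≤ b) :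
    toLexGroup a ≤ toLexGroup b := by
  have hp := (valid_normalForm a).1
  have h' : R (normalForm a) (normalForm a).1 ≤ R (normalForm b) (normalForm a).1 := by
    rw [← val_eq_normalForm, ← val_eq_normalForm]
    exact h _
  rw [R_eq] at h'
  refine pt_le.2 ?_
  rcases lt_trichotomy (normalForm a).1 (normalForm b).1 with k | k | k
  · exact Or.inl (Int.ofNat_lt.2 k)
  · rw [k, R_eq] at h'
    exact Or.inr ⟨congrArg _ k, h'⟩
  · rw [R_gt k] at h'
    exact absurd (le_zero.1 h') hp

theorem toLexGroup_injective : Function.Injective toLexGroup := by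
  intro a b h
  rw [toLexGroup, toLexGroup, pt_inj] at h
  have e : normalForm a = normalForm b := Prod.ext (Int.ofNat_inj.1 h.1) (Subtype.ext h.2)
  exact GoodSeq.ext (by rw [val_eq_normalForm a, e, ← val_eq_normalForm b])

/-- The morphism from `Ξ [0, 1]` to `𝐆`. -/
noncomputable def xiHom : LUHom (Xi.obj productAlgebra) lexGroup :=
  LUHom.ofGoodSeq (L := productAlgebra) toLexGroup toLexGroup_add
    (map_sup_of_mono isBLChain toLexGroup_mono)
    (toLexGroup_eq (valid_one one_ne_zero) (single_val 1))

/-- Good sequences already embed in `𝐆`, so a vanishing difference forces its two terms to be equal.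
-/
theorem xiHom_injective : Function.Injective xiHom.toFun := by
  refine xiHom.injective_of fun x hx => ?_
  obtain ⟨a, b, rfl⟩ := ChangGroup.exists_mk x
  change toLexGroup a - toLexGroup b = 0 at hx
  have e' := toLexGroup_injective (sub_eq_zero.1 hx)
  rw [e']
  exact ChangGroup.mk_eq_cls.2 rfl

/-- The place must be positive because at place `0` a normal form admits only the entry `1`. -/
theorem exists_toLexGroup {n : ℕ} (hn : n ≠ 0) {x : ℝ} (hx : 0 < x) (hx1 : x ≤ 1) :
    ∃ a, toLexGroup a = pt n x hx := by
  let p : ℕ × unitInterval := (n, ⟨x, hx.le, hx1⟩)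
  have hp : Valid p := ⟨fun h => hx.ne' (congrArg Subtype.val h), fun h => absurd h hn⟩
  exact ⟨⟨R p, R_val_zero hp, R_good p, n, fun i hi => R_gt hi⟩, toLexGroup_eq hp rfl⟩

theorem xiHom_surjective : Function.Surjective xiHom.toFun := by
  intro z
  obtain ⟨m, x, hx, rfl⟩ := exists_pt z
  have hx' : 0 < 1 + x := by linarith
  -- The positive real `x` is the quotient of `x / (1 + x)` and `1 / (1 + x)`, both in `(0, 1]`, and
  -- `m` is the difference of its positive and negative parts. The `+ 1` on both sides keeps the
  -- places positive and cancels.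
  obtain ⟨a, ha⟩ := exists_toLexGroup (n := m.toNat + 1) (by omega) (div_pos hx hx')
    ((div_le_one hx').2 (by linarith))
  obtain ⟨b, hb⟩ := exists_toLexGroup (n := (-m).toNat + 1) (by omega) (div_pos one_pos hx')
    ((div_le_one hx').2 (by linarith))
  refine ⟨ChangGroup.mk a b, ?_⟩
  change toLexGroup a - toLexGroup b = _
  rw [sub_eq_iff_eq_add, ha, hb, pt_add]
  exact pt_congr (by omega) (by field_simp)

/-- `Ξ [0, 1] ≅ 𝐆` -/
noncomputable def xiIso : Xi.obj productAlgebra ≅ lexGroup :=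
  xiHom.toIso ⟨xiHom_injective, xiHom_surjective⟩

/-- The morphism from `Ξ [0, 1]` to `𝐆` that forgets the second coordinate. -/
noncomputable def xiCollapse : Xi.obj productAlgebra ⟶ lexGroup :=
  xiIso.hom ≫ (show lexGroup ⟶ lexGroup from collapse)

theorem xiCollapse_ne : xiCollapse ≠ xiIso.hom := by
  intro h
  -- The collapse moves `(0, 2)`; any second coordinate other than `1` would do.
  obtain ⟨z, hz⟩ := xiHom_surjective (pt 0 2 two_pos)
  have h1 : collapse.toFun (xiHom.toFun z) = xiHom.toFun z :=
    congrArg (fun g : Xi.obj productAlgebra ⟶ lexGroup => LUHom.toFun g z) h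
  rw [hz] at h1
  have h2 := (pt_inj.1 (show pt 0 1 one_pos = pt 0 2 two_pos from h1)).2
  norm_num at h2

theorem subsingleton_hom_gamma : Subsingleton (productAlgebra ⟶ Gamma.obj lexGroup) :=
  BLHom.subsingleton_to_gamma (G := lexGroup) isStrictChain

theorem subsingleton_gamma_hom : Subsingleton (Gamma.obj lexGroup ⟶ productAlgebra) :=
  BLHom.subsingleton_of_gamma (G := lexGroup) isStrictChain le_total

theorem nontrivial_xi_hom : Nontrivial (Xi.obj productAlgebra ⟶ lexGroup) :=
  ⟨_, _, xiCollapse_ne⟩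

theorem nontrivial_hom_xi : Nontrivial (lexGroup ⟶ Xi.obj productAlgebra) := by
  refine ⟨𝟙 _ ≫ xiIso.inv, xiIso.inv ≫ xiCollapse ≫ xiIso.inv, fun h => xiCollapse_ne ?_⟩
  rw [← Category.assoc, cancel_mono, Iso.eq_inv_comp, Category.comp_id] at h
  exact h.symm

/-- No computation with `g` is needed: `Γ(g) η` and `f` lie in a hom-set with at most one element.
Hence every `g` factors `f`, and uniqueness of the factorization fails. -/
theorem eta_comp_eq (g : Xi.obj productAlgebra ⟶ lexGroup)
    (f : productAlgebra ⟶ Gamma.obj lexGroup) (a : productAlgebra.carrier) :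
    LUHom.toFun g (etaElt productAlgebra a) = gammaIncl lexGroup (BLHom.toFun f a) := by
  rw [← subsingleton_hom_gamma.elim (eta.app productAlgebra ≫ Gamma.map g) f]
  rfl

end ProductAlgebra

end Auxiliary

theorem mainTheorem12 :
    -- neither order of the two functors gives an adjoint pair
    IsEmpty (Xi.{u} ⊣ Gamma.{u}) ∧ IsEmpty (Gamma.{u} ⊣ Xi.{u}) ∧
    -- the four sets of morphisms of the example
    (∃ e : Xi.obj productAlgebra ≅ lexGroup,
      ∃ f : Xi.obj productAlgebra ⟶ lexGroup, f ≠ e.hom ∧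
        ∀ z, LUHom.toFun f z = toLex ((ofLex (LUHom.toFun e.hom z)).1, RPos.one)) ∧
    Nontrivial (lexGroup ⟶ Xi.obj productAlgebra) ∧
    Nonempty (Unique (productAlgebra ⟶ Gamma.obj lexGroup)) ∧
    (∃ f : Gamma.obj lexGroup ⟶ productAlgebra, (∀ h, h = f) ∧
      ∀ z, BLHom.toFun f z =
        if (ofLex (gammaIncl lexGroup z)).1 = 0 then (0 : unitInterval) else 1) ∧
    IsEmpty ((Xi.obj productAlgebra ⟶ lexGroup) ≃ (productAlgebra ⟶ Gamma.obj lexGroup)) ∧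
    IsEmpty ((Gamma.obj lexGroup ⟶ productAlgebra) ≃ (lexGroup ⟶ Xi.obj productAlgebra)) ∧
    -- the natural transformation and the factorization through it
    (∃ η : 𝟭 BLCat.{u} ⟶ Xi.{u} ⋙ Gamma.{u},
      (∀ (L : BLCat.{u}) (a : L.carrier),
        gammaIncl (Xi.obj L) (BLHom.toFun (η.app L) a) = etaElt L a) ∧
      ∀ (L : BLCat.{u}) (G : LUGroup.{u}) (f : L ⟶ Gamma.obj G),
        ∃ g : Xi.obj L ⟶ G, η.app L ≫ Gamma.map g = f) ∧
    -- the factorization is not unique in general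
    (∃ (f : productAlgebra ⟶ Gamma.obj lexGroup) (g₁ g₂ : Xi.obj productAlgebra ⟶ lexGroup),
      g₁ ≠ g₂ ∧
      (∀ a, LUHom.toFun g₁ (etaElt productAlgebra a) = gammaIncl lexGroup (BLHom.toFun f a)) ∧
      ∀ a, LUHom.toFun g₂ (etaElt productAlgebra a) = gammaIncl lexGroup (BLHom.toFun f a)) := by
  have s₁ := ProductAlgebra.subsingleton_hom_gamma
  have s₂ := ProductAlgebra.subsingleton_gamma_hom
  have n₁ := ProductAlgebra.nontrivial_xi_hom
  have n₂ := ProductAlgebra.nontrivial_hom_xi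
  -- The hom-set is known to have at most one element; this composite shows that it is inhabited.
  let f : productAlgebra ⟶ Gamma.obj lexGroup :=
    eta.app productAlgebra ≫ Gamma.map ProductAlgebra.xiIso.hom
  refine ⟨Xi_Gamma_not_adjoint.1, Xi_Gamma_not_adjoint.2,
    ⟨ProductAlgebra.xiIso, ProductAlgebra.xiCollapse, ProductAlgebra.xiCollapse_ne, fun _ => rfl⟩,
    n₂, ⟨⟨⟨f⟩, fun _ => Subsingleton.elim _ _⟩⟩,
    ⟨LexGroup.gammaHom unitInterval, fun _ => s₂.elim _ _, fun _ => rfl⟩,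
    ⟨fun e => not_subsingleton _ e.subsingleton⟩, ⟨fun e => not_subsingleton _ e.symm.subsingleton⟩,
    ⟨eta, fun _ _ => rfl, exists_eta_comp⟩,
    f, ProductAlgebra.xiCollapse, ProductAlgebra.xiIso.hom, ProductAlgebra.xiCollapse_ne,
    ProductAlgebra.eta_comp_eq _ _, ProductAlgebra.eta_comp_eq _ _⟩
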